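/- Let $\langle x\rangle=(1+x^2)^{1/2}$, let $L^{2,s}(\mathbb R)=\{f:\langle x\rangle^s f\in L^2(\mathbb R)\}$ with $\|f\|_{L^{2,s}}=\|\langle x\rangle^s f\|_{L^2}$, let $H^{1,1}(\mathbb R)=\{f: f,f'\in L^{2,1}(\mathbb R)\}$ with $\|f\|_{H^{1,1}}=\|f\|_{L^{2,1}}+\|f'\|_{L^{2,1}}$ (weak derivative), and equip $X=H^{1,1}(\mathbb R)\cap L^{2,3}(\mathbb R)$ and $Y=H^3(\mathbb R)\cap H^{1,1}(\mathbb R)$ with the sums of the norms. Elements of $X$ are complex valued and identified with their continuous representatives. Let $\sigma\in\{1,-1\}$. For $r_1,r_2\in X$ with $|r_1(z)|<1$ and $|r_2(z)|<1$ for all $z\in\mathbb R$, and for $x\in\mathbb R$, consider the Riemann–Hilbert problem: find a $2\times2$ matrix function $M(x;\cdot)$, analytic in $\mathbb C\setminus\mathbb R$, with boundary values $M_\pm(x;z)$, $z\in\mathbb R$, from $\{\pm\operatorname{Im}z>0\}$, such that $M(x;z)=I+\mathcal O(z^{-1})$ as $z\to\infty$ and $$M_+(x;z)=M_-(x;z)\begin{pmatrix}1+\sigma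 r_1(z)r_2(z)&\sigma r_2(z)e^{2ixz}\\ r_1(z)e^{-2ixz}&1\end{pmatrix},\qquad z\in\mathbb R .$$ **Proposition.** For all such $r_1,r_2$ and every $x\in\mathbb R$ this problem has exactly one solution, and the limits (over $z\to\infty$ in $\mathbb C\setminus\mathbb R$) in the reconstruction formulas $$u(x)=2i\lim_{z\to\infty}zM_{12}(x;z),\qquad w(-x)=2i\sigma\lim_{z\to\infty}zM_{21}(x;z),\qquad x\in\mathbb R,$$ exist. (When $r_1,r_2$ are the reflection coefficients of a potential of the nonlocal mKdV spectral problem, both formulas give that potential, $u=w$.) Moreover $u\in Y$ and $w\in Y$, and for all $\delta<1$ and $\rho$ there is a constant $c=c(\delta,\rho)$ such that, whenever $|r_j(z)|\le\delta$ for all $z\in\mathbb{R}$ and $\|r_j\|_X\le\rho$ $(j=1,2)$, $$\|u\|_{Y}\le c\,(\|r_1\|_{X}+\|r_2\|_{X}),$$ and the map $(r_1,r_2)\mapsto u$ is Lipschitz continuous on the set of these pairs: if $(\tilde r_1,\tilde r_2)$ satisfies the same conditions and $\tilde u$ (and $\tilde w$) is reconstructed from it, then $$\|u-\tilde u\|_{Y}\le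 c\,(\|r_1-\tilde r_1\|_{X}+\|r_2-\tilde r_2\|_{X}).$$ The same two bounds hold for $w$, $w-\tilde w$ in place of $u$, $u-\tilde u$. -/

import Mathlib

open scoped ContDiff
open Filter Topology MeasureTheory

noncomputable section

namespace NonlocalMKdV

/-! ### Weighted Lebesgue spaces and Sobolev spaces on the real line -/

/-- The weight `⟨x⟩ = (1 + x²)^{1/2}`. -/
def bracket (x : ℝ) : ℝ := Real.sqrt (1 + x ^ 2)

/-- `g` is the weak (distributional) derivative of `f` on `ℝ`. -/
structure HasWeakDeriv (f g : ℝ → ℂ) : Prop where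
  locallyIntegrable : LocallyIntegrable f
  locallyIntegrable_deriv : LocallyIntegrable g
  integral_eq : ∀ φ : ℝ → ℂ, ContDiff ℝ ∞ φ → HasCompactSupport φ →
    ∫ x, f x * deriv φ x = - ∫ x, g x * φ x

open Classical in
/-- The weak derivative of `f` (determined up to a null set), and `0` if there is none. -/
def weakDeriv (f : ℝ → ℂ) : ℝ → ℂ :=
  if h : ∃ g, HasWeakDeriv f g then h.choose else 0

/-- `f ∈ L^{2,s}(ℝ)`, that is, `⟨x⟩^s f ∈ L²(ℝ)`. -/
def MemL2w (s : ℕ) (f : ℝ → ℂ) : Prop :=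
  MemLp (fun x => ((bracket x ^ s : ℝ) : ℂ) * f x) 2 volume

/-- The norm `‖⟨x⟩^s f‖_{L²}` of `L^{2,s}(ℝ)`. -/
def normL2w (s : ℕ) (f : ℝ → ℂ) : ℝ :=
  (eLpNorm (fun x => ((bracket x ^ s : ℝ) : ℂ) * f x) 2 volume).toReal

/-- `f ∈ H^k(ℝ)`: the weak derivatives of order at most `k` exist and lie in `L²(ℝ)`. -/
structure MemH (k : ℕ) (f : ℝ → ℂ) : Prop where
  hasWeakDeriv : ∀ j < k, HasWeakDeriv (weakDeriv^[j] f) (weakDeriv^[j + 1] f)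
  memL2 : ∀ j ≤ k, MemL2w 0 (weakDeriv^[j] f)

/-- The norm of `H^k(ℝ)`, as the sum of the `L²` norms of the derivatives. -/
def normH (k : ℕ) (f : ℝ → ℂ) : ℝ :=
  ∑ j ∈ Finset.range (k + 1), normL2w 0 (weakDeriv^[j] f)

/-- `f ∈ H^{1,1}(ℝ)`: `f` and its weak derivative lie in `L^{2,1}(ℝ)`. -/
structure MemH11 (f : ℝ → ℂ) : Prop where
  hasWeakDeriv : HasWeakDeriv f (weakDeriv f)
  memL2w : MemL2w 1 f
  memL2w_deriv : MemL2w 1 (weakDeriv f)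

/-- The norm of `H^{1,1}(ℝ)`. -/
def normH11 (f : ℝ → ℂ) : ℝ := normL2w 1 f + normL2w 1 (weakDeriv f)

/-- `r ∈ H^{1,1}(ℝ) ∩ L^{2,3}(ℝ)`, the space of the reflection coefficients. -/
def MemX (r : ℝ → ℂ) : Prop := MemH11 r ∧ MemL2w 3 r

/-- The norm of `H^{1,1}(ℝ) ∩ L^{2,3}(ℝ)`. -/
def normX (r : ℝ → ℂ) : ℝ := normH11 r + normL2w 3 r

/-- `u ∈ H³(ℝ) ∩ H^{1,1}(ℝ)`, the space of the potentials. -/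
def MemY (u : ℝ → ℂ) : Prop := MemH 3 u ∧ MemH11 u

/-- The norm of `H³(ℝ) ∩ H^{1,1}(ℝ)`. -/
def normY (u : ℝ → ℂ) : ℝ := normH 3 u + normH11 u

/-! ### The Riemann–Hilbert problem -/

/-- An element of `H^{1,1}(ℝ) ∩ L^{2,3}(ℝ)`, given by its continuous representative,
of modulus less than `1` everywhere. -/
structure IsReflection (r : ℝ → ℂ) : Prop where
  continuous : Continuous r
  memX : MemX r
  norm_lt_one : ∀ z, ‖r z‖ < 1

/-- The jump matrix `V_x(z)`. -/
def jump (σ : ℝ) (r₁ r₂ : ℝ → ℂ) (x z : ℝ) : Matrix (Fin 2) (Fin 2) ℂ :=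
  !![1 + σ * r₁ z * r₂ z, σ * r₂ z * Complex.exp (2 * Complex.I * x * z);
     r₁ z * Complex.exp (-(2 * Complex.I * x * z)), 1]

/-- The complex plane without the real line. -/
def offReal : Set ℂ := {z | z.im ≠ 0}

/-- The filter `z → ∞`, `z ∈ ℂ \ ℝ`. -/
def atInfinity : Filter ℂ := Bornology.cobounded ℂ ⊓ 𝓟 offReal

/-- `M` solves the Riemann–Hilbert problem with parameter `x`: it is analytic in `ℂ \ ℝ`, equals
`I + O(1/z)` at infinity, has boundary values `M₊`, `M₋` on the real line from the upper and from
the lower half-plane, and `M₊ = M₋ V_x`. The values of `M` on the real line itself play no role. -/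
structure IsRHSolution (σ : ℝ) (r₁ r₂ : ℝ → ℂ) (x : ℝ) (M : ℂ → Matrix (Fin 2) (Fin 2) ℂ) :
    Prop where
  analytic : ∀ i j, DifferentiableOn ℂ (fun z => M z i j) offReal
  normalized : ∀ i j, (fun z => M z i j - (1 : Matrix (Fin 2) (Fin 2) ℂ) i j)
    =O[atInfinity] (fun z : ℂ => z⁻¹)
  boundary : ∃ Mp Mm : ℝ → Matrix (Fin 2) (Fin 2) ℂ, ∀ s : ℝ,
    Tendsto M (𝓝[{z : ℂ | 0 < z.im}] (s : ℂ)) (𝓝 (Mp s)) ∧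
    Tendsto M (𝓝[{z : ℂ | z.im < 0}] (s : ℂ)) (𝓝 (Mm s)) ∧
    Mp s = Mm s * jump σ r₁ r₂ x s

/-- The reconstruction formulas: `u x = 2 i lim z M₁₂(x, z)` and `w (-x) = 2 i σ lim z M₂₁(x, z)`
for every real `x`, the limits being over `z → ∞` in `ℂ \ ℝ`. When `r₁`, `r₂` are the reflection
coefficients of a potential, the two formulas give the same function `u = w`. -/
def IsReconstruction (σ : ℝ) (r₁ r₂ u w : ℝ → ℂ) : Prop :=
  ∀ x : ℝ, ∃ M : ℂ → Matrix (Fin 2) (Fin 2) ℂ, IsRHSolution σ r₁ r₂ x M ∧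
    Tendsto (fun z : ℂ => 2 * Complex.I * (z * M z 0 1)) atInfinity (𝓝 (u x)) ∧
    Tendsto (fun z : ℂ => 2 * Complex.I * σ * (z * M z 1 0)) atInfinity (𝓝 (w (-x)))

end NonlocalMKdV

end

open NonlocalMKdV

noncomputable section

namespace NonlocalMKdV

open FourierTransform
open scoped ENNReal

section

/-! ### Calculus of absolutely continuous functions -/

/-! The sign is absorbed into the second coefficient. Put `x = -π s`, `p = σ r₂` and `ρ(z) =
r₁(-z)`, write `F_p` for the Fourier transform of `p`, and let `Γ_p` be the Hankel operator with
kernel `F_p(y + y')`. On the Fourier side a row of the Riemann–Hilbert problem becomes a Marchenko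
equation `(1 + K_s) A = -1_{(0,∞)} Γ_ρ 1_{(s,∞)} F_p` with `K_s = 1_{(0,∞)} Γ_ρ 1_{(s,∞)} Γ_p
1_{(0,∞)}`.

Solvability. `Γ_p` is multiplication by `p` between two Fourier transforms, so its norm is at most
`sup |p|`, and `‖K_s‖ ≤ δ² < 1` for every `s` (`norm_Gam_le`, `isUnit_opK_of_bound`). The `L²`
solution gives kernels that are integrable with integrable derivatives (`integrable_cut_solB`), and
their Cauchy transforms are the entries of `M` (`exists_row`, `exists_isRHSolution`). The
coefficient of `1/z` is the value of a kernel at its end point, so the potential is a multiple of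
`U(s) = F_p(s) + ∫ F_p(s + y) A_s(y) dy` over `y > 0`. Uniqueness is Liouville's theorem for `M'
adj(M)` (`IsRHSolution.unique`).

Regularity and decay. Moving the cut-off at `s` changes `K_s` by rank one operators, so the
derivatives of `U` are polynomials in finitely many pairings of derivatives of `F_p` and `F_ρ` with
the resolvent and with `A` (`hasDerivAt_solA`, `hasDerivAt_bb`), apart from the derivatives of `F_p`
itself. The space `X` is what this needs: `L^{2,3}` gives three derivatives of `F_p` in `L²`, and
`H^{1,1}` gives the weight on `F_p` and on its first derivative. Tails of `F_p` decay as `s → +∞`,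
which yields the `Y` bounds on every half-line bounded below (`exists_localEst`).

As `s → -∞` these tails do not decay. There `M` is multiplied by a diagonal matrix built from the
scalar function with jump `1 + ρ(-z) p(z)`, and `z` is replaced by `-z`; the result is a problem of
the same form at `-s` with new symbols (`IsRHSolution.deform`, `exists_deformed`). These may exceed
`1` in modulus, but far out on the half-line the Hankel operator is small because its kernel decays
(`exists_isUnit_of_le`). The two half-lines overlap and the estimates are glued (`LocalEst.glue`,
`exists_inY`).

Lipschitz continuity. The bound in `Y` is uniform on bounded sets of complex symbols, and `U`
depends holomorphically on them. On the complex line through two pairs of symbols at distance `d`,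
the potential is holomorphic and bounded in a disc of radius comparable to `1/d`, so the Schwarz
lemma bounds the difference by a multiple of `d` (`InY.sub_of_differentiableOn`, `exists_inY_sub`).
The norm bound is the comparison with the zero pair. The function `w` is obtained from `M₂₁` by the
symmetry `z ↦ -z`, which turns it into the `M₁₂` of the problem with the two coefficients exchanged.
-/

theorem intervalIntegrable_of_locallyIntegrable {g : ℝ → ℂ} (h : LocallyIntegrable g) (a b : ℝ) :
    IntervalIntegrable g volume a b :=
  (h.integrableOn_isCompact isCompact_uIcc).intervalIntegrable

/-- `f` is a primitive of the locally integrable function `g`. -/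
structure IsPrim (f g : ℝ → ℂ) : Prop where
  loc : LocallyIntegrable g
  eq : ∀ a b : ℝ, ∫ x in a..b, g x = f b - f a

theorem IsPrim.intervalIntegrable {f g : ℝ → ℂ} (h : IsPrim f g) (a b : ℝ) :
    IntervalIntegrable g volume a b :=
  intervalIntegrable_of_locallyIntegrable h.loc a b

theorem IsPrim.eq_add {f g : ℝ → ℂ} (h : IsPrim f g) (a x : ℝ) :
    f x = f a + ∫ t in a..x, g t := by
  rw [h.eq a x]; ring

theorem IsPrim.continuous {f g : ℝ → ℂ} (h : IsPrim f g) : Continuous f := by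
  have : f = fun x => f 0 + ∫ t in (0 : ℝ)..x, g t := funext fun x => h.eq_add 0 x
  rw [this]
  exact continuous_const.add (intervalIntegral.continuous_primitive h.intervalIntegrable 0)

/-- The sums in the definition of absolute continuity are squeezed by those of `f`. Used twice: to
compare a primitive with the primitive of the modulus of the integrand, and for composition with a
Lipschitz map. -/
theorem absolutelyContinuousOnInterval_of_dist_le {X Y : Type*} [PseudoMetricSpace X]
    [PseudoMetricSpace Y] {f : ℝ → X} {g : ℝ → Y} {a b L : ℝ}
    (hf : AbsolutelyContinuousOnInterval f a b)
    (h : ∀ x ∈ Set.uIcc a b, ∀ y ∈ Set.uIcc a b, dist (g x) (g y) ≤ L * dist (f x) (f y)) :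
    AbsolutelyContinuousOnInterval g a b := by
  unfold AbsolutelyContinuousOnInterval at hf ⊢
  refine squeeze_zero' ?_ ?_ (by simpa using hf.const_mul L)
  · exact Filter.Eventually.of_forall fun _ => Finset.sum_nonneg fun i _ => dist_nonneg
  rw [eventually_inf_principal]
  filter_upwards with ⟨n, I⟩ hnI
  rw [Finset.mul_sum]
  exact Finset.sum_le_sum fun i hi => h _ (hnI.left i hi).1 _ (hnI.left i hi).2

theorem IsPrim.absolutelyContinuous {f g : ℝ → ℂ} (h : IsPrim f g) (a b : ℝ) :
    AbsolutelyContinuousOnInterval f a b := by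
  have hn : ∀ u v, IntervalIntegrable (fun x => ‖g x‖) volume u v := fun u v =>
    (h.intervalIntegrable u v).norm
  have h1 := (hn a b).absolutelyContinuousOnInterval_intervalIntegral (c := a) (by simp)
  refine absolutelyContinuousOnInterval_of_dist_le (L := 1) h1 fun x _ y _ => ?_
  rw [one_mul, dist_comm, dist_eq_norm, ← h.eq x y, dist_comm, dist_eq_norm,
    intervalIntegral.integral_interval_sub_left (hn _ _) (hn _ _)]
  exact intervalIntegral.norm_integral_le_abs_integral_norm

theorem IsPrim.ae_hasDerivAt {f g : ℝ → ℂ} (h : IsPrim f g) :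
    ∀ᵐ x, HasDerivAt f (g x) x := by
  filter_upwards [LocallyIntegrable.ae_hasDerivAt_integral h.loc] with x hx
  have := (hx 0).const_add (f 0)
  refine this.congr_of_eventuallyEq (Eventually.of_forall fun y => ?_)
  simpa using h.eq_add 0 y

/-- Subtracting a primitive of `g` leaves an absolutely continuous function whose derivative
vanishes almost everywhere, hence a constant. -/
theorem IsPrim.of_absolutelyContinuous {f g : ℝ → ℂ} (hg : LocallyIntegrable g)
    (hf : ∀ a b, AbsolutelyContinuousOnInterval f a b) (hd : ∀ᵐ x, HasDerivAt f (g x) x) :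
    IsPrim f g := by
  refine ⟨hg, fun a b => ?_⟩
  have hP : IsPrim (fun x => ∫ t in a..x, g t) g := ⟨hg, fun u v => by
    rw [intervalIntegral.integral_interval_sub_left] <;> exact intervalIntegrable_of_locallyIntegrable hg _ _⟩
  have h1 := (hf a b).fun_sub (hP.absolutelyContinuous a b)
  have h2 : ∀ᵐ x, x ∈ Set.uIcc a b → HasDerivAt (fun x => f x - ∫ t in a..x, g t) 0 x := by
    filter_upwards [hd, hP.ae_hasDerivAt] with x h3 h4 _
    have := h3.sub h4
    rwa [sub_self] at this
  obtain ⟨C, hC⟩ := h1.const_of_ae_hasDerivAt_zero h2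
  have ha := hC a (by simp)
  have hb := hC b (by simp)
  simp only [intervalIntegral.integral_same, sub_zero] at ha
  rw [ha, ← hb]; ring

theorem IsPrim.mul {f f' g g' : ℝ → ℂ} (hf : IsPrim f f') (hg : IsPrim g g') :
    IsPrim (fun x => f x * g x) (fun x => f' x * g x + f x * g' x) := by
  refine IsPrim.of_absolutelyContinuous ?_
    (fun a b => (hf.absolutelyContinuous a b).fun_smul (hg.absolutelyContinuous a b)) ?_
  · refine LocallyIntegrable.add ?_ ?_
    · simpa [mul_comm] using hf.loc.continuous_smul hg.continuous
    · simpa using hg.loc.continuous_smul hf.continuous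
  · filter_upwards [hf.ae_hasDerivAt, hg.ae_hasDerivAt] with x h1 h2
    exact h1.mul h2

theorem IsPrim.add {f f' g g' : ℝ → ℂ} (hf : IsPrim f f') (hg : IsPrim g g') :
    IsPrim (fun x => f x + g x) (fun x => f' x + g' x) := by
  refine ⟨hf.loc.add hg.loc, fun a b => ?_⟩
  rw [intervalIntegral.integral_add (hf.intervalIntegrable a b) (hg.intervalIntegrable a b),
    hf.eq, hg.eq]
  ring

theorem IsPrim.sub {f f' g g' : ℝ → ℂ} (hf : IsPrim f f') (hg : IsPrim g g') :
    IsPrim (fun x => f x - g x) (fun x => f' x - g' x) := by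
  refine ⟨hf.loc.sub hg.loc, fun a b => ?_⟩
  rw [intervalIntegral.integral_sub (hf.intervalIntegrable a b) (hg.intervalIntegrable a b),
    hf.eq, hg.eq]
  ring

theorem IsPrim.const_mul {f f' : ℝ → ℂ} (hf : IsPrim f f') (c : ℂ) :
    IsPrim (fun x => c * f x) (fun x => c * f' x) := by
  refine ⟨by simpa using hf.loc.continuous_smul (continuous_const (y := c)), fun a b => ?_⟩
  rw [intervalIntegral.integral_const_mul, hf.eq]
  ring

theorem IsPrim.of_hasDerivAt {f f' : ℝ → ℂ} (hf : ∀ x, HasDerivAt f (f' x) x)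
    (hf' : Continuous f') : IsPrim f f' :=
  ⟨hf'.locallyIntegrable, fun a b => intervalIntegral.integral_eq_sub_of_hasDerivAt
    (fun x _ => hf x) (hf'.intervalIntegrable a b)⟩

theorem IsPrim.comp_mul {f g : ℝ → ℂ} (hf : IsPrim f g) {c : ℝ} (hc : c ≠ 0) :
    IsPrim (fun x => f (c * x)) (fun x => c * g (c * x)) := by
  have hi : ∀ a b : ℝ, IntervalIntegrable (fun x => (c : ℂ) * g (c * x)) volume a b := by
    intro a b
    have := ((hf.intervalIntegrable (c * a) (c * b)).comp_mul_left (c := c))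
    simp only [mul_div_cancel_left₀ _ hc] at this
    exact this.const_mul _
  refine ⟨?_, fun a b => ?_⟩
  · rw [MeasureTheory.locallyIntegrable_iff]
    intro k hk
    obtain ⟨R, hR⟩ := hk.isBounded.subset_closedBall 0
    rw [Real.closedBall_eq_Icc] at hR
    refine IntegrableOn.mono_set ?_ hR
    by_cases h : 0 - R ≤ 0 + R
    · exact (intervalIntegrable_iff_integrableOn_Icc_of_le h).1 (hi _ _)
    · rw [Set.Icc_eq_empty h]
      exact integrableOn_empty
  · rw [intervalIntegral.integral_const_mul, intervalIntegral.integral_comp_mul_left _ hc, hf.eq]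
    simp only [Complex.real_smul]
    push_cast
    have : (c : ℂ) ≠ 0 := by exact_mod_cast hc
    field_simp

theorem IsPrim.comp_neg {f g : ℝ → ℂ} (hf : IsPrim f g) :
    IsPrim (fun x => f (-x)) (fun x => -g (-x)) := by
  simpa using hf.comp_mul (c := -1) (by norm_num)

/-- The mean value inequality on the convex set makes `φ` Lipschitz there, so the composition stays
absolutely continuous and the chain rule holds almost everywhere. Needed for the logarithm and the
exponential of symbols. -/
theorem IsPrim.comp_holomorphic {f g : ℝ → ℂ} (hf : IsPrim f g) {φ φ' : ℂ → ℂ} {C : Set ℂ}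
    {L : ℝ} (hC : Convex ℝ C) (hφ : ∀ w ∈ C, HasDerivAt φ (φ' w) w)
    (hL : ∀ w ∈ C, ‖φ' w‖ ≤ L) (hφ' : ContinuousOn φ' C) (hfC : ∀ x, f x ∈ C) :
    IsPrim (fun x => φ (f x)) (fun x => φ' (f x) * g x) := by
  refine IsPrim.of_absolutelyContinuous ?_ (fun a b => ?_) ?_
  · have : Continuous fun x => φ' (f x) := hφ'.comp_continuous hf.continuous hfC
    simpa using hf.loc.continuous_smul this
  · refine absolutelyContinuousOnInterval_of_dist_le (L := L) (hf.absolutelyContinuous a b)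
      fun x _ y _ => ?_
    rw [dist_eq_norm, dist_eq_norm]
    exact hC.norm_image_sub_le_of_norm_hasDerivWithin_le
      (fun w hw => (hφ w hw).hasDerivWithinAt) hL (hfC y) (hfC x)
  · filter_upwards [hf.ae_hasDerivAt] with x hx
    exact (hφ _ (hfC x)).comp x hx

/-! ### Weak derivatives -/

theorem IsPrim.hasWeakDeriv {f g : ℝ → ℂ} (h : IsPrim f g) : HasWeakDeriv f g := by
  refine ⟨h.continuous.locallyIntegrable, h.loc, fun φ hφ hc => ?_⟩
  have hφ' : IsPrim φ (deriv φ) :=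
    IsPrim.of_hasDerivAt (fun x => (hφ.differentiable (by simp) x).hasDerivAt)
      (hφ.continuous_deriv (by simp))
  have hm := h.mul hφ'
  obtain ⟨R, hR⟩ := hc.isCompact.isBounded.subset_closedBall 0
  have hz : ∀ x, R < |x| → φ x = 0 := fun x hx => image_eq_zero_of_notMem_tsupport fun hmem => by
    have := hR hmem
    rw [mem_closedBall_zero_iff, Real.norm_eq_abs] at this
    linarith
  have hz' : ∀ x, R < |x| → deriv φ x = 0 := fun x hx => by
    refine image_eq_zero_of_notMem_tsupport fun hmem => ?_
    have := hR (tsupport_deriv_subset hmem)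
    rw [mem_closedBall_zero_iff, Real.norm_eq_abs] at this
    linarith
  -- Strictly larger than the support radius, so that `φ` vanishes at both end points and the
  -- boundary terms of `f φ` disappear.
  set S := |R| + 1
  have hRS : R < S := by have := le_abs_self R; simp only [S]; linarith
  have hS : 0 < S := by positivity
  have key := hm.eq (-S) S
  rw [hz S (by rw [abs_of_pos hS]; exact hRS), hz (-S) (by rw [abs_neg, abs_of_pos hS]; exact hRS)]
    at key
  have i1 : Integrable fun x => g x * φ x := by
    have := h.loc.integrable_smul_left_of_hasCompactSupport hφ.continuous hc
    simpa [mul_comm] using this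
  have i2 : Integrable fun x => f x * deriv φ x := by
    have := (h.continuous.locallyIntegrable (μ := volume)).integrable_smul_left_of_hasCompactSupport
      (hφ.continuous_deriv (by simp)) hc.deriv
    simpa [mul_comm] using this
  rw [intervalIntegral.integral_eq_integral_of_support_subset] at key
  · rw [integral_add i1 i2] at key
    simp only [mul_zero, sub_zero] at key
    exact eq_neg_of_add_eq_zero_right key
  · intro x hx
    by_contra hx'
    apply hx
    have : S ≤ |x| := by
      rw [Set.mem_Ioc, not_and_or, not_lt, not_le] at hx'
      rcases hx' with h1 | h1
      · exact le_abs.2 (Or.inr (by linarith))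
      · exact le_abs.2 (Or.inl h1.le)
    simp [hz x (by linarith), hz' x (by linarith)]

theorem HasWeakDeriv.congr_ae {f g f₁ g₁ : ℝ → ℂ} (h : HasWeakDeriv f g) (hf : f =ᵐ[volume] f₁)
    (hg : g =ᵐ[volume] g₁) : HasWeakDeriv f₁ g₁ := by
  refine ⟨(locallyIntegrable_congr hf).1 h.1, (locallyIntegrable_congr hg).1 h.2, fun φ h1 h2 => ?_⟩
  have e1 : ∫ x, f₁ x * deriv φ x = ∫ x, f x * deriv φ x :=
    integral_congr_ae (hf.mono fun x hx => by simp only [hx])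
  have e2 : ∫ x, g₁ x * φ x = ∫ x, g x * φ x :=
    integral_congr_ae (hg.mono fun x hx => by simp only [hx])
  rw [e1, e2]
  exact h.3 φ h1 h2

theorem HasWeakDeriv.ae_eq {f g h : ℝ → ℂ} (hg : HasWeakDeriv f g) (hh : HasWeakDeriv f h) :
    g =ᵐ[volume] h := by
  refine ae_eq_of_integral_contDiff_smul_eq hg.2 hh.2 fun φ h1 h2 => ?_
  have h3 : ContDiff ℝ ∞ fun x => (φ x : ℂ) := Complex.ofRealCLM.contDiff.comp h1
  have h4 : HasCompactSupport fun x => (φ x : ℂ) := h2.comp_left (g := Complex.ofReal) (by simp)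
  have := (hg.3 _ h3 h4).symm.trans (hh.3 _ h3 h4)
  simpa [mul_comm] using this

theorem HasWeakDeriv.weakDeriv_ae_eq {f g : ℝ → ℂ} (h : HasWeakDeriv f g) :
    weakDeriv f =ᵐ[volume] g := by
  have hex : ∃ g, HasWeakDeriv f g := ⟨g, h⟩
  have : weakDeriv f = hex.choose := by simp only [weakDeriv, hex, dif_pos]
  rw [this]
  exact hex.choose_spec.ae_eq h

theorem HasWeakDeriv.hasWeakDeriv_weakDeriv {f g : ℝ → ℂ} (h : HasWeakDeriv f g) :
    HasWeakDeriv f (weakDeriv f) :=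
  h.congr_ae (EventuallyEq.refl _ _) h.weakDeriv_ae_eq.symm

/-- A locally integrable function with vanishing weak derivative is constant. -/
theorem HasWeakDeriv.ae_const {f : ℝ → ℂ} (h : HasWeakDeriv f 0) :
    ∃ c, f =ᵐ[volume] fun _ => c := by
  obtain ⟨η⟩ : Nonempty (ContDiffBump (0 : ℝ)) := ⟨⟨1, 2, one_pos, one_lt_two⟩⟩
  set ν : ℝ → ℝ := η.normed volume
  have hν : ContDiff ℝ ∞ ν := η.contDiff_normed
  have hνc : HasCompactSupport ν := η.hasCompactSupport_normed
  have hνi : ∫ x, ν x = 1 := η.integral_normed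
  refine ⟨∫ x, ν x • f x, ae_eq_of_integral_contDiff_smul_eq h.1
    continuous_const.locallyIntegrable fun φ h1 h2 => ?_⟩
  set m := ∫ x, φ x
  -- Subtracting the multiple of the bump with the same integral gives a test function of mean zero.
  -- Its primitive again has compact support, so it may be used in the definition of the weak
  -- derivative; this gives `∫ f ψ = 0`.
  set ψ : ℝ → ℝ := fun x => φ x - m * ν x
  have hψ : ContDiff ℝ ∞ ψ := h1.sub (contDiff_const.mul hν)
  have hψc : HasCompactSupport ψ := h2.sub (hνc.mul_left)
  have hφi : Integrable φ := h1.continuous.integrable_of_hasCompactSupport h2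
  have hνi' : Integrable ν := hν.continuous.integrable_of_hasCompactSupport hνc
  have hψi : Integrable ψ := hφi.sub (hνi'.const_mul m)
  have hψ0 : ∫ x, ψ x = 0 := by
    simp only [ψ]
    rw [integral_sub hφi (hνi'.const_mul m), integral_const_mul, hνi]; simp [m]
  obtain ⟨R, hR⟩ := hψc.isCompact.isBounded.subset_closedBall 0
  have hz : ∀ x, |R| < |x| → ψ x = 0 := fun x hx => image_eq_zero_of_notMem_tsupport fun hmem => by
    have := hR hmem
    rw [mem_closedBall_zero_iff, Real.norm_eq_abs] at this
    linarith [le_abs_self R]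
  set S := |R| + 1 with hS
  set Ψ : ℝ → ℝ := fun x => ∫ t in (-S)..x, ψ t
  have hΨd : ∀ x, HasDerivAt Ψ (ψ x) x := fun x =>
    intervalIntegral.integral_hasDerivAt_right (hψ.continuous.intervalIntegrable _ _)
      hψ.continuous.stronglyMeasurable.stronglyMeasurableAtFilter hψ.continuous.continuousAt
  have hderiv : deriv Ψ = ψ := funext fun x => (hΨd x).deriv
  have hΨ : ContDiff ℝ ∞ Ψ := by
    rw [contDiff_infty_iff_deriv, hderiv]
    exact ⟨fun x => (hΨd x).differentiableAt, hψ⟩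
  have hΨc : HasCompactSupport Ψ := by
    refine HasCompactSupport.intro (isCompact_Icc (a := -S) (b := S)) fun x hx => ?_
    rw [Set.mem_Icc, not_and_or, not_le, not_le] at hx
    rcases hx with hx | hx
    · simp only [Ψ]
      rw [intervalIntegral.integral_congr (g := fun _ => 0)]
      · simp
      · intro t ht
        rw [Set.uIcc_of_ge hx.le] at ht
        refine hz t ?_
        have := neg_abs_le t
        have := ht.2
        linarith
    · simp only [Ψ]
      rw [intervalIntegral.integral_eq_integral_of_support_subset, hψ0]
      intro t ht
      by_contra hcon
      refine ht (hz t ?_)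
      rw [Set.mem_Ioc, not_and_or, not_lt, not_le] at hcon
      rcases hcon with h3 | h3
      · have := neg_abs_le t; linarith
      · have := le_abs_self t; linarith
  have key := h.3 (fun x => (Ψ x : ℂ)) (Complex.ofRealCLM.contDiff.comp hΨ)
    (hΨc.comp_left (g := Complex.ofReal) (by simp))
  have hd2 : deriv (fun x => (Ψ x : ℂ)) = fun x => (ψ x : ℂ) :=
    funext fun x => (hΨd x).ofReal_comp.deriv
  rw [hd2] at key
  simp only [Pi.zero_apply, zero_mul, integral_zero, neg_zero] at key
  have e1 : Integrable fun x => φ x • f x :=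
    h.1.integrable_smul_left_of_hasCompactSupport h1.continuous h2
  have e2 : Integrable fun x => ν x • f x :=
    h.1.integrable_smul_left_of_hasCompactSupport hν.continuous hνc
  have e3 : (∫ x, f x * (ψ x : ℂ)) = (∫ x, φ x • f x) - m * ∫ x, ν x • f x := by
    rw [← integral_const_mul, ← integral_sub e1 (e2.const_mul _)]
    refine integral_congr_ae (Eventually.of_forall fun x => ?_)
    simp only [ψ, Complex.real_smul]; push_cast; ring
  rw [e3, sub_eq_zero] at key
  rw [key, integral_smul_const]
  simp [m]

/-- The difference between `f` and a primitive of `g` has weak derivative zero, so it is constant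
almost everywhere, and everywhere by continuity. This gives the fundamental theorem of calculus for
the continuous representatives of the reflection coefficients. -/
theorem HasWeakDeriv.isPrim {f g : ℝ → ℂ} (h : HasWeakDeriv f g) (hf : Continuous f) :
    IsPrim f g := by
  have hP : IsPrim (fun x => ∫ t in (0 : ℝ)..x, g t) g := ⟨h.2, fun u v => by
    rw [intervalIntegral.integral_interval_sub_left] <;> exact intervalIntegrable_of_locallyIntegrable h.2 _ _⟩
  have hw := hP.hasWeakDeriv
  have h0 : HasWeakDeriv (fun x => f x - ∫ t in (0 : ℝ)..x, g t) 0 := by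
    refine ⟨h.1.sub hw.1, locallyIntegrable_zero, fun φ h1 h2 => ?_⟩
    have i1 : Integrable fun x => f x * deriv φ x := by
      simpa [mul_comm] using h.1.integrable_smul_left_of_hasCompactSupport
        (h1.continuous_deriv (by simp)) h2.deriv
    have i2 : Integrable fun x => (∫ t in (0 : ℝ)..x, g t) * deriv φ x := by
      simpa [mul_comm] using hw.1.integrable_smul_left_of_hasCompactSupport
        (h1.continuous_deriv (by simp)) h2.deriv
    simp only [sub_mul]
    rw [integral_sub i1 i2, h.3 φ h1 h2, hw.3 φ h1 h2]
    simp
  obtain ⟨c, hc⟩ := h0.ae_const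
  have : (fun x => f x - ∫ t in (0 : ℝ)..x, g t) = fun _ => c :=
    Continuous.ae_eq_iff_eq volume (hf.sub hP.continuous) continuous_const |>.1 hc
  refine ⟨h.2, fun a b => ?_⟩
  rw [hP.eq a b]
  have ha := congrFun this a
  have hb := congrFun this b
  linear_combination ha - hb

end

section

/-! ### The Hilbert space `L²(ℝ)` -/

/-- The complex space `L²(ℝ)`. -/
abbrev E := Lp ℂ 2 (volume : Measure ℝ)

open Classical in
/-- The class of `f` in `L²(ℝ)`, and `0` if `f` is not square integrable. -/
def toE (f : ℝ → ℂ) : E := if h : MemLp f 2 volume then h.toLp f else 0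

theorem toE_eq {f : ℝ → ℂ} (h : MemLp f 2 volume) : toE f = h.toLp f := by simp [toE, h]

theorem coeFn_toE {f : ℝ → ℂ} (h : MemLp f 2 volume) : (toE f : ℝ → ℂ) =ᵐ[volume] f := by
  rw [toE_eq h]; exact h.coeFn_toLp

theorem toE_congr {f g : ℝ → ℂ} (h : f =ᵐ[volume] g) : toE f = toE g := by
  by_cases hf : MemLp f 2 volume
  · have hg := hf.ae_eq h
    rw [toE_eq hf, toE_eq hg]; exact MemLp.toLp_congr hf hg h
  · have hg : ¬ MemLp g 2 volume := fun hg => hf (hg.ae_eq h.symm)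
    simp [toE, hf, hg]

theorem toE_coeFn (f : E) : toE f = f := by
  rw [toE_eq (Lp.memLp f)]; exact Lp.toLp_coeFn _ _

theorem eq_toE {f : E} {g : ℝ → ℂ} (h : (f : ℝ → ℂ) =ᵐ[volume] g) : f = toE g := by
  rw [← toE_congr h, toE_coeFn]

theorem norm_toE {f : ℝ → ℂ} (h : MemLp f 2 volume) :
    ‖toE f‖ = (eLpNorm f 2 volume).toReal := by
  rw [toE_eq h, Lp.norm_toLp]

theorem norm_toE_le {f : ℝ → ℂ} {C : ℝ} (hC : 0 ≤ C)
    (h : eLpNorm f 2 volume ≤ ENNReal.ofReal C) : ‖toE f‖ ≤ C := by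
  by_cases hf : MemLp f 2 volume
  · rw [norm_toE hf]; exact ENNReal.toReal_le_of_le_ofReal hC h
  · simpa [toE, hf] using hC

theorem toE_add {f g : ℝ → ℂ} (hf : MemLp f 2 volume) (hg : MemLp g 2 volume) :
    toE (fun x => f x + g x) = toE f + toE g := by
  rw [toE_eq hf, toE_eq hg, toE_eq (f := fun x => f x + g x) (hf.add hg)]; rfl

theorem toE_sub {f g : ℝ → ℂ} (hf : MemLp f 2 volume) (hg : MemLp g 2 volume) :
    toE (fun x => f x - g x) = toE f - toE g := by
  rw [toE_eq hf, toE_eq hg, toE_eq (f := fun x => f x - g x) (hf.sub hg)]; rfl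

theorem toE_const_mul {f : ℝ → ℂ} (hf : MemLp f 2 volume) (c : ℂ) :
    toE (fun x => c * f x) = c • toE f := by
  rw [toE_eq hf, toE_eq (hf.const_mul c)]; rfl

theorem norm_E_sq (f : E) : ‖f‖ ^ 2 = ∫ x, ‖f x‖ ^ 2 := by
  have h := (Lp.memLp f).eLpNorm_eq_integral_rpow_norm (by norm_num) (by norm_num)
  rw [Lp.norm_def, h, ENNReal.toReal_ofReal (by positivity)]
  simp only [ENNReal.toReal_ofNat, Real.rpow_two]
  rw [← Real.rpow_natCast, ← Real.rpow_mul (by positivity)]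
  norm_num

/-- Dominated convergence for the squared distance, which is at most `(2G)²`. It yields continuity
and differentiability of `vec` in `L²`. -/
theorem tendsto_toE_of_dominated {ι : Type*} {l : Filter ι} [l.IsCountablyGenerated]
    {f : ι → ℝ → ℂ} {g : ℝ → ℂ} {G : ℝ → ℝ} (hG : MemLp G 2 volume)
    (hf : ∀ i, AEStronglyMeasurable (f i) volume) (hg : AEStronglyMeasurable g volume)
    (hb : ∀ᶠ i in l, ∀ᵐ x, ‖f i x‖ ≤ G x) (hgb : ∀ᵐ x, ‖g x‖ ≤ G x)
    (hlim : ∀ᵐ x, Tendsto (fun i => f i x) l (𝓝 (g x))) :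
    Tendsto (fun i => toE (f i)) l (𝓝 (toE g)) := by
  have hgm : MemLp g 2 volume := hG.mono' hg hgb
  have key : Tendsto (fun i => ∫ x, ‖f i x - g x‖ ^ 2) l (𝓝 (∫ _x : ℝ, (0 : ℝ))) := by
    refine tendsto_integral_filter_of_dominated_convergence (fun x => (2 * G x) ^ 2) ?_ ?_ ?_ ?_
    · exact Eventually.of_forall fun i => ((hf i).sub hg).norm.pow 2
    · filter_upwards [hb] with i hi
      filter_upwards [hi, hgb] with x h1 h2
      rw [Real.norm_eq_abs, abs_of_nonneg (by positivity)]
      have := norm_sub_le (f i x) (g x)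
      gcongr
      linarith
    · have := (hG.const_mul 2).integrable_sq
      simpa using this
    · filter_upwards [hlim] with x hx
      have := ((hx.sub_const (g x)).norm).pow 2
      simpa using this
  rw [integral_zero] at key
  rw [tendsto_iff_norm_sub_tendsto_zero]
  have h2 : Tendsto (fun i => Real.sqrt (∫ x, ‖f i x - g x‖ ^ 2)) l (𝓝 0) := by
    simpa using key.sqrt
  refine h2.congr' ?_
  filter_upwards [hb] with i hi
  have hfm : MemLp (f i) 2 volume := hG.mono' (hf i) hi
  rw [← toE_sub hfm hgm, Real.sqrt_eq_iff_mul_self_eq (by positivity) (norm_nonneg _), ← sq,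
    norm_E_sq]
  refine integral_congr_ae ?_
  filter_upwards [coeFn_toE (hfm.sub hgm)] with x hx
  have hx' : (toE fun x => f i x - g x) x = f i x - g x := hx
  rw [hx']

/-- The bilinear pairing `∫ f g` of `L²(ℝ)`. -/
def pair : E →L[ℂ] E →L[ℂ] ℂ := (ContinuousLinearMap.mul ℂ ℂ).lpPairing volume 2 2

theorem pair_apply (f g : E) : pair f g = ∫ x, f x * g x := by
  simp [pair, ContinuousLinearMap.lpPairing_eq_integral]

theorem pair_toE {f g : ℝ → ℂ} (hf : MemLp f 2 volume) (hg : MemLp g 2 volume) :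
    pair (toE f) (toE g) = ∫ x, f x * g x := by
  rw [pair_apply]
  refine integral_congr_ae ?_
  filter_upwards [coeFn_toE hf, coeFn_toE hg] with x h1 h2
  rw [h1, h2]

theorem pair_toE_left {f : ℝ → ℂ} (hf : MemLp f 2 volume) (g : E) :
    pair (toE f) g = ∫ x, f x * g x := by
  rw [pair_apply]
  refine integral_congr_ae ?_
  filter_upwards [coeFn_toE hf] with x h1
  rw [h1]

theorem pair_comm (f g : E) : pair f g = pair g f := by
  rw [pair_apply, pair_apply]; simp only [mul_comm]

theorem norm_pair_le (f g : E) : ‖pair f g‖ ≤ ‖f‖ * ‖g‖ := by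
  have h1 : ‖pair f g‖ ≤ ‖(ContinuousLinearMap.mul ℂ ℂ).holder (r := 1) f g‖ := by
    rw [pair_apply]
    refine (norm_integral_le_integral_norm _).trans (le_of_eq ?_)
    rw [L1.norm_eq_integral_norm]
    refine integral_congr_ae ?_
    filter_upwards [(ContinuousLinearMap.mul ℂ ℂ).coeFn_holder (r := 1) f g] with x hx
    rw [hx]; rfl
  refine h1.trans ?_
  have := (ContinuousLinearMap.mul ℂ ℂ).norm_holder_apply_apply_le (r := 1) f g
  simpa using this

theorem eq_zero_of_pair_eq_zero {f : E} (h : ∀ g, pair f g = 0) : f = 0 := by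
  have hm : MemLp (fun x => (starRingEnd ℂ) (f x)) 2 volume := (Lp.memLp f).star
  have h1 := h (toE fun x => (starRingEnd ℂ) (f x))
  rw [pair_comm, pair_toE_left hm] at h1
  have h2 : ((‖f‖ ^ 2 : ℝ) : ℂ) = 0 := by
    rw [norm_E_sq, ← h1, ← integral_complex_ofReal]
    refine integral_congr_ae (Eventually.of_forall fun x => ?_)
    simp only [Complex.conj_mul']
    push_cast; rfl
  have h3 : ‖f‖ ^ 2 = 0 := by exact_mod_cast h2
  simpa using h3

theorem eq_of_pair_eq {f g : E} (h : ∀ k, pair f k = pair g k) : f = g := by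
  rw [← sub_eq_zero]
  refine eq_zero_of_pair_eq_zero fun k => ?_
  rw [map_sub, sub_apply, h k, sub_self]

theorem norm_le_of_pair_le {f : E} {C : ℝ} (h : ∀ g, ‖pair f g‖ ≤ C * ‖g‖) : ‖f‖ ≤ C := by
  have hm : MemLp (fun x => (starRingEnd ℂ) (f x)) 2 volume := (Lp.memLp f).star
  have h1 := h (toE fun x => (starRingEnd ℂ) (f x))
  have hn : ‖toE fun x => (starRingEnd ℂ) (f x)‖ = ‖f‖ := by
    rw [norm_toE hm, Lp.norm_def]
    congr 1
    exact eLpNorm_congr_norm_ae (Eventually.of_forall fun x => by simp)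
  rw [hn, pair_comm, pair_toE_left hm] at h1
  have h2 : (∫ x, (starRingEnd ℂ) (f x) * f x) = ((‖f‖ ^ 2 : ℝ) : ℂ) := by
    rw [norm_E_sq, ← integral_complex_ofReal]
    refine integral_congr_ae (Eventually.of_forall fun x => ?_)
    simp only [Complex.conj_mul']
    push_cast; rfl
  rw [h2, Complex.norm_real, Real.norm_eq_abs, abs_of_nonneg (by positivity), sq] at h1
  -- Testing against the conjugate of `f` settles `f ≠ 0`. For `f = 0` the claim is `0 ≤ C`, which
  -- follows by testing against a function of norm one.
  by_cases h0 : ‖f‖ = 0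
  · rw [h0]
    by_contra hC
    push Not at hC
    have h3 := h (toE (Set.indicator (Set.Icc (0 : ℝ) 1) fun _ => 1))
    have hm1 : MemLp (Set.indicator (Set.Icc (0 : ℝ) 1) fun _ => (1 : ℂ)) 2 volume :=
      memLp_indicator_const 2 measurableSet_Icc 1 (Or.inr (by simp))
    have h4 : ‖toE (Set.indicator (Set.Icc (0 : ℝ) 1) fun _ => (1 : ℂ))‖ = 1 := by
      rw [norm_toE hm1, eLpNorm_indicator_const measurableSet_Icc (by norm_num) (by norm_num)]
      simp
    rw [h4] at h3
    have := norm_nonneg (pair f (toE (Set.indicator (Set.Icc (0 : ℝ) 1) fun _ => 1)))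
    linarith
  · have : 0 < ‖f‖ := lt_of_le_of_ne (norm_nonneg _) (Ne.symm h0)
    exact le_of_mul_le_mul_right h1 this

/-! ### Multiplication operators -/

open Classical in
/-- Multiplication by the bounded function `m` on `L²(ℝ)`. -/
def mulOp (m : ℝ → ℂ) : E →L[ℂ] E :=
  if h : MemLp m ∞ volume then (ContinuousLinearMap.mul ℂ ℂ).holderL volume ∞ 2 2 (h.toLp m) else 0

theorem coeFn_mulOp {m : ℝ → ℂ} (h : MemLp m ∞ volume) (f : E) :
    (mulOp m f : ℝ → ℂ) =ᵐ[volume] fun x => m x * f x := by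
  simp only [mulOp, h, dif_pos, ContinuousLinearMap.holderL_apply_apply]
  filter_upwards [(ContinuousLinearMap.mul ℂ ℂ).coeFn_holder (r := 2) (h.toLp m) f,
    h.coeFn_toLp] with x h1 h2
  rw [h1, h2]; rfl

theorem norm_mulOp_le {m : ℝ → ℂ} {C : ℝ} (hm : AEStronglyMeasurable m volume)
    (hC : 0 ≤ C) (hb : ∀ x, ‖m x‖ ≤ C) : ‖mulOp m‖ ≤ C := by
  have h : MemLp m ∞ volume := memLp_top_of_bound hm C (Eventually.of_forall hb)
  refine ContinuousLinearMap.opNorm_le_bound _ hC fun f => ?_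
  refine Lp.norm_le_mul_norm_of_ae_le_mul ?_
  filter_upwards [coeFn_mulOp h f] with x hx
  rw [hx, norm_mul]
  exact mul_le_mul_of_nonneg_right (hb x) (norm_nonneg _)

theorem pair_mulOp {m : ℝ → ℂ} (h : MemLp m ∞ volume) (f g : E) :
    pair (mulOp m f) g = pair f (mulOp m g) := by
  rw [pair_apply, pair_apply]
  refine integral_congr_ae ?_
  filter_upwards [coeFn_mulOp h f, coeFn_mulOp h g] with x h1 h2
  rw [h1, h2]; ring

theorem mulOp_add_mul {m n : ℝ → ℂ} (hm : MemLp m ∞ volume) (hn : MemLp n ∞ volume) (c : ℂ) :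
    mulOp (fun x => m x + c * n x) = mulOp m + c • mulOp n := by
  ext1 f
  refine Lp.ext ?_
  have e : ((mulOp m + c • mulOp n) f : E) = mulOp m f + c • mulOp n f := rfl
  rw [e]
  filter_upwards [coeFn_mulOp (hm.add (hn.const_mul c)) f, coeFn_mulOp hm f, coeFn_mulOp hn f,
    Lp.coeFn_add (mulOp m f) (c • mulOp n f), Lp.coeFn_smul c (mulOp n f)] with x h1 h2 h3 h4 h5
  have h1' : (mulOp (fun x => m x + c * n x) f) x = (m x + c * n x) * f x := h1
  rw [h1', h4, Pi.add_apply, h5, h2, Pi.smul_apply, h3, smul_eq_mul]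
  ring

/-- The restriction of a function to the half-line `(s, ∞)`. -/
def cut (s : ℝ) : E →L[ℂ] E := mulOp (Set.indicator (Set.Ioi s) fun _ => 1)

theorem memLp_top_indicator (s : ℝ) :
    MemLp (Set.indicator (Set.Ioi s) fun _ => (1 : ℂ)) ∞ (volume : Measure ℝ) :=
  memLp_top_of_bound
    ((stronglyMeasurable_const.indicator measurableSet_Ioi).aestronglyMeasurable) 1
    (Eventually.of_forall fun x => by by_cases h : x ∈ Set.Ioi s <;> simp [Set.indicator, h])

theorem coeFn_cut (s : ℝ) (f : E) :
    (cut s f : ℝ → ℂ) =ᵐ[volume] Set.indicator (Set.Ioi s) f := by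
  filter_upwards [coeFn_mulOp (memLp_top_indicator s) f] with x hx
  rw [cut, hx]
  by_cases h : x ∈ Set.Ioi s <;> simp [Set.indicator, h]

theorem norm_cut_opNorm_le (s : ℝ) : ‖cut s‖ ≤ 1 :=
  norm_mulOp_le (memLp_top_indicator s).1 zero_le_one
    fun x => by by_cases h : x ∈ Set.Ioi s <;> simp [Set.indicator, h]

theorem norm_cut_le (s : ℝ) (f : E) : ‖cut s f‖ ≤ ‖f‖ :=
  ((cut s).le_of_opNorm_le (norm_cut_opNorm_le s) f).trans (by simp)

theorem pair_cut (s : ℝ) (f g : E) : pair (cut s f) g = pair f (cut s g) :=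
  pair_mulOp (memLp_top_indicator s) f g

theorem cut_cut (s : ℝ) (f : E) : cut s (cut s f) = cut s f := by
  refine Lp.ext ?_
  filter_upwards [coeFn_cut s (cut s f), coeFn_cut s f] with x h1 h2
  rw [h1, h2]
  by_cases h : x ∈ Set.Ioi s
  · rw [Set.indicator_of_mem h, h2]
  · simp [Set.indicator, h]

/-! ### The Fourier transform of `L²(ℝ)` -/

/-- The Fourier transform on `L²(ℝ)`. -/
def FT : E ≃ₗᵢ[ℂ] E := Lp.fourierTransformₗᵢ ℝ ℂ

theorem pair_FT_schwartz (f : E) (ψ : SchwartzMap ℝ ℂ) :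
    ∫ x, ψ x * (FT f) x = ∫ x, (𝓕 ψ) x * f x := by
  have h := congrArg (fun T => T ψ) (Lp.fourier_toTemperedDistribution_eq f)
  simp only [TemperedDistribution.fourier_apply, Lp.toTemperedDistribution_apply,
    smul_eq_mul] at h
  exact h.symm

theorem schwartz_toLp_eq (ψ : SchwartzMap ℝ ℂ) : ψ.toLp 2 = toE ψ :=
  eq_toE (ψ.coeFn_toLp 2 volume)

theorem memLp_schwartz (ψ : SchwartzMap ℝ ℂ) : MemLp ψ 2 (volume : Measure ℝ) := ψ.memLp 2

/-- For Schwartz functions this is the definition of the Fourier transform of a distribution;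
density gives the rest. The symmetry is the reason for using the bilinear pairing in place of the
inner product. -/
theorem pair_FT (f g : E) : pair (FT f) g = pair f (FT g) := by
  refine DenseRange.induction_on (p := fun g => pair (FT f) g = pair f (FT g))
    (SchwartzMap.denseRange_toLpCLM (p := 2) (E := ℝ) (F := ℂ) (μ := volume) ENNReal.ofNat_ne_top)
    g ?_ fun ψ => ?_
  · exact isClosed_eq (pair (FT f)).continuous ((pair f).continuous.comp FT.continuous)
  · rw [SchwartzMap.toLpCLM_apply]
    have h1 : FT (ψ.toLp 2) = (𝓕 ψ).toLp 2 := SchwartzMap.toLp_fourier_eq ψ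
    rw [h1, schwartz_toLp_eq, schwartz_toLp_eq, pair_comm, pair_toE_left (memLp_schwartz _),
      pair_FT_schwartz, pair_comm, pair_toE_left (memLp_schwartz _)]

/-- Both sides have the same integrals against test functions, the integral transform by Fubini and
the `L²` transform by symmetry of the pairing. -/
theorem FT_toE_ae {g : ℝ → ℂ} (h1 : Integrable g) (h2 : MemLp g 2 volume) :
    (FT (toE g) : ℝ → ℂ) =ᵐ[volume] 𝓕 g := by
  have hl : LocallyIntegrable (FT (toE g) : ℝ → ℂ) :=
    (Lp.memLp (FT (toE g))).locallyIntegrable (by norm_num)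
  have hc : Continuous (𝓕 g) := VectorFourier.fourierIntegral_continuous Real.continuous_fourierChar
    (L := innerₗ ℝ) continuous_inner h1
  refine ae_eq_of_integral_contDiff_smul_eq hl hc.locallyIntegrable fun φ hφ hφc => ?_
  set ψ : SchwartzMap ℝ ℂ := HasCompactSupport.toSchwartzMap (f := fun x => (φ x : ℂ))
    (hφc.comp_left (g := Complex.ofReal) (by simp)) (Complex.ofRealCLM.contDiff.comp hφ)
  have hψ : ∀ x, ψ x = φ x := fun x => rfl
  have e1 := pair_FT_schwartz (toE g) ψ
  have e2 : ∫ x, (𝓕 ψ) x * (toE g) x = ∫ x, (𝓕 ψ) x * g x :=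
    integral_congr_ae ((coeFn_toE h2).mono fun x hx => by simp only [hx])
  have e3 : ∫ x, (𝓕 (ψ : ℝ → ℂ)) x * g x = ∫ x, ψ x * 𝓕 g x := by
    have := VectorFourier.integral_fourierIntegral_smul_eq_flip (L := innerₗ ℝ)
      Real.continuous_fourierChar continuous_inner (ψ.integrable (μ := volume)) h1
    simpa using! this
  simp only [hψ] at e1 e3
  simp only [Complex.real_smul]
  rw [e1, e2, SchwartzMap.fourier_coe, e3]

end

section

/-! ### The Fourier integral -/

/-- The character `e^{2πix}`. -/
def chi (x : ℝ) : ℂ := Complex.exp (2 * Real.pi * x * Complex.I)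

theorem norm_chi (x : ℝ) : ‖chi x‖ = 1 := by
  rw [chi, show (2 * Real.pi * x * Complex.I : ℂ) = ((2 * Real.pi * x : ℝ) : ℂ) * Complex.I by
    push_cast; ring]
  exact Complex.norm_exp_ofReal_mul_I _

@[fun_prop]
theorem continuous_chi : Continuous chi := by unfold chi; fun_prop

theorem chi_add (x y : ℝ) : chi (x + y) = chi x * chi y := by
  rw [chi, chi, chi, ← Complex.exp_add]; congr 1; push_cast; ring

@[simp] theorem chi_zero : chi 0 = 1 := by simp [chi]

theorem hasDerivAt_chi_mul (z t : ℝ) :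
    HasDerivAt (fun t : ℝ => chi (t * z)) (2 * Real.pi * Complex.I * z * chi (t * z)) t := by
  have h1 : HasDerivAt (fun t : ℝ => (2 * Real.pi * ((t * z : ℝ) : ℂ) * Complex.I : ℂ))
      (2 * Real.pi * Complex.I * z) t := by
    have h2 : HasDerivAt (fun t : ℝ => ((t * z : ℝ) : ℂ)) ((1 * z : ℝ) : ℂ) t :=
      ((hasDerivAt_id t).mul_const z).ofReal_comp
    refine ((h2.const_mul (2 * Real.pi : ℂ)).mul_const Complex.I).congr_deriv ?_
    push_cast; ring
  refine h1.cexp.congr_deriv ?_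
  rw [chi]; ring

theorem hasDerivAt_chi_neg_mul (z t : ℝ) :
    HasDerivAt (fun t : ℝ => chi (-(t * z))) (-2 * Real.pi * Complex.I * z * chi (-(t * z))) t := by
  have := hasDerivAt_chi_mul (-z) t
  convert this using 1
  · ext s; congr 1; ring
  · rw [mul_neg]; push_cast; ring

theorem norm_chi_sub_le (z t s : ℝ) : ‖chi (-(t * z)) - chi (-(s * z))‖ ≤
    2 * Real.pi * |z| * |t - s| := by
  have := Convex.norm_image_sub_le_of_norm_hasDerivWithin_le (𝕜 := ℝ)
    (f := fun t : ℝ => chi (-(t * z)))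
    (f' := fun t => -2 * Real.pi * Complex.I * z * chi (-(t * z))) (C := 2 * Real.pi * |z|)
    (s := Set.univ) (x := s) (y := t) (fun u _ => (hasDerivAt_chi_neg_mul z u).hasDerivWithinAt)
    (fun u _ => by
      simp [norm_chi, abs_of_pos Real.pi_pos]) convex_univ trivial trivial
  simpa using this

/-- The Fourier integral. -/
def ft (g : ℝ → ℂ) (w : ℝ) : ℂ := ∫ z, chi (-(w * z)) * g z

theorem fourier_eq_ft (g : ℝ → ℂ) : 𝓕 g = ft g := by
  ext w
  rw [Real.fourier_real_eq_integral_exp_smul, ft]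
  refine integral_congr_ae (Eventually.of_forall fun z => ?_)
  simp only [chi, smul_eq_mul]
  congr 2
  push_cast; ring

theorem integrable_chi_mul {g : ℝ → ℂ} (hg : Integrable g) {c : ℝ → ℝ} (hc : Continuous c) :
    Integrable fun z => chi (c z) * g z :=
  hg.bdd_mul (c := 1) (continuous_chi.comp hc).aestronglyMeasurable
    (Eventually.of_forall fun _ => (norm_chi _).le)

theorem memLp_chi_mul {g : ℝ → ℂ} {p : ℝ≥0∞} (hg : MemLp g p volume) {c : ℝ → ℝ}
    (hc : Continuous c) : MemLp (fun z => chi (c z) * g z) p volume :=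
  hg.of_le ((continuous_chi.comp hc).aestronglyMeasurable.mul hg.1)
    (Eventually.of_forall fun z => by rw [norm_mul, norm_chi, one_mul])

theorem continuous_ft {g : ℝ → ℂ} (hg : Integrable g) : Continuous (ft g) := by
  rw [← fourier_eq_ft]
  exact VectorFourier.fourierIntegral_continuous Real.continuous_fourierChar
    (L := innerₗ ℝ) continuous_inner hg

theorem norm_ft_le (g : ℝ → ℂ) (w : ℝ) : ‖ft g w‖ ≤ ∫ z, ‖g z‖ := by
  refine (norm_integral_le_integral_norm _).trans (le_of_eq ?_)
  simp [norm_chi]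

theorem ft_neg_eq (g : ℝ → ℂ) (w : ℝ) : ft g (-w) = ft (fun z => g (-z)) w := by
  rw [ft, ft, ← integral_neg_eq_self]
  simp

theorem FT_toE_ae' {g : ℝ → ℂ} (h1 : Integrable g) (h2 : MemLp g 2 volume) :
    (FT (toE g) : ℝ → ℂ) =ᵐ[volume] ft g := by
  rw [← fourier_eq_ft]; exact FT_toE_ae h1 h2

/-- The Fourier transform of `L²(ℝ)`, of the function `r` modulated by the character of `t`.
As a function it is the translate by `t` of the Fourier transform of `r`. -/
def vec (r : ℝ → ℂ) (t : ℝ) : E := FT (toE fun z => chi (-(t * z)) * r z)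

theorem ft_chi_mul (r : ℝ → ℂ) (t y : ℝ) : ft (fun z => chi (-(t * z)) * r z) y = ft r (t + y) := by
  refine integral_congr_ae (Eventually.of_forall fun z => ?_)
  simp only
  rw [← mul_assoc, ← chi_add]; congr 2; ring

theorem coeFn_vec {r : ℝ → ℂ} (h1 : Integrable r) (h2 : MemLp r 2 volume) (t : ℝ) :
    (vec r t : ℝ → ℂ) =ᵐ[volume] fun y => ft r (t + y) := by
  refine (FT_toE_ae' (integrable_chi_mul h1 (by fun_prop))
    (memLp_chi_mul h2 (by fun_prop))).trans (Eventually.of_forall fun y => ft_chi_mul r t y)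

theorem norm_vec {r : ℝ → ℂ} (h2 : MemLp r 2 volume) (t : ℝ) : ‖vec r t‖ = ‖toE r‖ := by
  rw [vec, LinearIsometryEquiv.norm_map, norm_toE h2, norm_toE (memLp_chi_mul h2 (by fun_prop))]
  congr 1
  exact eLpNorm_congr_norm_ae (Eventually.of_forall fun z => by simp [norm_chi])

theorem continuous_vec {r : ℝ → ℂ} (h2 : MemLp r 2 volume) : Continuous (vec r) := by
  refine FT.continuous.comp (continuous_iff_continuousAt.2 fun t => ?_)
  refine tendsto_toE_of_dominated (G := fun z => ‖r z‖) h2.norm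
    (fun s => (memLp_chi_mul h2 (by fun_prop)).1) (memLp_chi_mul h2 (by fun_prop)).1
    (Eventually.of_forall fun s => Eventually.of_forall fun z => by simp [norm_chi])
    (Eventually.of_forall fun z => by simp [norm_chi])
    (Eventually.of_forall fun z => ?_)
  have : Continuous fun s : ℝ => chi (-(s * z)) * r z := by fun_prop
  exact this.tendsto t

/-- The multiplier of the derivative on the Fourier side. -/
def zmul (r : ℝ → ℂ) : ℝ → ℂ := fun z => -2 * Real.pi * Complex.I * z * r z

/-- The difference quotients of the character are bounded by `2π|z|`, so before the Fourier
transform is applied the quotients are dominated by `|zmul r|` and converge in `L²`. -/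
theorem hasDerivAt_vec {r : ℝ → ℂ} (h2 : MemLp r 2 volume) (h3 : MemLp (zmul r) 2 volume) (t : ℝ) :
    HasDerivAt (vec r) (vec (zmul r) t) t := by
  rw [hasDerivAt_iff_tendsto_slope]
  have e : ∀ s, slope (vec r) t s =
      FT (toE fun z => ((s - t)⁻¹ : ℝ) * (chi (-(s * z)) * r z - chi (-(t * z)) * r z)) := by
    intro s
    have m1 : MemLp (fun z => chi (-(s * z)) * r z) 2 volume := memLp_chi_mul h2 (by fun_prop)
    have m2 : MemLp (fun z => chi (-(t * z)) * r z) 2 volume := memLp_chi_mul h2 (by fun_prop)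
    have m3 := toE_const_mul (f := fun z => chi (-(s * z)) * r z - chi (-(t * z)) * r z)
      (m1.sub m2) ((s - t)⁻¹ : ℝ)
    rw [slope_def_module, vec, vec, ← map_sub, ← toE_sub m1 m2, m3, map_smul]
    rfl
  rw [funext e]
  refine (FT.continuous.tendsto _).comp ?_
  refine tendsto_toE_of_dominated (G := fun z => ‖zmul r z‖) h3.norm (fun s => ?_)
    (memLp_chi_mul h3 (by fun_prop)).1 ?_ (Eventually.of_forall fun z => by simp [norm_chi])
    (Eventually.of_forall fun z => ?_)
  · exact (((memLp_chi_mul h2 (by fun_prop)).sub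
      (memLp_chi_mul h2 (by fun_prop))).const_mul _).1
  · filter_upwards [self_mem_nhdsWithin] with s hs
    refine Eventually.of_forall fun z => ?_
    have hst : 0 < |s - t| := abs_pos.2 (sub_ne_zero.2 hs)
    rw [← sub_mul, norm_mul, norm_mul, Complex.norm_real, norm_inv, Real.norm_eq_abs, zmul,
      norm_mul]
    have h4 := norm_chi_sub_le z s t
    have h5 : ‖(-2 * Real.pi * Complex.I * z : ℂ)‖ = 2 * Real.pi * |z| := by
      simp [abs_of_pos Real.pi_pos]
    rw [h5, ← mul_assoc]
    refine mul_le_mul_of_nonneg_right ?_ (norm_nonneg _)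
    rw [inv_mul_le_iff₀ hst]
    linarith
  · have h6 := ((hasDerivAt_chi_neg_mul z t).mul_const (r z))
    rw [hasDerivAt_iff_tendsto_slope] at h6
    convert h6 using 1
    · ext s; simp [slope_def_module]
    · simp only [zmul]; ring_nf

/-- The Hankel type operator with kernel `F(y + y')`, `F` the Fourier transform of `r`. -/
def Gam (r : ℝ → ℂ) : E →L[ℂ] E :=
  (FT.toContinuousLinearEquiv : E →L[ℂ] E) ∘L mulOp r ∘L (FT.toContinuousLinearEquiv : E →L[ℂ] E)

theorem Gam_apply (r : ℝ → ℂ) (f : E) : Gam r f = FT (mulOp r (FT f)) := rfl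

/-- Plancherel, applied twice. This is where a bound on the modulus of the symbol becomes a bound on
the Hankel operator. -/
theorem norm_Gam_le {r : ℝ → ℂ} {C : ℝ} (hm : AEStronglyMeasurable r volume)
    (hC : 0 ≤ C) (hb : ∀ x, ‖r x‖ ≤ C) : ‖Gam r‖ ≤ C := by
  refine ContinuousLinearMap.opNorm_le_bound _ hC fun f => ?_
  rw [Gam_apply, LinearIsometryEquiv.norm_map]
  refine ((mulOp r).le_of_opNorm_le (norm_mulOp_le hm hC hb) _).trans ?_
  rw [LinearIsometryEquiv.norm_map]

theorem Gam_add_mul {m n : ℝ → ℂ} (hm : MemLp m ∞ volume) (hn : MemLp n ∞ volume) (c : ℂ) :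
    Gam (fun x => m x + c * n x) = Gam m + c • Gam n := by
  ext1 f
  simp only [Gam_apply, mulOp_add_mul hm hn, add_apply, smul_apply, map_add, map_smul]

theorem pair_Gam {r : ℝ → ℂ} (hr : MemLp r ∞ volume) (f g : E) :
    pair (Gam r f) g = pair f (Gam r g) := by
  rw [Gam_apply, Gam_apply, pair_FT, pair_mulOp hr, pair_FT]

/-- By symmetry of the Fourier transform, evaluating at `t` amounts to pairing with the translate by
`t` of the transform of `r`. Thus `Gam r` is the integral operator with kernel `F(t + y)`, and its
values have continuous representatives. -/
theorem coeFn_Gam {r : ℝ → ℂ} (h2 : MemLp r 2 volume) (hr : MemLp r ∞ volume) (f : E) :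
    (Gam r f : ℝ → ℂ) =ᵐ[volume] fun t => pair (vec r t) f := by
  have h1 : (mulOp r (FT f)) = toE fun z => r z * FT f z := eq_toE (coeFn_mulOp hr _)
  have hm : MemLp (fun z => r z * FT f z) 2 volume :=
    (Lp.memLp (mulOp r (FT f))).ae_eq (coeFn_mulOp hr _)
  have hi : Integrable fun z => r z * FT f z := h2.integrable_mul (Lp.memLp _)
  rw [Gam_apply, h1]
  refine (FT_toE_ae' hi hm).trans (Eventually.of_forall fun t => ?_)
  simp only
  rw [vec, pair_FT, pair_toE_left (memLp_chi_mul h2 (by fun_prop)), ft]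
  simp only [mul_assoc]

theorem continuous_pair_vec {r : ℝ → ℂ} (h2 : MemLp r 2 volume) (f : E) :
    Continuous fun t => pair (vec r t) f :=
  (pair.flip f).continuous.comp (continuous_vec h2)

/-- The dependence of `Γ_r 1_{(s,∞)} f` on `s`. -/
theorem Gam_cut_sub {r : ℝ → ℂ} (h2 : MemLp r 2 volume) (hr : MemLp r ∞ volume) {X : E}
    {f : ℝ → ℂ} (hf : Continuous f) (hX : (X : ℝ → ℂ) =ᵐ[volume] f) (a b : ℝ) :
    Gam r (cut b X) - Gam r (cut a X) = -∫ t in a..b, f t • vec r t := by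
  wlog hab : a ≤ b
  · have := this h2 hr hf hX b a (le_of_not_ge hab)
    rw [intervalIntegral.integral_symm, ← this]; abel
  refine eq_of_pair_eq fun g => ?_
  have hc : Continuous fun t => f t • vec r t := hf.smul (continuous_vec h2)
  have e1 : pair (∫ t in a..b, f t • vec r t) g = ∫ t in a..b, f t * pair (vec r t) g := by
    have := (pair.flip g).intervalIntegral_comp_comm (hc.intervalIntegrable (μ := volume) a b)
    rw [ContinuousLinearMap.flip_apply] at this
    rw [← this]
    simp
  -- Tested against `g`, the symmetric operator moves to `g`. What remains is an integral over `(a,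
  -- b]` of `f` times the values of `Gam r g`, which are pairings with `vec r t`.
  rw [map_neg, neg_apply, e1, ← map_sub (Gam r), pair_Gam hr, pair_apply,
    intervalIntegral.integral_of_le hab, ← integral_neg, ← integral_indicator measurableSet_Ioc]
  refine integral_congr_ae ?_
  filter_upwards [coeFn_Gam h2 hr g, hX, coeFn_cut a X, coeFn_cut b X,
    Lp.coeFn_sub (cut b X) (cut a X)] with t h3 h4 h5 h6 h7
  rw [h7, Pi.sub_apply, h5, h6, h3]
  by_cases hta : a < t <;> by_cases htb : b < t
  · simp [Set.indicator, hta, htb]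
  · simp [Set.indicator, hta, htb, not_lt.1 htb, h4]
  · exact absurd (hab.trans_lt htb) hta
  · simp [Set.indicator, hta, htb]

/-! ### Regularity and decay under the Fourier transform -/

/-- Integrability of the derivative makes the limit exist, and integrability of the function forces
it to vanish. -/
theorem IsPrim.tendsto_atTop {f g : ℝ → ℂ} (h : IsPrim f g) {a : ℝ}
    (hf : IntegrableOn f (Set.Ioi a)) (hg : IntegrableOn g (Set.Ioi a)) :
    Tendsto f atTop (𝓝 0) := by
  have h1 : Tendsto f atTop (𝓝 (f a + ∫ x in Set.Ioi a, g x)) := by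
    have := (intervalIntegral_tendsto_integral_Ioi a hg tendsto_id).const_add (f a)
    refine this.congr fun b => (h.eq_add a b).symm
  have h2 : f a + ∫ x in Set.Ioi a, g x = 0 := by
    refine IntegrableAtFilter.eq_zero_of_tendsto ⟨Set.Ioi a, Ioi_mem_atTop a, hf⟩ ?_ h1
    intro s hs
    obtain ⟨b, hb⟩ := mem_atTop_sets.1 hs
    exact top_unique ((by simp : (⊤ : ℝ≥0∞) = volume (Set.Ici b)) ▸ measure_mono hb)
  rwa [h2] at h1

theorem IsPrim.integral_Ioi {f g : ℝ → ℂ} (h : IsPrim f g) {a : ℝ}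
    (hf : IntegrableOn f (Set.Ioi a)) (hg : IntegrableOn g (Set.Ioi a)) :
    ∫ x in Set.Ioi a, g x = -f a := by
  have h1 := intervalIntegral_tendsto_integral_Ioi a hg tendsto_id
  have h2 : Tendsto (fun b => ∫ x in a..id b, g x) atTop (𝓝 (0 - f a)) := by
    simp only [h.eq, id]
    exact (h.tendsto_atTop hf hg).sub_const _
  rw [tendsto_nhds_unique h1 h2, zero_sub]

theorem IsPrim.integral_eq_zero {f g : ℝ → ℂ} (h : IsPrim f g) (hf : Integrable f)
    (hg : Integrable g) : ∫ x, g x = 0 := by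
  have h1 := h.integral_Ioi (a := 0) hf.integrableOn hg.integrableOn
  have h2 := h.comp_neg.integral_Ioi (a := 0) hf.comp_neg.integrableOn hg.comp_neg.neg.integrableOn
  rw [integral_neg, neg_zero, integral_comp_neg_Ioi, neg_zero] at h2
  have := intervalIntegral.integral_Iic_add_Ioi (b := (0 : ℝ)) hg.integrableOn hg.integrableOn
  rw [← this, h1]
  linear_combination -h2

theorem hasDerivAt_ft {g : ℝ → ℂ} (hg : Integrable g) (hg' : Integrable (zmul g)) (w : ℝ) :
    HasDerivAt (ft g) (ft (zmul g) w) w := by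
  have h1 : Integrable fun x : ℝ => x • g x := by
    have := hg'.const_mul ((-2 * Real.pi * Complex.I)⁻¹)
    refine this.congr (Eventually.of_forall fun z => ?_)
    have hpi : (Real.pi : ℂ) ≠ 0 := by exact_mod_cast Real.pi_ne_zero
    simp only [zmul, Complex.real_smul]
    field_simp
  have := Real.hasDerivAt_fourier hg h1 w
  rw [fourier_eq_ft, fourier_eq_ft] at this
  exact this

theorem memLp_indicator_Ioc (a b : ℝ) (p : ℝ≥0∞) :
    MemLp (Set.indicator (Set.Ioc a b) fun _ => (1 : ℂ)) p (volume : Measure ℝ) :=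
  memLp_indicator_const p measurableSet_Ioc 1 (Or.inr (by simp))

/-- The Fourier transform of an integrable function with a square integrable first moment. -/
theorem isPrim_ft {g : ℝ → ℂ} (h1 : Integrable g) (h3 : MemLp (zmul g) 2 volume) :
    IsPrim (ft g) (FT (toE (zmul g))) := by
  refine ⟨(Lp.memLp _).locallyIntegrable (by norm_num), fun a b => ?_⟩
  wlog hab : a ≤ b
  · have := this h1 h3 b a (le_of_not_ge hab)
    rw [intervalIntegral.integral_symm, this]; ring
  have e1 : ∫ x in a..b, (FT (toE (zmul g))) x =
      pair (toE (Set.indicator (Set.Ioc a b) fun _ => (1 : ℂ))) (FT (toE (zmul g))) := by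
    rw [pair_toE_left (memLp_indicator_Ioc a b 2), intervalIntegral.integral_of_le hab,
      ← integral_indicator measurableSet_Ioc]
    refine integral_congr_ae (Eventually.of_forall fun x => ?_)
    by_cases h : x ∈ Set.Ioc a b <;> simp [Set.indicator, h]
  -- The Fourier transform is moved onto the indicator of `(a, b]`. Its transform times `-2πiz` is
  -- the difference of the characters at the end points.
  rw [e1, ← pair_FT, pair_comm, pair_toE_left h3, ft, ft,
    ← integral_sub (integrable_chi_mul h1 (by fun_prop)) (integrable_chi_mul h1 (by fun_prop))]
  refine integral_congr_ae ?_
  filter_upwards [FT_toE_ae' ((memLp_one_iff_integrable).1 (memLp_indicator_Ioc a b 1))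
    (memLp_indicator_Ioc a b 2)] with z hz
  rw [hz]
  have e2 : ft (Set.indicator (Set.Ioc a b) fun _ => (1 : ℂ)) z = ∫ w in a..b, chi (-(w * z)) := by
    rw [ft, intervalIntegral.integral_of_le hab, ← integral_indicator measurableSet_Ioc]
    refine integral_congr_ae (Eventually.of_forall fun x => ?_)
    by_cases h : x ∈ Set.Ioc a b <;> simp [Set.indicator, h, mul_comm]
  have e3 : ∫ w in a..b, (-2 * Real.pi * Complex.I * z * chi (-(w * z)) : ℂ) =
      chi (-(b * z)) - chi (-(a * z)) :=
    intervalIntegral.integral_eq_sub_of_hasDerivAt (fun w _ => hasDerivAt_chi_neg_mul z w)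
      (Continuous.intervalIntegrable (by fun_prop) _ _)
  rw [intervalIntegral.integral_const_mul] at e3
  rw [e2, zmul]
  linear_combination (g z) * e3

/-- The Fourier transform turns the derivative into a multiplication. -/
theorem FT_of_isPrim {g h : ℝ → ℂ} (hp : IsPrim g h) (hg : MemLp g 2 volume)
    (hh : MemLp h 2 volume) :
    (FT (toE h) : ℝ → ℂ) =ᵐ[volume] fun y => 2 * Real.pi * Complex.I * y * FT (toE g) y := by
  have hl : LocallyIntegrable (FT (toE h) : ℝ → ℂ) := (Lp.memLp _).locallyIntegrable (by norm_num)
  have hl' : LocallyIntegrable (fun y => 2 * Real.pi * Complex.I * y * FT (toE g) y : ℝ → ℂ) := by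
    have : Continuous fun y : ℝ => (2 * Real.pi * Complex.I * y : ℂ) := by fun_prop
    exact ((Lp.memLp (FT (toE g))).locallyIntegrable (by norm_num)).continuous_smul this
  refine ae_eq_of_integral_contDiff_smul_eq hl hl' fun φ hφ hφc => ?_
  have hs1 : ContDiff ℝ ∞ fun x => (φ x : ℂ) := Complex.ofRealCLM.contDiff.comp hφ
  have hc1 : HasCompactSupport fun x => (φ x : ℂ) := hφc.comp_left (g := Complex.ofReal) (by simp)
  have hs2 : ContDiff ℝ ∞ (zmul fun x => (φ x : ℂ)) := by
    have : ContDiff ℝ ∞ fun z : ℝ => (-2 * Real.pi * Complex.I * z : ℂ) :=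
      contDiff_const.mul Complex.ofRealCLM.contDiff
    exact this.mul hs1
  have hc2 : HasCompactSupport (zmul fun x => (φ x : ℂ)) := hc1.mul_left
  set ψ : SchwartzMap ℝ ℂ := hc1.toSchwartzMap hs1
  set ψ' : SchwartzMap ℝ ℂ := hc2.toSchwartzMap hs2
  have hψ : (ψ : ℝ → ℂ) = fun x => (φ x : ℂ) := rfl
  have hψ' : (ψ' : ℝ → ℂ) = zmul fun x => (φ x : ℂ) := rfl
  have k1 : (𝓕 ψ : SchwartzMap ℝ ℂ) = ft fun x => (φ x : ℂ) := by
    rw [SchwartzMap.fourier_coe, fourier_eq_ft, hψ]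
  have k2 : (𝓕 ψ' : SchwartzMap ℝ ℂ) = ft (zmul fun x => (φ x : ℂ)) := by
    rw [SchwartzMap.fourier_coe, fourier_eq_ft, hψ']
  have hi1 : Integrable fun x => (φ x : ℂ) := hs1.continuous.integrable_of_hasCompactSupport hc1
  have hi2 : Integrable (zmul fun x => (φ x : ℂ)) :=
    hs2.continuous.integrable_of_hasCompactSupport hc2
  have hP : IsPrim (𝓕 ψ : SchwartzMap ℝ ℂ) (𝓕 ψ' : SchwartzMap ℝ ℂ) := by
    rw [k1, k2]
    exact IsPrim.of_hasDerivAt (hasDerivAt_ft hi1 hi2) (continuous_ft hi2)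
  have m1 : MemLp (𝓕 ψ : SchwartzMap ℝ ℂ) 2 volume := memLp_schwartz _
  have m2 : MemLp (𝓕 ψ' : SchwartzMap ℝ ℂ) 2 volume := memLp_schwartz _
  have j1 : Integrable fun x => h x * (𝓕 ψ : SchwartzMap ℝ ℂ) x := hh.integrable_mul m1
  have j2 : Integrable fun x => g x * (𝓕 ψ' : SchwartzMap ℝ ℂ) x := hg.integrable_mul m2
  -- The product of `g` with the transform of a test function is integrable with integrable
  -- derivative, so the integral of that derivative vanishes. This is the claimed identity in weak
  -- form.
  have key := (hp.mul hP).integral_eq_zero (hg.integrable_mul m1) (j1.add j2)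
  rw [integral_add j1 j2] at key
  have p1 := pair_FT_schwartz (toE h) ψ
  have p2 := pair_FT_schwartz (toE g) ψ'
  have q1 : ∫ x, (𝓕 ψ) x * (toE h) x = ∫ x, h x * (𝓕 ψ : SchwartzMap ℝ ℂ) x :=
    integral_congr_ae ((coeFn_toE hh).mono fun x hx => by simp only [hx]; ring)
  have q2 : ∫ x, (𝓕 ψ') x * (toE g) x = ∫ x, g x * (𝓕 ψ' : SchwartzMap ℝ ℂ) x :=
    integral_congr_ae ((coeFn_toE hg).mono fun x hx => by simp only [hx]; ring)
  rw [q1] at p1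
  rw [q2] at p2
  simp only [Complex.real_smul]
  have l1 : ∫ x, (φ x : ℂ) * FT (toE h) x = ∫ x, h x * (𝓕 ψ : SchwartzMap ℝ ℂ) x := p1
  have l2 : ∫ x, (φ x : ℂ) * (2 * Real.pi * Complex.I * x * FT (toE g) x) =
      -∫ x, g x * (𝓕 ψ' : SchwartzMap ℝ ℂ) x := by
    rw [← p2, ← integral_neg]
    refine integral_congr_ae (Eventually.of_forall fun x => ?_)
    simp only [hψ', zmul]; ring
  rw [l1, l2]
  linear_combination key

end

section

/-! ### Symbols -/

theorem bracket_pos (x : ℝ) : 0 < bracket x := Real.sqrt_pos.2 (by positivity)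

theorem one_le_bracket (x : ℝ) : 1 ≤ bracket x := Real.one_le_sqrt.2 (by nlinarith [sq_nonneg x])

theorem abs_le_bracket (x : ℝ) : |x| ≤ bracket x := Real.abs_le_sqrt (by linarith)

theorem sq_bracket (x : ℝ) : bracket x ^ 2 = 1 + x ^ 2 := Real.sq_sqrt (by positivity)

theorem bracket_neg (x : ℝ) : bracket (-x) = bracket x := by simp [bracket]

theorem bracket_le (x : ℝ) : bracket x ≤ 1 + |x| := by
  refine Real.sqrt_le_iff.2 ⟨by positivity, ?_⟩
  nlinarith [abs_nonneg x, sq_abs x]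

@[fun_prop]
theorem continuous_bracket : Continuous bracket := by unfold bracket; fun_prop

theorem eLpNorm_le_ofReal_mul {f g : ℝ → ℂ} {c A : ℝ} (hc : 0 ≤ c)
    (hg : eLpNorm g 2 volume ≤ ENNReal.ofReal A) (h : ∀ᵐ x, ‖f x‖ ≤ c * ‖g x‖) :
    eLpNorm f 2 volume ≤ ENNReal.ofReal (c * A) := by
  refine (eLpNorm_le_mul_eLpNorm_of_ae_le_mul h 2).trans ?_
  rw [ENNReal.ofReal_mul hc]
  gcongr

theorem eLpNorm_add_le_ofReal {f g : ℝ → ℂ} {A B : ℝ} (hA : 0 ≤ A) (hB : 0 ≤ B)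
    (hfm : AEStronglyMeasurable f volume) (hgm : AEStronglyMeasurable g volume)
    (hf : eLpNorm f 2 volume ≤ ENNReal.ofReal A) (hg : eLpNorm g 2 volume ≤ ENNReal.ofReal B) :
    eLpNorm (fun x => f x + g x) 2 volume ≤ ENNReal.ofReal (A + B) := by
  refine (eLpNorm_add_le hfm hgm (by norm_num)).trans ?_
  rw [ENNReal.ofReal_add hA hB]
  gcongr

theorem memLp_of_eLpNorm_le {f : ℝ → ℂ} {A : ℝ} (hfm : AEStronglyMeasurable f volume)
    (hf : eLpNorm f 2 volume ≤ ENNReal.ofReal A) : MemLp f 2 volume :=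
  ⟨hfm, hf.trans_lt ENNReal.ofReal_lt_top⟩

/-- Cauchy–Schwarz. -/
theorem integral_norm_mul_le {f g : ℝ → ℂ} {A B : ℝ} (hA : 0 ≤ A) (hB : 0 ≤ B)
    (hfm : AEStronglyMeasurable f volume) (hgm : AEStronglyMeasurable g volume)
    (hf : eLpNorm f 2 volume ≤ ENNReal.ofReal A) (hg : eLpNorm g 2 volume ≤ ENNReal.ofReal B) :
    Integrable (fun x => f x * g x) ∧ ∫ x, ‖f x * g x‖ ≤ A * B := by
  have h1 := memLp_of_eLpNorm_le hfm hf
  have h2 := memLp_of_eLpNorm_le hgm hg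
  have hi : Integrable (fun x => f x * g x) := h1.integrable_mul h2
  refine ⟨hi, ?_⟩
  have h3 : eLpNorm (fun x => f x * g x) 1 volume ≤ eLpNorm f 2 volume * eLpNorm g 2 volume := by
    have := eLpNorm_le_eLpNorm_mul_eLpNorm_of_nnnorm (p := 2) (q := 2) (r := 1) hfm hgm
      (fun a b => a * b) 1 (Eventually.of_forall fun x => by simp)
    rwa [ENNReal.coe_one, one_mul] at this
  rw [integral_norm_eq_lintegral_enorm hi.1, ← eLpNorm_one_eq_lintegral_enorm]
  refine ENNReal.toReal_le_of_le_ofReal (by positivity) (h3.trans ?_)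
  rw [ENNReal.ofReal_mul hA]
  gcongr

/-- The Sobolev inequality on the line. -/
theorem IsPrim.norm_le {f g : ℝ → ℂ} (h : IsPrim f g) {A B : ℝ} (hA : 0 ≤ A) (hB : 0 ≤ B)
    (hf : eLpNorm f 2 volume ≤ ENNReal.ofReal A) (hg : eLpNorm g 2 volume ≤ ENNReal.ofReal B)
    (x : ℝ) : ‖f x‖ ≤ A + B := by
  -- The value at `x` is compared with the mean over an interval of length one. The restricted
  -- measure is a probability measure, on which the `L¹` norm is at most the `L²` norm.
  set μ := (volume : Measure ℝ).restrict (Set.Ioc x (x + 1))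
  have : IsProbabilityMeasure μ := ⟨by simp [μ]⟩
  have cs : ∀ {k : ℝ → ℂ} {D : ℝ}, 0 ≤ D → AEStronglyMeasurable k volume →
      eLpNorm k 2 volume ≤ ENNReal.ofReal D → Integrable k μ → ∫ y, ‖k y‖ ∂μ ≤ D := by
    intro k D hD hk hkD hki
    rw [integral_norm_eq_lintegral_enorm hki.1, ← eLpNorm_one_eq_lintegral_enorm]
    refine ENNReal.toReal_le_of_le_ofReal hD ?_
    refine (eLpNorm_le_eLpNorm_of_exponent_le (by norm_num : (1 : ℝ≥0∞) ≤ 2) hk.restrict).trans ?_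
    exact (eLpNorm_mono_measure _ Measure.restrict_le_self).trans hkD
  have hfi : Integrable f μ :=
    (intervalIntegrable_iff_integrableOn_Ioc_of_le (by linarith)).1
      (h.continuous.intervalIntegrable x (x + 1))
  have hgi : Integrable g μ :=
    (intervalIntegrable_iff_integrableOn_Ioc_of_le (by linarith)).1 (h.intervalIntegrable x (x + 1))
  have h1 : ∀ᵐ y ∂μ, ‖f x‖ - ∫ y, ‖g y‖ ∂μ ≤ ‖f y‖ := by
    filter_upwards [ae_restrict_mem measurableSet_Ioc] with y hy
    have h2 : ‖∫ t in x..y, g t‖ ≤ ∫ y, ‖g y‖ ∂μ := by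
      rw [intervalIntegral.integral_of_le hy.1.le]
      refine (norm_integral_le_integral_norm _).trans ?_
      refine setIntegral_mono_set hgi.norm (Eventually.of_forall fun t => norm_nonneg _) ?_
      exact (Set.Ioc_subset_Ioc_right hy.2).eventuallyLE
    have h3 : ‖f x‖ ≤ ‖f y‖ + ‖∫ t in x..y, g t‖ := by
      rw [h.eq, show f x = f y - (f y - f x) by ring]
      refine (norm_sub_le _ _).trans ?_
      simp
    linarith
  have h4 := integral_mono_ae (integrable_const _) hfi.norm h1
  simp only [integral_const, probReal_univ, smul_eq_mul, one_mul] at h4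
  have h5 := cs hA h.continuous.aestronglyMeasurable hf hfi
  have h6 := cs hB h.loc.aestronglyMeasurable hg hgi
  linarith

/-- `r` lies in `H^{1,1} ∩ L^{2,3}`, has the derivative `r'`, and its norms are at most `N`. -/
structure InX (r r' : ℝ → ℂ) (N : ℝ) : Prop where
  prim : IsPrim r r'
  nonneg : 0 ≤ N
  weight : eLpNorm (fun z => ((bracket z ^ 3 : ℝ) : ℂ) * r z) 2 volume ≤ ENNReal.ofReal N
  weight_deriv : eLpNorm (fun z => (bracket z : ℂ) * r' z) 2 volume ≤ ENNReal.ofReal N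

/-- The properties of a symbol `r` and of its Fourier transform that are used below. -/
structure Good (r : ℝ → ℂ) (N : ℝ) : Prop where
  nonneg : 0 ≤ N
  continuous : Continuous r
  bound : ∀ z, ‖r z‖ ≤ N
  integrable : ∀ k ≤ 2, Integrable (zmul^[k] r)
  memLp : ∀ k ≤ 3, MemLp (zmul^[k] r) 2 volume
  norm_le : ∀ k ≤ 3, ‖toE (zmul^[k] r)‖ ≤ N
  memLp_weight : ∀ k ≤ 1, MemLp (fun y : ℝ => (y : ℂ) * ft (zmul^[k] r) y) 2 volume
  weight_le : ∀ k ≤ 1, ‖toE (fun y : ℝ => (y : ℂ) * ft (zmul^[k] r) y)‖ ≤ N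

theorem zmul_iterate (k : ℕ) (r : ℝ → ℂ) (z : ℝ) :
    zmul^[k] r z = (-2 * Real.pi * Complex.I * z) ^ k * r z := by
  induction k generalizing r with
  | zero => simp
  | succ k ih => rw [Function.iterate_succ_apply, ih, zmul]; ring

/-- The square of the norm is `π`, and `2π` is a convenient bound for its root. -/
theorem eLpNorm_inv_bracket_le :
    eLpNorm (fun z => ((bracket z)⁻¹ : ℂ)) 2 volume ≤ ENNReal.ofReal (2 * Real.pi) := by
  have hc : Continuous fun z => ((bracket z)⁻¹ : ℂ) :=
    (Complex.continuous_ofReal.comp continuous_bracket).inv₀ fun z => by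
      simpa using (bracket_pos z).ne'
  have hsq : ∀ z, ‖((bracket z)⁻¹ : ℂ)‖ ^ 2 = (1 + z ^ 2)⁻¹ := fun z => by
    rw [norm_inv, Complex.norm_real, Real.norm_eq_abs, inv_pow, sq_abs, sq_bracket]
  have hm : MemLp (fun z => ((bracket z)⁻¹ : ℂ)) 2 volume := by
    rw [memLp_two_iff_integrable_sq_norm hc.aestronglyMeasurable]
    simp only [hsq]
    exact integrable_inv_one_add_sq
  have h1 : ‖toE fun z => ((bracket z)⁻¹ : ℂ)‖ ^ 2 = Real.pi := by
    rw [norm_E_sq, ← integral_univ_inv_one_add_sq]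
    refine integral_congr_ae ?_
    filter_upwards [coeFn_toE hm] with z hz
    rw [hz, hsq]
  have h2 : ‖toE fun z => ((bracket z)⁻¹ : ℂ)‖ ≤ 2 * Real.pi := by
    have := Real.pi_gt_three
    exact abs_le_of_sq_le_sq' (by rw [h1]; nlinarith) (by positivity) |>.2
  rw [norm_toE hm] at h2
  exact (ENNReal.le_ofReal_iff_toReal_le hm.eLpNorm_ne_top (by positivity)).2 h2

namespace InX

variable {r r' : ℝ → ℂ} {N : ℝ}

theorem meas (h : InX r r' N) : AEStronglyMeasurable r volume :=
  h.prim.continuous.aestronglyMeasurable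

theorem meas' (h : InX r r' N) : AEStronglyMeasurable r' volume := h.prim.loc.aestronglyMeasurable

theorem eLpNorm_pow_mul_le (h : InX r r' N) {k : ℕ} (hk : k ≤ 3) :
    eLpNorm (fun z : ℝ => (z : ℂ) ^ k * r z) 2 volume ≤ ENNReal.ofReal N := by
  have := eLpNorm_le_ofReal_mul (f := fun z : ℝ => (z : ℂ) ^ k * r z) zero_le_one h.weight
    (Eventually.of_forall fun z => ?_)
  · simpa using this
  · rw [one_mul, norm_mul, norm_mul, norm_pow, Complex.norm_real, Complex.norm_real,
      Real.norm_eq_abs, Real.norm_eq_abs, abs_of_pos (pow_pos (bracket_pos z) 3)]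
    gcongr
    calc |z| ^ k ≤ bracket z ^ k := by gcongr; exact abs_le_bracket z
      _ ≤ bracket z ^ 3 := pow_le_pow_right₀ (one_le_bracket z) hk

theorem eLpNorm_le (h : InX r r' N) : eLpNorm r 2 volume ≤ ENNReal.ofReal N := by
  simpa using h.eLpNorm_pow_mul_le (k := 0) (by norm_num)

theorem eLpNorm_deriv_le (h : InX r r' N) : eLpNorm r' 2 volume ≤ ENNReal.ofReal N := by
  have := eLpNorm_le_ofReal_mul (f := r') zero_le_one h.weight_deriv
    (Eventually.of_forall fun z => ?_)
  · simpa using this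
  · rw [one_mul, norm_mul, Complex.norm_real, Real.norm_eq_abs, abs_of_pos (bracket_pos z)]
    exact le_mul_of_one_le_left (norm_nonneg _) (one_le_bracket z)

theorem eLpNorm_mul_deriv_le (h : InX r r' N) :
    eLpNorm (fun z : ℝ => (z : ℂ) * r' z) 2 volume ≤ ENNReal.ofReal N := by
  have := eLpNorm_le_ofReal_mul (f := fun z : ℝ => (z : ℂ) * r' z) zero_le_one h.weight_deriv
    (Eventually.of_forall fun z => ?_)
  · simpa using this
  · rw [one_mul, norm_mul, norm_mul, Complex.norm_real, Complex.norm_real, Real.norm_eq_abs,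
      Real.norm_eq_abs, abs_of_pos (bracket_pos z)]
    gcongr
    exact abs_le_bracket z

theorem norm_le (h : InX r r' N) (z : ℝ) : ‖r z‖ ≤ 2 * N :=
  (h.prim.norm_le h.nonneg h.nonneg h.eLpNorm_le h.eLpNorm_deriv_le z).trans (by linarith)

theorem isPrim_mul (h : InX r r' N) :
    IsPrim (fun z : ℝ => (z : ℂ) * r z) (fun z => r z + (z : ℂ) * r' z) := by
  have h1 : IsPrim (fun z : ℝ => (z : ℂ)) (fun _ => 1) :=
    IsPrim.of_hasDerivAt (fun x => by simpa using (hasDerivAt_id x).ofReal_comp) continuous_const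
  simpa using h1.mul h.prim

theorem eLpNorm_deriv_mul_le (h : InX r r' N) :
    eLpNorm (fun z => r z + (z : ℂ) * r' z) 2 volume ≤ ENNReal.ofReal (2 * N) := by
  rw [two_mul]
  exact eLpNorm_add_le_ofReal h.nonneg h.nonneg h.meas
    (Complex.continuous_ofReal.aestronglyMeasurable.mul h.meas') h.eLpNorm_le h.eLpNorm_mul_deriv_le

theorem norm_mul_le (h : InX r r' N) (z : ℝ) : ‖(z : ℂ) * r z‖ ≤ 3 * N := by
  have h1 := h.eLpNorm_pow_mul_le (k := 1) (by norm_num)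
  simp only [pow_one] at h1
  exact (h.isPrim_mul.norm_le h.nonneg (by linarith [h.nonneg]) h1 h.eLpNorm_deriv_mul_le z).trans
    (by linarith)

theorem norm_zmul_iterate (r : ℝ → ℂ) (k : ℕ) (z : ℝ) :
    ‖zmul^[k] r z‖ = (2 * Real.pi) ^ k * ‖(z : ℂ) ^ k * r z‖ := by
  rw [zmul_iterate]
  simp [abs_of_pos Real.pi_pos, mul_pow]
  ring

theorem continuous_zmul_iterate (hr : Continuous r) (k : ℕ) : Continuous (zmul^[k] r) := by
  have : zmul^[k] r = fun z : ℝ => (-2 * Real.pi * Complex.I * z) ^ k * r z :=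
    funext (zmul_iterate k r)
  rw [this]; fun_prop

theorem one_le_two_pi : (1 : ℝ) ≤ 2 * Real.pi := by linarith [Real.pi_gt_three]

/-- Cauchy–Schwarz against `1/⟨z⟩`: one of the three powers of the weight is spent on integrability,
so two moments are integrable while three are square integrable. -/
theorem integrable_zmul (h : InX r r' N) {k : ℕ} (hk : k ≤ 2) : Integrable (zmul^[k] r) := by
  have hc : Continuous fun z => ((bracket z)⁻¹ : ℂ) :=
    (Complex.continuous_ofReal.comp continuous_bracket).inv₀ fun z => by
      simpa using (bracket_pos z).ne'
  have hm : AEStronglyMeasurable (fun z => ((bracket z ^ 3 : ℝ) : ℂ) * r z) volume :=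
    (Continuous.aestronglyMeasurable (by fun_prop)).mul h.meas
  have h1 := (integral_norm_mul_le (by positivity) h.nonneg hc.aestronglyMeasurable hm
    eLpNorm_inv_bracket_le h.weight).1
  have hb : ∀ z, ‖zmul^[k] r z‖ ≤ (2 * Real.pi) ^ 2 *
      ‖((bracket z)⁻¹ : ℂ) * (((bracket z ^ 3 : ℝ) : ℂ) * r z)‖ := fun z => by
    have e : ((bracket z)⁻¹ : ℂ) * (((bracket z ^ 3 : ℝ) : ℂ) * r z) =
        ((bracket z ^ 2 : ℝ) : ℂ) * r z := by
      have : (bracket z : ℂ) ≠ 0 := by exact_mod_cast (bracket_pos z).ne'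
      push_cast; field_simp
    rw [norm_zmul_iterate, e]
    refine mul_le_mul (pow_le_pow_right₀ one_le_two_pi hk) ?_ (norm_nonneg _) (by positivity)
    rw [norm_mul, norm_mul, norm_pow, Complex.norm_real, Complex.norm_real,
      Real.norm_eq_abs, Real.norm_eq_abs, abs_of_pos (pow_pos (bracket_pos z) 2)]
    gcongr
    calc |z| ^ k ≤ bracket z ^ k := by gcongr; exact abs_le_bracket z
      _ ≤ bracket z ^ 2 := pow_le_pow_right₀ (one_le_bracket z) hk
  exact (h1.norm.const_mul ((2 * Real.pi) ^ 2)).mono'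
    (continuous_zmul_iterate h.prim.continuous k).aestronglyMeasurable (Eventually.of_forall hb)

theorem eLpNorm_zmul_le (h : InX r r' N) {k : ℕ} (hk : k ≤ 3) :
    eLpNorm (zmul^[k] r) 2 volume ≤ ENNReal.ofReal ((2 * Real.pi) ^ 3 * N) := by
  refine eLpNorm_le_ofReal_mul (by positivity) (h.eLpNorm_pow_mul_le hk)
    (Eventually.of_forall fun z => ?_)
  rw [norm_zmul_iterate]
  exact mul_le_mul_of_nonneg_right (pow_le_pow_right₀ one_le_two_pi hk) (norm_nonneg _)

/-- Multiplication by `y` after the Fourier transform is differentiation before it, up to `2πi`. The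
factor `2π` in the hypothesis cancels that constant. -/
theorem weight_aux {g h : ℝ → ℂ} {A : ℝ} (hA : 0 ≤ A) (hp : IsPrim g h) (hg1 : Integrable g)
    (hg : MemLp g 2 volume)
    (hhm : AEStronglyMeasurable h volume)
    (hh : eLpNorm h 2 volume ≤ ENNReal.ofReal (2 * Real.pi * A)) :
    MemLp (fun y : ℝ => (y : ℂ) * ft g y) 2 volume ∧ ‖toE (fun y : ℝ => (y : ℂ) * ft g y)‖ ≤ A := by
  have hh2 := memLp_of_eLpNorm_le hhm hh
  have hae : (fun y : ℝ => (y : ℂ) * ft g y) =ᵐ[volume]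
      fun y => (2 * Real.pi * Complex.I)⁻¹ * FT (toE h) y := by
    filter_upwards [FT_of_isPrim hp hg hh2, FT_toE_ae' hg1 hg] with y h1 h2
    rw [h1, h2]
    have hpi : (Real.pi : ℂ) ≠ 0 := by exact_mod_cast Real.pi_ne_zero
    field_simp
  have hm : MemLp (fun y => (2 * Real.pi * Complex.I)⁻¹ * FT (toE h) y) 2 volume :=
    (Lp.memLp (FT (toE h))).const_mul _
  refine ⟨hm.ae_eq hae.symm, ?_⟩
  rw [toE_congr hae, toE_const_mul (Lp.memLp _), toE_coeFn, norm_smul,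
    LinearIsometryEquiv.norm_map]
  have h1 := norm_toE_le (by positivity) hh
  have h2 : ‖(2 * Real.pi * Complex.I : ℂ)⁻¹‖ = (2 * Real.pi)⁻¹ := by
    simp [abs_of_pos Real.pi_pos]
  rw [h2, inv_mul_le_iff₀ (by positivity)]
  exact h1

/-- The factor `(2π)³` comes from the third moment and absorbs the smaller constants of the other
bounds. The weights on the transforms of `r` and of `zmul r` come from the derivatives of `r` and of
`z r`. -/
theorem good (h : InX r r' N) : Good r ((2 * Real.pi) ^ 3 * N) := by
  have hN := h.nonneg
  have hpi := Real.pi_gt_three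
  have h8 : (2 : ℝ) ≤ (2 * Real.pi) ^ 3 := by
    calc (2 : ℝ) ≤ (2 * 3) ^ 3 := by norm_num
      _ ≤ (2 * Real.pi) ^ 3 := by gcongr
  have h2N : 2 * N ≤ (2 * Real.pi) ^ 3 * N := mul_le_mul_of_nonneg_right h8 hN
  have hml : ∀ k ≤ 3, MemLp (zmul^[k] r) 2 volume := fun k hk =>
    memLp_of_eLpNorm_le (continuous_zmul_iterate h.prim.continuous k).aestronglyMeasurable
      (h.eLpNorm_zmul_le hk)
  have hw : ∀ k ≤ 1, MemLp (fun y : ℝ => (y : ℂ) * ft (zmul^[k] r) y) 2 volume ∧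
      ‖toE (fun y : ℝ => (y : ℂ) * ft (zmul^[k] r) y)‖ ≤ (2 * Real.pi) ^ 3 * N := by
    intro k hk
    interval_cases k
    · have := weight_aux (A := (2 * Real.pi) ^ 3 * N) (by positivity) h.prim
        (h.integrable_zmul (k := 0) (by norm_num)) (hml 0 (by norm_num)) h.meas'
        (h.eLpNorm_deriv_le.trans (ENNReal.ofReal_le_ofReal ?_))
      · exact this
      · nlinarith [one_le_two_pi]
    · have e : zmul^[1] r = fun z : ℝ => (-2 * Real.pi * Complex.I : ℂ) * ((z : ℂ) * r z) := by
        ext z; simp [zmul]; ring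
      have hp := h.isPrim_mul.const_mul (-2 * Real.pi * Complex.I)
      rw [← e] at hp
      refine weight_aux (A := (2 * Real.pi) ^ 3 * N) (by positivity) hp
        (h.integrable_zmul (k := 1) (by norm_num)) (hml 1 (by norm_num))
        hp.loc.aestronglyMeasurable ?_
      refine (eLpNorm_le_ofReal_mul (c := 2 * Real.pi) (by positivity) h.eLpNorm_deriv_mul_le
        (Eventually.of_forall fun z => ?_)).trans (ENNReal.ofReal_le_ofReal ?_)
      · rw [norm_mul]; simp [abs_of_pos Real.pi_pos]
      · gcongr
  exact
  { nonneg := by positivity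
    continuous := h.prim.continuous
    bound := fun z => (h.norm_le z).trans h2N
    integrable := fun k hk => h.integrable_zmul hk
    memLp := hml
    norm_le := fun k hk => norm_toE_le (by positivity) (h.eLpNorm_zmul_le hk)
    memLp_weight := fun k hk => (hw k hk).1
    weight_le := fun k hk => (hw k hk).2 }

theorem neg (h : InX r r' N) : InX (fun z => -r z) (fun z => -r' z) N where
  prim := by simpa using h.prim.const_mul (-1)
  nonneg := h.nonneg
  weight := by
    refine le_of_eq_of_le (eLpNorm_congr_norm_ae (Eventually.of_forall fun z => ?_)) h.weight
    simp
  weight_deriv := by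
    refine le_of_eq_of_le (eLpNorm_congr_norm_ae (Eventually.of_forall fun z => ?_)) h.weight_deriv
    simp

theorem reflect (h : InX r r' N) : InX (fun z => r (-z)) (fun z => -r' (-z)) N where
  prim := h.prim.comp_neg
  nonneg := h.nonneg
  weight := by
    have h1 := eLpNorm_comp_measurePreserving (p := 2)
      (g := fun z => ((bracket z ^ 3 : ℝ) : ℂ) * r z)
      ((Continuous.aestronglyMeasurable (by fun_prop)).mul h.meas)
      (Measure.measurePreserving_neg (volume : Measure ℝ))
    refine le_of_eq_of_le ?_ (h1.trans_le h.weight)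
    refine eLpNorm_congr_norm_ae (Eventually.of_forall fun z => ?_)
    simp [bracket_neg]
  weight_deriv := by
    have h1 := eLpNorm_comp_measurePreserving (p := 2)
      (g := fun z => (bracket z : ℂ) * r' z)
      ((Continuous.aestronglyMeasurable (by fun_prop)).mul h.meas')
      (Measure.measurePreserving_neg (volume : Measure ℝ))
    refine le_of_eq_of_le ?_ (h1.trans_le h.weight_deriv)
    refine eLpNorm_congr_norm_ae (Eventually.of_forall fun z => ?_)
    simp [bracket_neg]

theorem mono (h : InX r r' N) {M : ℝ} (hM : N ≤ M) : InX r r' M :=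
  ⟨h.prim, h.nonneg.trans hM, h.weight.trans (ENNReal.ofReal_le_ofReal hM),
    h.weight_deriv.trans (ENNReal.ofReal_le_ofReal hM)⟩

end InX

end

section

/-! ### The Marchenko equation -/

/-- The translates of the derivatives of the Fourier transform of `p`, on the half-line. -/
def wv (p : ℝ → ℂ) (k : ℕ) (s : ℝ) : E := cut 0 (vec (zmul^[k] p) s)

/-- The operator of the Marchenko equation. -/
def opK (ρ p : ℝ → ℂ) (s : ℝ) : E →L[ℂ] E := cut 0 ∘L Gam ρ ∘L cut s ∘L Gam p ∘L cut 0

/-- The source term of the Marchenko equation. -/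
def src (ρ p : ℝ → ℂ) (s : ℝ) : E := cut 0 (Gam ρ (cut s (toE (ft p))))

/-- The resolvent of the Marchenko equation. -/
def res (ρ p : ℝ → ℂ) (s : ℝ) : E →L[ℂ] E := Ring.inverse (1 + opK ρ p s)

/-- The solution of the Marchenko equation. -/
def solA (ρ p : ℝ → ℂ) (s : ℝ) : E := -res ρ p s (src ρ p s)

/-- The potential reconstructed from the solution of the Marchenko equation. -/
def solU (ρ p : ℝ → ℂ) (s : ℝ) : ℂ := ft p s + pair (wv p 0 s) (solA ρ p s)

/-- The matrix elements of the resolvent. -/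
def bb (ρ p : ℝ → ℂ) (k j : ℕ) (s : ℝ) : ℂ := pair (wv p k s) (res ρ p s (wv ρ j s))

variable {ρ p : ℝ → ℂ} {M N : ℝ}

theorem Good.memLp_top (h : Good p N) : MemLp p ∞ volume :=
  memLp_top_of_bound h.continuous.aestronglyMeasurable N (Eventually.of_forall h.bound)

theorem Good.norm_Gam_le (h : Good p N) : ‖Gam p‖ ≤ N :=
  NonlocalMKdV.norm_Gam_le h.continuous.aestronglyMeasurable h.nonneg h.bound

theorem Good.continuous_wv (h : Good p N) {k : ℕ} (hk : k ≤ 3) : Continuous (wv p k) :=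
  (cut 0).continuous.comp (continuous_vec (h.memLp k hk))

theorem Good.hasDerivAt_wv (h : Good p N) {k : ℕ} (hk : k ≤ 2) (s : ℝ) :
    HasDerivAt (wv p k) (wv p (k + 1) s) s := by
  have h2 := h.memLp (k + 1) (by omega)
  rw [Function.iterate_succ_apply'] at h2
  have h1 := hasDerivAt_vec (h.memLp k (by omega)) h2 s
  rw [wv, Function.iterate_succ_apply']
  exact ((cut 0).restrictScalars ℝ).hasFDerivAt.comp_hasDerivAt s h1

theorem Good.norm_wv_le (h : Good p N) {k : ℕ} (hk : k ≤ 3) (s : ℝ) : ‖wv p k s‖ ≤ N :=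
  (norm_cut_le _ _).trans (by rw [norm_vec (h.memLp k hk)]; exact h.norm_le k hk)

theorem Good.memLp_ft (h : Good p N) {k : ℕ} (hk : k ≤ 2) : MemLp (ft (zmul^[k] p)) 2 volume :=
  (Lp.memLp (FT (toE (zmul^[k] p)))).ae_eq
    (FT_toE_ae' (h.integrable k hk) (h.memLp k (by omega)))

theorem Good.toE_ft (h : Good p N) {k : ℕ} (hk : k ≤ 2) :
    toE (ft (zmul^[k] p)) = FT (toE (zmul^[k] p)) :=
  (eq_toE (FT_toE_ae' (h.integrable k hk) (h.memLp k (by omega)))).symm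

theorem Good.continuous_ft (h : Good p N) {k : ℕ} (hk : k ≤ 2) : Continuous (ft (zmul^[k] p)) :=
  NonlocalMKdV.continuous_ft (h.integrable k hk)

/-- The rank one operator which is minus the derivative of `opK`. -/
def rankOne (ρ p : ℝ → ℂ) (s : ℝ) : E →L[ℂ] E := (pair (wv p 0 s)).smulRight (wv ρ 0 s)

theorem rankOne_apply (s : ℝ) (X : E) : rankOne ρ p s X = pair (wv p 0 s) X • wv ρ 0 s := rfl

theorem continuous_rankOne (hρ : Good ρ M) (hp : Good p N) : Continuous (rankOne ρ p) := by
  have h1 : Continuous fun s => (pair (wv p 0 s) : E →L[ℂ] ℂ) :=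
    pair.continuous.comp (hp.continuous_wv (by norm_num))
  have h2 := hρ.continuous_wv (k := 0) (by norm_num)
  exact ((ContinuousLinearMap.smulRightL ℂ E E).continuous₂).comp (h1.prodMk h2)

/-- The parameter enters only through the cut-off in the middle, and moving that cut-off sweeps out
rank one operators. Hence the family is continuously differentiable in operator norm, although the
cut-offs alone are not norm continuous. -/
theorem opK_sub (hρ : Good ρ M) (hp : Good p N) (a b : ℝ) :
    opK ρ p b - opK ρ p a = -∫ t in a..b, rankOne ρ p t := by
  ext1 X
  have h0 : MemLp ρ 2 volume := hρ.memLp 0 (by norm_num)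
  have h1 := Gam_cut_sub h0 hρ.memLp_top
    (continuous_pair_vec (hp.memLp 0 (by norm_num)) (cut 0 X))
    (coeFn_Gam (hp.memLp 0 (by norm_num)) hp.memLp_top (cut 0 X)) a b
  have h2 : (opK ρ p b - opK ρ p a) X = cut 0 (Gam ρ (cut b (Gam p (cut 0 X))) -
      Gam ρ (cut a (Gam p (cut 0 X)))) := by
    rw [map_sub]; rfl
  have h4 : Continuous fun t => pair (vec p t) (cut 0 X) • vec ρ t :=
    (continuous_pair_vec (hp.memLp 0 (by norm_num)) _).smul (continuous_vec h0)
  have h3 : (∫ t in a..b, rankOne ρ p t) X = ∫ t in a..b, rankOne ρ p t X :=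
    ContinuousLinearMap.intervalIntegral_apply
      ((continuous_rankOne hρ hp).intervalIntegrable a b) X
  have h5 := (cut 0).intervalIntegral_comp_comm (h4.intervalIntegrable (μ := volume) a b)
  rw [h2]
  erw [h1]
  rw [map_neg, neg_apply, h3]
  congr 1
  refine Eq.trans h5.symm (intervalIntegral.integral_congr fun t _ => ?_)
  simp only [rankOne_apply, map_smul, wv, pair_cut, Function.iterate_zero, id]

theorem hasDerivAt_opK (hρ : Good ρ M) (hp : Good p N) (s : ℝ) :
    HasDerivAt (opK ρ p) (-rankOne ρ p s) s := by
  have h1 : opK ρ p = fun b => opK ρ p 0 + -∫ t in (0 : ℝ)..b, rankOne ρ p t := by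
    ext1 b; rw [← opK_sub hρ hp]; abel
  have hc := continuous_rankOne hρ hp
  rw [h1]
  exact ((intervalIntegral.integral_hasDerivAt_right (hc.intervalIntegrable _ _)
    ⟨Set.univ, univ_mem, hc.aestronglyMeasurable.restrict⟩ hc.continuousAt).neg).const_add _

theorem hasDerivAt_src (hρ : Good ρ M) (hp : Good p N) (s : ℝ) :
    HasDerivAt (src ρ p) (-(ft p s • wv ρ 0 s)) s := by
  have h0 : MemLp ρ 2 volume := hρ.memLp 0 (by norm_num)
  have hF : Continuous (ft p) := hp.continuous_ft (k := 0) (by norm_num)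
  have hc : Continuous fun t => ft p t • wv ρ 0 t := hF.smul (hρ.continuous_wv (by norm_num))
  have h1 : src ρ p = fun b => src ρ p 0 + -∫ t in (0 : ℝ)..b, ft p t • wv ρ 0 t := by
    ext1 b
    have h2 := Gam_cut_sub h0 hρ.memLp_top hF
      (coeFn_toE (hp.memLp_ft (k := 0) (by norm_num))) 0 b
    have h4 : Continuous fun t => ft p t • vec ρ t := hF.smul (continuous_vec h0)
    have h5 := (cut 0).intervalIntegral_comp_comm (h4.intervalIntegrable (μ := volume) 0 b)
    have h6 : src ρ p b - src ρ p 0 = -∫ t in (0 : ℝ)..b, ft p t • wv ρ 0 t := by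
      rw [src, src, ← map_sub]
      erw [h2]
      rw [map_neg]
      congr 1
      refine Eq.trans h5.symm (intervalIntegral.integral_congr fun t _ => ?_)
      simp only [map_smul, wv, Function.iterate_zero, id]
    rw [← h6]; abel
  rw [h1]
  exact ((intervalIntegral.integral_hasDerivAt_right (hc.intervalIntegrable _ _)
    ⟨Set.univ, univ_mem, hc.aestronglyMeasurable.restrict⟩ hc.continuousAt).neg).const_add _

theorem mul_res {s : ℝ} (hu : IsUnit (1 + opK ρ p s)) : (1 + opK ρ p s) * res ρ p s = 1 :=
  Ring.mul_inverse_cancel _ hu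

/-- The derivative of an inverse is `-R K' R`, and `K'` is minus a rank one operator. -/
theorem hasDerivAt_res (hρ : Good ρ M) (hp : Good p N) {s : ℝ} (hu : IsUnit (1 + opK ρ p s)) :
    HasDerivAt (res ρ p) (res ρ p s ∘L rankOne ρ p s ∘L res ρ p s) s := by
  have h1 := (hasFDerivAt_ringInverse (𝕜 := ℂ) hu.unit).restrictScalars ℝ
  have h2 : HasDerivAt (fun t => 1 + opK ρ p t) (-rankOne ρ p s) s :=
    (hasDerivAt_opK hρ hp s).const_add 1
  have h3 := HasFDerivAt.comp_hasDerivAt (x := s) (f := fun t => 1 + opK ρ p t)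
    (l := (Ring.inverse : (E →L[ℂ] E) → (E →L[ℂ] E))) h1 h2
  refine h3.congr_deriv ?_
  have h4 : (↑(hu.unit⁻¹) : E →L[ℂ] E) = res ρ p s := by
    rw [res, Ring.inverse_of_isUnit hu]
  simp only [ContinuousLinearMap.coe_restrictScalars', neg_apply,
    ContinuousLinearMap.mulLeftRight_apply, h4]
  rw [mul_neg, neg_mul, neg_neg]
  rfl

theorem clm_hasDerivAt_apply {T : ℝ → E →L[ℂ] E} {T' : E →L[ℂ] E} {v : ℝ → E} {v' : E} {s : ℝ}
    (hT : HasDerivAt T T' s) (hv : HasDerivAt v v' s) :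
    HasDerivAt (fun t => T t (v t)) (T' (v s) + T s v') s := by
  have h1 := ((isBoundedBilinearMap_apply (𝕜 := ℂ) (E := E) (F := E)).hasFDerivAt
    (T s, v s)).restrictScalars ℝ
  have h2 := h1.comp_hasDerivAt s (hT.prodMk hv)
  refine h2.congr_deriv ?_
  simp [add_comm]

theorem pair_hasDerivAt {f g : ℝ → E} {f' g' : E} {s : ℝ}
    (hf : HasDerivAt f f' s) (hg : HasDerivAt g g' s) :
    HasDerivAt (fun t => pair (f t) (g t)) (pair f' (g s) + pair (f s) g') s := by
  have h1 := (pair.isBoundedBilinearMap.hasFDerivAt (f s, g s)).restrictScalars ℝ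
  have h2 := h1.comp_hasDerivAt s (hf.prodMk hg)
  refine h2.congr_deriv ?_
  simp [add_comm]

theorem hasDerivAt_resolvent_wv (hρ : Good ρ M) (hp : Good p N) {s : ℝ}
    (hu : IsUnit (1 + opK ρ p s)) {j : ℕ} (hj : j ≤ 2) :
    HasDerivAt (fun t => res ρ p t (wv ρ j t))
      (res ρ p s (wv ρ (j + 1) s) + bb ρ p 0 j s • res ρ p s (wv ρ 0 s)) s := by
  refine (clm_hasDerivAt_apply (hasDerivAt_res hρ hp hu) (hρ.hasDerivAt_wv hj s)).congr_deriv ?_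
  rw [add_comm]
  congr 1
  simp only [ContinuousLinearMap.comp_apply, rankOne_apply, map_smul, bb]

/-- Two terms arise, from the resolvent and from the source. Both are multiples of the same vector,
and their coefficients add up to the potential itself. -/
theorem hasDerivAt_solA (hρ : Good ρ M) (hp : Good p N) {s : ℝ}
    (hu : IsUnit (1 + opK ρ p s)) :
    HasDerivAt (solA ρ p) (solU ρ p s • res ρ p s (wv ρ 0 s)) s := by
  have h1 := (clm_hasDerivAt_apply (hasDerivAt_res hρ hp hu) (hasDerivAt_src hρ hp s)).neg
  refine h1.congr_deriv ?_
  simp only [ContinuousLinearMap.comp_apply, rankOne_apply, map_smul, map_neg, solU, solA]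
  rw [add_smul, neg_smul, neg_add, neg_neg, add_comm]

/-- The quadratic term comes from the rank one derivative of the resolvent. Differentiation
therefore stays within the algebra of these pairings, and each derivative costs one more moment of a
symbol. -/
theorem hasDerivAt_bb (hρ : Good ρ M) (hp : Good p N) {s : ℝ}
    (hu : IsUnit (1 + opK ρ p s)) {k j : ℕ} (hk : k ≤ 2) (hj : j ≤ 2) :
    HasDerivAt (bb ρ p k j) (bb ρ p (k + 1) j s + bb ρ p k (j + 1) s +
      bb ρ p 0 j s * bb ρ p k 0 s) s := by
  refine (pair_hasDerivAt (hp.hasDerivAt_wv hk s)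
    (hasDerivAt_resolvent_wv hρ hp hu hj)).congr_deriv ?_
  simp only [map_add, map_smul, smul_eq_mul, bb]
  ring

/-- The pairings of the derivatives of the Fourier transform of `p` with the solution. -/
def aa (ρ p : ℝ → ℂ) (k : ℕ) (s : ℝ) : ℂ := pair (wv p k s) (solA ρ p s)

theorem hasDerivAt_aa (hρ : Good ρ M) (hp : Good p N) {s : ℝ}
    (hu : IsUnit (1 + opK ρ p s)) {k : ℕ} (hk : k ≤ 2) :
    HasDerivAt (aa ρ p k) (aa ρ p (k + 1) s + solU ρ p s * bb ρ p k 0 s) s := by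
  refine (pair_hasDerivAt (hp.hasDerivAt_wv hk s) (hasDerivAt_solA hρ hp hu)).congr_deriv ?_
  simp only [map_smul, smul_eq_mul, bb, aa]

end

/-! ### The potential, its three derivatives and their common majorant -/

section

variable {ρ p : ℝ → ℂ} {M N : ℝ}

theorem eLpNorm_le_of_norm_toE_le {f : ℝ → ℂ} {C : ℝ} (hf : MemLp f 2 volume) (h : ‖toE f‖ ≤ C) :
    eLpNorm f 2 volume ≤ ENNReal.ofReal C := by
  rw [norm_toE hf] at h
  rw [← ENNReal.ofReal_toReal hf.2.ne]
  exact ENNReal.ofReal_le_ofReal h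

/-- Translation by `s` is an isometry and carries the half-line beyond `a` to the one beyond `s +
a`. So the norms in the Marchenko equation are tails of a fixed function, the source of all decay as
`s → +∞`. -/
theorem Good.norm_cut_vec (h : Good p N) {k : ℕ} (hk : k ≤ 2) (a s : ℝ) :
    ‖cut a (vec (zmul^[k] p) s)‖ = ‖cut (s + a) (toE (ft (zmul^[k] p)))‖ := by
  set F := ft (zmul^[k] p)
  have h1 : (cut a (vec (zmul^[k] p) s) : ℝ → ℂ) =ᵐ[volume]
      (Set.indicator (Set.Ioi (s + a)) F) ∘ fun y => s + y := by
    filter_upwards [coeFn_cut a (vec (zmul^[k] p) s),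
      coeFn_vec (h.integrable k hk) (h.memLp k (by omega)) s] with y h1 h2
    rw [h1]
    by_cases hy : a < y
    · rw [Set.indicator_of_mem (by exact hy), h2, Function.comp, Set.indicator_of_mem]
      simpa using hy
    · rw [Set.indicator_of_notMem (by exact hy), Function.comp, Set.indicator_of_notMem]
      simpa using hy
  have h2 : (cut (s + a) (toE F) : ℝ → ℂ) =ᵐ[volume] Set.indicator (Set.Ioi (s + a)) F := by
    filter_upwards [coeFn_cut (s + a) (toE F), coeFn_toE (f := F) (h.memLp_ft hk)] with y h1 h2
    rw [h1]
    by_cases hy : y ∈ Set.Ioi (s + a)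
    · rw [Set.indicator_of_mem hy, Set.indicator_of_mem hy, h2]
    · rw [Set.indicator_of_notMem hy, Set.indicator_of_notMem hy]
  have h3 : AEStronglyMeasurable (Set.indicator (Set.Ioi (s + a)) F) volume :=
    (h.continuous_ft hk).aestronglyMeasurable.indicator measurableSet_Ioi
  rw [Lp.norm_def, Lp.norm_def, eLpNorm_congr_ae h1, eLpNorm_congr_ae h2,
    eLpNorm_comp_measurePreserving h3 (measurePreserving_add_left volume s)]

theorem Good.norm_wv_eq (h : Good p N) {k : ℕ} (hk : k ≤ 2) (s : ℝ) :
    ‖wv p k s‖ = ‖cut s (toE (ft (zmul^[k] p)))‖ := by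
  rw [wv, h.norm_cut_vec hk, add_zero]

theorem Good.eLpNorm_bracket_ft_le (h : Good p N) {k : ℕ} (hk : k ≤ 1) :
    eLpNorm (fun y => (bracket y : ℂ) * ft (zmul^[k] p) y) 2 volume ≤ ENNReal.ofReal (2 * N) := by
  set F := ft (zmul^[k] p)
  have hF : MemLp F 2 volume := h.memLp_ft (k := k) (by omega)
  have hyF : MemLp (fun y : ℝ => y * F y) 2 volume := h.memLp_weight k hk
  have h1 : eLpNorm (fun y => ((‖F y‖ : ℝ) : ℂ)) 2 volume ≤ ENNReal.ofReal N := by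
    refine le_of_eq_of_le (eLpNorm_congr_norm_ae (Eventually.of_forall fun y => by simp))
      (eLpNorm_le_of_norm_toE_le hF ?_)
    rw [h.toE_ft (by omega), LinearIsometryEquiv.norm_map]
    exact h.norm_le k (by omega)
  have h2 : eLpNorm (fun y : ℝ => ((‖y * F y‖ : ℝ) : ℂ)) 2 volume ≤ ENNReal.ofReal N :=
    le_of_eq_of_le (eLpNorm_congr_norm_ae (Eventually.of_forall fun y => by simp))
      (eLpNorm_le_of_norm_toE_le hyF (h.weight_le k hk))
  have hc := h.continuous_ft (k := k) (by omega)
  have h3 := eLpNorm_add_le_ofReal h.nonneg h.nonneg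
    (Continuous.aestronglyMeasurable (by fun_prop)) (Continuous.aestronglyMeasurable (by fun_prop))
    h1 h2
  rw [two_mul]
  refine (eLpNorm_mono fun y => ?_).trans h3
  rw [← Complex.ofReal_add, Complex.norm_real, Real.norm_of_nonneg (by positivity), norm_mul,
    norm_mul, Complex.norm_real, Complex.norm_real, Real.norm_of_nonneg (bracket_pos y).le,
    Real.norm_eq_abs]
  nlinarith [bracket_le y, norm_nonneg (F y)]

/-- For `s ≥ 0` the weight increases along `(s, ∞)` and can be pulled inside the norm. For negative
`s` it is at most its value at `s₁`. This restricts the estimates to half-lines bounded below. -/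
theorem Good.bracket_mul_norm_cut_le (h : Good p N) {k : ℕ} (hk : k ≤ 1) {s₁ s : ℝ} (hs : s₁ ≤ s) :
    bracket s * ‖cut s (toE (ft (zmul^[k] p)))‖ ≤ (2 + bracket s₁) * N := by
  set F := ft (zmul^[k] p)
  have hF : MemLp F 2 volume := h.memLp_ft (k := k) (by omega)
  have hN := h.nonneg
  have hb := bracket_pos s₁
  rcases le_or_gt 0 s with h0 | h0
  · have hw := h.eLpNorm_bracket_ft_le hk
    have hc := h.continuous_ft (k := k) (by omega)
    have hm : MemLp (fun y => (bracket y : ℂ) * F y) 2 volume :=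
      memLp_of_eLpNorm_le (Continuous.aestronglyMeasurable (by fun_prop)) hw
    have h1 : ‖(bracket s : ℂ) • cut s (toE F)‖ ≤ ‖toE fun y => (bracket y : ℂ) * F y‖ := by
      refine Lp.norm_le_norm_of_ae_le ?_
      filter_upwards [Lp.coeFn_smul (bracket s : ℂ) (cut s (toE F)), coeFn_cut s (toE F),
        coeFn_toE hF, coeFn_toE hm] with y e1 e2 e3 e4
      rw [e1, Pi.smul_apply, e2, e4]
      by_cases hy : y ∈ Set.Ioi s
      · rw [Set.indicator_of_mem hy, e3, norm_smul, norm_mul, Complex.norm_real, Complex.norm_real,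
          Real.norm_of_nonneg (bracket_pos _).le, Real.norm_of_nonneg (bracket_pos _).le]
        have : bracket s ≤ bracket y := Real.sqrt_le_sqrt (by
          have : s < y := hy
          nlinarith)
        gcongr
      · rw [Set.indicator_of_notMem hy, smul_zero, norm_zero]; exact norm_nonneg _
    have h2 := norm_toE_le (by positivity) hw
    rw [norm_smul, Complex.norm_real, Real.norm_of_nonneg (bracket_pos _).le] at h1
    nlinarith
  · have h1 : ‖cut s (toE F)‖ ≤ N := by
      refine (norm_cut_le _ _).trans ?_
      rw [h.toE_ft (by omega), LinearIsometryEquiv.norm_map]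
      exact h.norm_le k (by omega)
    have h2 : bracket s ≤ bracket s₁ := Real.sqrt_le_sqrt (by nlinarith)
    calc bracket s * ‖cut s (toE F)‖ ≤ bracket s₁ * N := by gcongr
      _ ≤ (2 + bracket s₁) * N := by nlinarith

/-- The function dominating the potential and its derivatives. -/
def majorant (p : ℝ → ℂ) (s : ℝ) : ℝ :=
  bracket s * ‖ft p s‖ + bracket s * ‖ft (zmul p) s‖ + ‖ft (zmul^[2] p) s‖ +
    ‖FT (toE (zmul^[3] p)) s‖ + (bracket s)⁻¹

theorem majorant_nonneg (p : ℝ → ℂ) (s : ℝ) : 0 ≤ majorant p s := by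
  have := bracket_pos s
  unfold majorant; positivity

theorem Good.eLpNorm_majorant_le (h : Good p N) :
    eLpNorm (fun s => (majorant p s : ℂ)) 2 volume ≤
      ENNReal.ofReal (2 * N + 2 * N + N + N + 2 * Real.pi) := by
  have hN := h.nonneg
  have c0 : Continuous (ft p) := h.continuous_ft (k := 0) (by norm_num)
  have c1 : Continuous (ft (zmul p)) := h.continuous_ft (k := 1) (by norm_num)
  have c2 := h.continuous_ft (k := 2) (by norm_num)
  have e : ∀ {f : ℝ → ℂ} {g : ℝ → ℝ} {A : ℝ}, (∀ x, ‖f x‖ = g x) →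
      eLpNorm f 2 volume ≤ ENNReal.ofReal A →
      eLpNorm (fun s => (g s : ℂ)) 2 volume ≤ ENNReal.ofReal A := by
    intro f g A hfg hA
    refine le_of_eq_of_le (eLpNorm_congr_norm_ae (Eventually.of_forall fun y => ?_)) hA
    rw [hfg, Complex.norm_real, Real.norm_of_nonneg (by rw [← hfg]; positivity)]
  have b0 := e (g := fun s => bracket s * ‖ft p s‖) (fun s => by
    rw [norm_mul, Complex.norm_real, Real.norm_of_nonneg (bracket_pos s).le]; rfl)
    (h.eLpNorm_bracket_ft_le (k := 0) (by norm_num))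
  have b1 := e (g := fun s => bracket s * ‖ft (zmul p) s‖) (fun s => by
    rw [norm_mul, Complex.norm_real, Real.norm_of_nonneg (bracket_pos s).le]; rfl)
    (h.eLpNorm_bracket_ft_le (k := 1) (by norm_num))
  have b2 := e (g := fun s => ‖ft (zmul^[2] p) s‖) (A := N) (fun s => rfl)
    (eLpNorm_le_of_norm_toE_le (h.memLp_ft (k := 2) (by norm_num)) (by
      rw [h.toE_ft (by norm_num), LinearIsometryEquiv.norm_map]
      exact h.norm_le 2 (by norm_num)))
  have b3 := e (g := fun s => ‖FT (toE (zmul^[3] p)) s‖) (A := N) (fun s => rfl)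
    (eLpNorm_le_of_norm_toE_le (Lp.memLp (FT (toE (zmul^[3] p)))) (by
      rw [toE_coeFn, LinearIsometryEquiv.norm_map]
      exact h.norm_le 3 (by norm_num)))
  have b4 := e (g := fun s => (bracket s)⁻¹) (fun s => by
    rw [norm_inv, Complex.norm_real, Real.norm_of_nonneg (bracket_pos s).le]) eLpNorm_inv_bracket_le
  have m0 : AEStronglyMeasurable (fun s => ((bracket s * ‖ft p s‖ : ℝ) : ℂ)) volume :=
    Continuous.aestronglyMeasurable (by fun_prop)
  have m1 : AEStronglyMeasurable (fun s => ((bracket s * ‖ft (zmul p) s‖ : ℝ) : ℂ)) volume :=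
    Continuous.aestronglyMeasurable (by fun_prop)
  have m2 : AEStronglyMeasurable (fun s => ((‖ft (zmul^[2] p) s‖ : ℝ) : ℂ)) volume :=
    Continuous.aestronglyMeasurable (by fun_prop)
  have m3 : AEStronglyMeasurable (fun s => ((‖FT (toE (zmul^[3] p)) s‖ : ℝ) : ℂ)) volume :=
    Complex.continuous_ofReal.comp_aestronglyMeasurable (Lp.aestronglyMeasurable _).norm
  have m4 : AEStronglyMeasurable (fun s => (((bracket s)⁻¹ : ℝ) : ℂ)) volume :=
    (Complex.continuous_ofReal.comp
      (continuous_bracket.inv₀ fun s => (bracket_pos s).ne')).aestronglyMeasurable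
  have := eLpNorm_add_le_ofReal (by positivity) (by positivity) (((m0.add m1).add m2).add m3) m4
    (eLpNorm_add_le_ofReal (by positivity) (by positivity) ((m0.add m1).add m2) m3
      (eLpNorm_add_le_ofReal (by positivity) (by positivity) (m0.add m1) m2
        (eLpNorm_add_le_ofReal (by positivity) (by positivity) m0 m1 b0 b1) b2) b3) b4
  simp only [majorant, Complex.ofReal_add]
  exact this

theorem norm_src_le (hρ : Good ρ M) (s : ℝ) : ‖src ρ p s‖ ≤ M * ‖cut s (toE (ft p))‖ :=
  (norm_cut_le _ _).trans ((Gam ρ).le_of_opNorm_le hρ.norm_Gam_le _)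

theorem norm_solA_le (hρ : Good ρ M) {κ s : ℝ} (hκ : ‖res ρ p s‖ ≤ κ) :
    ‖solA ρ p s‖ ≤ κ * (M * ‖cut s (toE (ft p))‖) := by
  rw [solA, norm_neg]
  refine ((res ρ p s).le_of_opNorm_le hκ _).trans ?_
  have : 0 ≤ κ := (norm_nonneg _).trans hκ
  gcongr
  exact norm_src_le hρ s

theorem norm_bb_le (hρ : Good ρ M) (hp : Good p N) {κ s : ℝ} (hκ : ‖res ρ p s‖ ≤ κ) {k j : ℕ}
    (hk : k ≤ 3) (hj : j ≤ 3) : ‖bb ρ p k j s‖ ≤ N * (κ * M) := by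
  have h0 : 0 ≤ κ := (norm_nonneg _).trans hκ
  have := hp.nonneg
  refine (norm_pair_le _ _).trans ?_
  gcongr
  · exact hp.norm_wv_le hk s
  · refine ((res ρ p s).le_of_opNorm_le hκ _).trans ?_
    gcongr
    exact hρ.norm_wv_le hj s

/-- The first derivative of the potential. -/
def solU₁ (ρ p : ℝ → ℂ) (s : ℝ) : ℂ := ft (zmul p) s + aa ρ p 1 s + solU ρ p s * bb ρ p 0 0 s

/-- The derivative of `bb ρ p k j`. -/
def bb' (ρ p : ℝ → ℂ) (k j : ℕ) (s : ℝ) : ℂ :=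
  bb ρ p (k + 1) j s + bb ρ p k (j + 1) s + bb ρ p 0 j s * bb ρ p k 0 s

/-- The second derivative of the potential, up to a term that is twice integrable only. -/
def solW (ρ p : ℝ → ℂ) (s : ℝ) : ℂ :=
  aa ρ p 2 s + solU ρ p s * bb ρ p 1 0 s +
    (solU₁ ρ p s * bb ρ p 0 0 s + solU ρ p s * bb' ρ p 0 0 s)

/-- The second derivative of the potential. -/
def solU₂ (ρ p : ℝ → ℂ) (s : ℝ) : ℂ := ft (zmul^[2] p) s + solW ρ p s

/-- The derivative of `solW`. -/
def solW' (ρ p : ℝ → ℂ) (s : ℝ) : ℂ :=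
  aa ρ p 3 s + solU ρ p s * bb ρ p 2 0 s +
    (solU₁ ρ p s * bb ρ p 1 0 s + solU ρ p s * bb' ρ p 1 0 s) +
    (solU₂ ρ p s * bb ρ p 0 0 s + solU₁ ρ p s * bb' ρ p 0 0 s +
      (solU₁ ρ p s * bb' ρ p 0 0 s + solU ρ p s * (bb' ρ p 1 0 s + bb' ρ p 0 1 s +
        (bb' ρ p 0 0 s * bb ρ p 0 0 s + bb ρ p 0 0 s * bb' ρ p 0 0 s))))

/-- The third derivative of the potential. -/
def solU₃ (ρ p : ℝ → ℂ) (s : ℝ) : ℂ := FT (toE (zmul^[3] p)) s + solW' ρ p s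

theorem hasDerivAt_solU (hρ : Good ρ M) (hp : Good p N) {s : ℝ} (hu : IsUnit (1 + opK ρ p s)) :
    HasDerivAt (solU ρ p) (solU₁ ρ p s) s := by
  have h1 := hasDerivAt_ft (hp.integrable 0 (by norm_num)) (hp.integrable 1 (by norm_num)) s
  refine (h1.add (hasDerivAt_aa hρ hp hu (k := 0) (by norm_num))).congr_deriv ?_
  simp only [solU₁, Function.iterate_zero, id]; ring

theorem hasDerivAt_solU₁ (hρ : Good ρ M) (hp : Good p N) {s : ℝ} (hu : IsUnit (1 + opK ρ p s)) :
    HasDerivAt (solU₁ ρ p) (solU₂ ρ p s) s := by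
  have h1 := hasDerivAt_ft (hp.integrable 1 (by norm_num)) (hp.integrable 2 (by norm_num)) s
  refine ((h1.add (hasDerivAt_aa hρ hp hu (k := 1) (by norm_num))).add
    ((hasDerivAt_solU hρ hp hu).mul
      (hasDerivAt_bb hρ hp hu (k := 0) (j := 0) (by norm_num) (by norm_num)))).congr_deriv ?_
  simp only [solU₂, solW, bb', Function.iterate_succ_apply', Function.iterate_zero, id]; ring

theorem hasDerivAt_solW (hρ : Good ρ M) (hp : Good p N) {s : ℝ} (hu : IsUnit (1 + opK ρ p s)) :
    HasDerivAt (solW ρ p) (solW' ρ p s) s := by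
  have hb : ∀ k j, k ≤ 1 → j ≤ 1 → HasDerivAt (bb ρ p k j) (bb' ρ p k j s) s := fun k j hk hj =>
    hasDerivAt_bb hρ hp hu (hk.trans (by norm_num)) (hj.trans (by norm_num))
  have hb2 : HasDerivAt (bb' ρ p 0 0) (bb' ρ p 1 0 s + bb' ρ p 0 1 s +
      (bb' ρ p 0 0 s * bb ρ p 0 0 s + bb ρ p 0 0 s * bb' ρ p 0 0 s)) s :=
    ((hb 1 0 le_rfl (by norm_num)).add (hb 0 1 (by norm_num) le_rfl)).add
      ((hb 0 0 (by norm_num) (by norm_num)).mul (hb 0 0 (by norm_num) (by norm_num)))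
  exact ((hasDerivAt_aa hρ hp hu (k := 2) (by norm_num)).add
    ((hasDerivAt_solU hρ hp hu).mul (hb 1 0 le_rfl (by norm_num)))).add
    (((hasDerivAt_solU₁ hρ hp hu).mul (hb 0 0 (by norm_num) (by norm_num))).add
      ((hasDerivAt_solU hρ hp hu).mul hb2))

/-- Provides the integrability and measurability that turn `solW'` into an integrand. The pairing
with the third moment need not be differentiable, but it is continuous because `wv p 3` is. -/
theorem continuousAt_solW' (hρ : Good ρ M) (hp : Good p N) {s : ℝ}
    (hu : IsUnit (1 + opK ρ p s)) : ContinuousAt (solW' ρ p) s := by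
  have hb : ∀ k j, k ≤ 2 → j ≤ 2 → ContinuousAt (bb ρ p k j) s := fun k j hk hj =>
    (hasDerivAt_bb hρ hp hu hk hj).continuousAt
  have hb' : ∀ k j, k ≤ 1 → j ≤ 1 → ContinuousAt (bb' ρ p k j) s := fun k j hk hj =>
    ((hb _ _ (by omega) (by omega)).add (hb _ _ (by omega) (by omega))).add
      ((hb _ _ (by omega) (by omega)).mul (hb _ _ (by omega) (by omega)))
  have h3 : ContinuousAt (aa ρ p 3) s := by
    have h4 : ContinuousAt (fun t => pair (wv p 3 t)) s :=
      pair.continuous.continuousAt.comp (hp.continuous_wv le_rfl).continuousAt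
    exact h4.clm_apply (hasDerivAt_solA hρ hp hu).continuousAt
  have u0 := (hasDerivAt_solU hρ hp hu).continuousAt
  have u1 := (hasDerivAt_solU₁ hρ hp hu).continuousAt
  have u2 : ContinuousAt (solU₂ ρ p) s :=
    (hp.continuous_ft (k := 2) le_rfl).continuousAt.add (hasDerivAt_solW hρ hp hu).continuousAt
  have b20 := hb 2 0 (by norm_num) (by norm_num)
  have b10 := hb 1 0 (by norm_num) (by norm_num)
  have b00 := hb 0 0 (by norm_num) (by norm_num)
  have c10 := hb' 1 0 (by norm_num) (by norm_num)
  have c01 := hb' 0 1 (by norm_num) (by norm_num)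
  have c00 := hb' 0 0 (by norm_num) (by norm_num)
  unfold solW'
  fun_prop

end

/-! ### Estimates of the potential on a half-line bounded below -/

section

variable {ρ p : ℝ → ℂ} {M N : ℝ}

/-- The function `u` is of the class `H³ ∩ H^{1,1}` on `I`, with norms at most `C` and
with the third derivative `w`. -/
structure LocalEst (I : Set ℝ) (u w : ℝ → ℂ) (C : ℝ) : Prop where
  differentiableAt : ∀ s ∈ I, DifferentiableAt ℝ u s
  differentiableAt_deriv : ∀ s ∈ I, DifferentiableAt ℝ (deriv u) s
  locallyIntegrable : LocallyIntegrable w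
  integral_eq : ∀ a ∈ I, ∀ b ∈ I, ∫ s in a..b, w s = deriv (deriv u) b - deriv (deriv u) a
  norm_le : eLpNorm (I.indicator fun s => (bracket s : ℂ) * u s) 2 volume ≤ ENNReal.ofReal C
  norm_deriv_le : eLpNorm (I.indicator fun s => (bracket s : ℂ) * deriv u s) 2 volume ≤
    ENNReal.ofReal C
  norm_deriv₂_le : eLpNorm (I.indicator (deriv (deriv u))) 2 volume ≤ ENNReal.ofReal C
  norm_deriv₃_le : eLpNorm (I.indicator w) 2 volume ≤ ENNReal.ofReal C

theorem norm_add_le_of {a b : ℂ} {x y : ℝ} (ha : ‖a‖ ≤ x) (hb : ‖b‖ ≤ y) : ‖a + b‖ ≤ x + y :=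
  (norm_add_le _ _).trans (add_le_add ha hb)

theorem norm_mul_le_of {a b : ℂ} {x y : ℝ} (ha : ‖a‖ ≤ x) (hb : ‖b‖ ≤ y) : ‖a * b‖ ≤ x * y := by
  rw [norm_mul]; exact mul_le_mul ha hb (norm_nonneg _) ((norm_nonneg _).trans ha)

/-- The size of the potential and its derivatives. -/
theorem exists_norm_solU_le (M N κ s₁ : ℝ) (hM : 0 ≤ M) (hN : 0 ≤ N) (hκ0 : 0 ≤ κ) :
    ∃ C, 0 ≤ C ∧ ∀ ρ p : ℝ → ℂ, Good ρ M → Good p N → ∀ s, s₁ ≤ s → ‖res ρ p s‖ ≤ κ →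
      bracket s * ‖solU ρ p s‖ ≤ C * majorant p s ∧ bracket s * ‖solU₁ ρ p s‖ ≤ C * majorant p s ∧
      ‖solU₂ ρ p s‖ ≤ C * majorant p s ∧ ‖solU₃ ρ p s‖ ≤ C * majorant p s := by
  -- `D` bounds the weighted tails, `(T - 1)/⟨s⟩` the pairings `aa`, `β` the pairings `bb`, and `γ`
  -- their derivatives. Then `T`, `c1`, `c2`, `c3` are the multiples of the majorant that bound the
  -- potential and its three derivatives, each found from the preceding ones by the product rule.
  obtain ⟨D, hD⟩ : ∃ D, D = (2 + bracket s₁) * N := ⟨_, rfl⟩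
  obtain ⟨T, hT⟩ : ∃ T, T = 1 + (N + D) * (κ * (M * D)) := ⟨_, rfl⟩
  obtain ⟨β, hβ⟩ : ∃ β, β = N * (κ * M) := ⟨_, rfl⟩
  obtain ⟨γ, hγ⟩ : ∃ γ, γ = β + β + β * β := ⟨_, rfl⟩
  have hD0 : 0 ≤ D := by rw [hD]; have := bracket_pos s₁; positivity
  have hT1 : 1 ≤ T := by
    rw [hT]; have : 0 ≤ (N + D) * (κ * (M * D)) := by positivity
    linarith
  have hβ0 : 0 ≤ β := by rw [hβ]; positivity
  have hγ0 : 0 ≤ γ := by rw [hγ]; positivity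
  obtain ⟨c1, hc1⟩ : ∃ c, c = T + T * β := ⟨_, rfl⟩
  obtain ⟨c2, hc2⟩ : ∃ c, c = T + T * β + (c1 * β + T * γ) := ⟨_, rfl⟩
  obtain ⟨c3, hc3⟩ : ∃ c, c = T + T * β + (c1 * β + T * γ) + (c2 * β + c1 * γ +
    (c1 * γ + T * (γ + γ + (γ * β + β * γ)))) := ⟨_, rfl⟩
  have p1 : 0 ≤ c1 := by rw [hc1]; positivity
  have p2 : 0 ≤ c2 := by rw [hc2]; positivity
  have p3 : 0 ≤ c3 := by rw [hc3]; positivity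
  refine ⟨T + c1 + c2 + c3, by positivity, fun ρ p hρ hp s hs hκ => ?_⟩
  set G := majorant p s with hG
  have hG0 : 0 ≤ G := majorant_nonneg p s
  have hW := bracket_pos s
  have hW1 := one_le_bracket s
  have hcut : ∀ k ≤ 1, ‖cut s (toE (ft (zmul^[k] p)))‖ ≤ D * (bracket s)⁻¹ := fun k hk => by
    rw [← div_eq_mul_inv, le_div_iff₀ hW, mul_comm, hD]
    exact hp.bracket_mul_norm_cut_le hk hs
  have hA : ‖solA ρ p s‖ ≤ κ * (M * D) * (bracket s)⁻¹ := by
    refine (norm_solA_le hρ hκ).trans ?_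
    rw [mul_assoc, mul_assoc]
    gcongr
    exact hcut 0 (by norm_num)
  have ha : ∀ k ≤ 3, ‖aa ρ p k s‖ ≤ (T - 1) * (bracket s)⁻¹ := fun k hk => by
    refine (norm_pair_le _ _).trans ((mul_le_mul (hp.norm_wv_le hk s) hA (norm_nonneg _) hN).trans ?_)
    rw [← mul_assoc, hT]
    gcongr
    nlinarith [mul_nonneg hD0 (mul_nonneg hκ0 (mul_nonneg hM hD0))]
  -- For at most one derivative both factors of the pairing decay like `1/⟨s⟩`. One factor pays for
  -- the weight, and the other keeps the bound square integrable.
  have ha' : ∀ k ≤ 1, bracket s * ‖aa ρ p k s‖ ≤ (T - 1) * (bracket s)⁻¹ := fun k hk => by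
    have h1 : ‖aa ρ p k s‖ ≤ D * (bracket s)⁻¹ * (κ * (M * D) * (bracket s)⁻¹) := by
      refine (norm_pair_le _ _).trans ?_
      rw [hp.norm_wv_eq (by omega)]
      exact mul_le_mul (hcut k hk) hA (norm_nonneg _) (by positivity)
    calc bracket s * ‖aa ρ p k s‖
        ≤ bracket s * (D * (bracket s)⁻¹ * (κ * (M * D) * (bracket s)⁻¹)) := by gcongr
      _ = D * (κ * (M * D)) * (bracket s)⁻¹ := by field_simp
      _ ≤ (T - 1) * (bracket s)⁻¹ := by
        rw [hT]; gcongr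
        nlinarith [mul_nonneg hN (mul_nonneg hκ0 (mul_nonneg hM hD0))]
  have hb : ∀ k j, k ≤ 3 → j ≤ 3 → ‖bb ρ p k j s‖ ≤ β := fun k j hk hj => by
    rw [hβ]; exact norm_bb_le hρ hp hκ hk hj
  have hb' : ∀ k j, k ≤ 2 → j ≤ 2 → ‖bb' ρ p k j s‖ ≤ γ := fun k j hk hj => by
    rw [hγ]
    exact norm_add_le_of (norm_add_le_of (hb _ _ (by omega) (by omega)) (hb _ _ (by omega)
      (by omega))) (norm_mul_le_of (hb _ _ (by omega) (by omega)) (hb _ _ (by omega) (by omega)))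
  have hinv : (bracket s)⁻¹ ≤ G := by
    rw [hG, majorant]
    have : 0 ≤ bracket s * ‖ft p s‖ + bracket s * ‖ft (zmul p) s‖ + ‖ft (zmul^[2] p) s‖ +
      ‖FT (toE (zmul^[3] p)) s‖ := by positivity
    linarith
  have hF : ∀ {x : ℝ}, x + (bracket s)⁻¹ ≤ G → 0 ≤ x → x + (T - 1) * (bracket s)⁻¹ ≤ T * G := by
    intro x h1 h2
    have h3 : (T - 1) * (x + (bracket s)⁻¹) ≤ (T - 1) * G :=
      mul_le_mul_of_nonneg_left h1 (by linarith)
    nlinarith [mul_nonneg (sub_nonneg.2 hT1) h2, inv_nonneg.2 hW.le]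
  have n0 : 0 ≤ bracket s * ‖ft p s‖ := by positivity
  have n1 : 0 ≤ bracket s * ‖ft (zmul p) s‖ := by positivity
  have n2 : 0 ≤ ‖ft (zmul^[2] p) s‖ := by positivity
  have n3 : 0 ≤ ‖FT (toE (zmul^[3] p)) s‖ := by positivity
  have u0 : bracket s * ‖solU ρ p s‖ ≤ T * G := by
    have h1 : ‖solU ρ p s‖ ≤ ‖ft p s‖ + ‖aa ρ p 0 s‖ := norm_add_le _ _
    calc bracket s * ‖solU ρ p s‖ ≤ bracket s * (‖ft p s‖ + ‖aa ρ p 0 s‖) := by gcongr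
      _ ≤ bracket s * ‖ft p s‖ + (T - 1) * (bracket s)⁻¹ := by
        have := ha' 0 (by norm_num)
        rw [mul_add]; linarith
      _ ≤ T * G := hF (by rw [hG, majorant]; linarith) n0
  have v0 : ‖solU ρ p s‖ ≤ T * G := (le_mul_of_one_le_left (norm_nonneg _) hW1).trans u0
  have u1 : bracket s * ‖solU₁ ρ p s‖ ≤ c1 * G := by
    have h1 : ‖solU₁ ρ p s‖ ≤ ‖ft (zmul p) s‖ + ‖aa ρ p 1 s‖ + ‖solU ρ p s‖ * β :=
      norm_add_le_of (norm_add_le _ _) (norm_mul_le_of le_rfl (hb _ _ (by omega) (by omega)))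
    calc bracket s * ‖solU₁ ρ p s‖
        ≤ bracket s * (‖ft (zmul p) s‖ + ‖aa ρ p 1 s‖ + ‖solU ρ p s‖ * β) := by gcongr
      _ = bracket s * ‖ft (zmul p) s‖ + bracket s * ‖aa ρ p 1 s‖ +
          bracket s * ‖solU ρ p s‖ * β := by ring
      _ ≤ bracket s * ‖ft (zmul p) s‖ + (T - 1) * (bracket s)⁻¹ + T * G * β := by
        have h2 := ha' 1 le_rfl
        have h3 := mul_le_mul_of_nonneg_right u0 hβ0
        linarith
      _ ≤ T * G + T * G * β := by
        gcongr; exact hF (by rw [hG, majorant]; linarith) n1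
      _ = c1 * G := by rw [hc1]; ring
  have v1 : ‖solU₁ ρ p s‖ ≤ c1 * G := (le_mul_of_one_le_left (norm_nonneg _) hW1).trans u1
  have b00 := hb 0 0 (by norm_num) (by norm_num)
  have b10 := hb 1 0 (by norm_num) (by norm_num)
  have b20 := hb 2 0 (by norm_num) (by norm_num)
  have d00 := hb' 0 0 (by norm_num) (by norm_num)
  have d10 := hb' 1 0 (by norm_num) (by norm_num)
  have d01 := hb' 0 1 (by norm_num) (by norm_num)
  have v2 : ‖solU₂ ρ p s‖ ≤ c2 * G := by
    have h1 : ‖solU₂ ρ p s‖ ≤ ‖ft (zmul^[2] p) s‖ + ((T - 1) * (bracket s)⁻¹ + T * G * β +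
        (c1 * G * β + T * G * γ)) :=
      norm_add_le_of le_rfl (norm_add_le_of (norm_add_le_of (ha 2 (by norm_num))
        (norm_mul_le_of v0 b10)) (norm_add_le_of (norm_mul_le_of v1 b00) (norm_mul_le_of v0 d00)))
    have h2 := hF (x := ‖ft (zmul^[2] p) s‖) (by rw [hG, majorant]; linarith) n2
    calc ‖solU₂ ρ p s‖ ≤ T * G + T * G * β + (c1 * G * β + T * G * γ) := by linarith
      _ = c2 * G := by rw [hc2]; ring
  have v3 : ‖solU₃ ρ p s‖ ≤ c3 * G := by
    have h1 : ‖solU₃ ρ p s‖ ≤ ‖FT (toE (zmul^[3] p)) s‖ + ((T - 1) * (bracket s)⁻¹ + T * G * β +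
        (c1 * G * β + T * G * γ) + (c2 * G * β + c1 * G * γ + (c1 * G * γ + T * G * (γ + γ +
          (γ * β + β * γ))))) :=
      norm_add_le_of le_rfl (norm_add_le_of (norm_add_le_of (norm_add_le_of (ha 3 (by norm_num))
        (norm_mul_le_of v0 b20)) (norm_add_le_of (norm_mul_le_of v1 b10) (norm_mul_le_of v0 d10)))
        (norm_add_le_of (norm_add_le_of (norm_mul_le_of v2 b00) (norm_mul_le_of v1 d00))
          (norm_add_le_of (norm_mul_le_of v1 d00) (norm_mul_le_of v0 (norm_add_le_of
            (norm_add_le_of d10 d01) (norm_add_le_of (norm_mul_le_of d00 b00)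
              (norm_mul_le_of b00 d00)))))))
    have h2 := hF (x := ‖FT (toE (zmul^[3] p)) s‖) (by rw [hG, majorant]; linarith) n3
    calc ‖solU₃ ρ p s‖ ≤ T * G + T * G * β + (c1 * G * β + T * G * γ) + (c2 * G * β + c1 * G * γ +
          (c1 * G * γ + T * G * (γ + γ + (γ * β + β * γ)))) := by linarith
      _ = c3 * G := by rw [hc3]; ring
  refine ⟨u0.trans ?_, u1.trans ?_, v2.trans ?_, v3.trans ?_⟩ <;> gcongr <;> linarith

/-- The potential on a half-line where the Marchenko equation is uniquely solvable. -/
theorem exists_localEst (M N κ s₁ : ℝ) (hM : 0 ≤ M) (hN : 0 ≤ N) (hκ0 : 0 ≤ κ) :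
    ∃ C, 0 ≤ C ∧ ∀ ρ p : ℝ → ℂ, Good ρ M → Good p N →
      (∀ s, s₁ ≤ s → IsUnit (1 + opK ρ p s) ∧ ‖res ρ p s‖ ≤ κ) →
      ∃ w, LocalEst (Set.Ioi s₁) (solU ρ p) w C := by
  obtain ⟨C, hC, h⟩ := exists_norm_solU_le M N κ s₁ hM hN hκ0
  refine ⟨C * (2 * N + 2 * N + N + N + 2 * Real.pi), by positivity, fun ρ p hρ hp hu => ?_⟩
  have hI : ∀ s ∈ Set.Ioi s₁, IsUnit (1 + opK ρ p s) := fun s hs => (hu s (le_of_lt hs)).1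
  have d0 : ∀ s ∈ Set.Ioi s₁, HasDerivAt (solU ρ p) (solU₁ ρ p s) s := fun s hs =>
    hasDerivAt_solU hρ hp (hI s hs)
  have e0 : ∀ s ∈ Set.Ioi s₁, deriv (solU ρ p) =ᶠ[𝓝 s] solU₁ ρ p := fun s hs => by
    filter_upwards [Ioi_mem_nhds hs] with t ht using (d0 t ht).deriv
  have d1 : ∀ s ∈ Set.Ioi s₁, HasDerivAt (deriv (solU ρ p)) (solU₂ ρ p s) s := fun s hs =>
    (hasDerivAt_solU₁ hρ hp (hI s hs)).congr_of_eventuallyEq (e0 s hs)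
  have hm : ∀ s ∈ Set.Ioi s₁, _ := fun s hs => h ρ p hρ hp s (le_of_lt hs) (hu s (le_of_lt hs)).2
  have key : ∀ f : ℝ → ℂ, (∀ s ∈ Set.Ioi s₁, ‖f s‖ ≤ C * majorant p s) →
      eLpNorm ((Set.Ioi s₁).indicator f) 2 volume ≤
        ENNReal.ofReal (C * (2 * N + 2 * N + N + N + 2 * Real.pi)) := fun f hf => by
    refine eLpNorm_le_ofReal_mul hC hp.eLpNorm_majorant_le (Eventually.of_forall fun s => ?_)
    rw [Complex.norm_real, Real.norm_of_nonneg (majorant_nonneg p s)]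
    by_cases hs : s ∈ Set.Ioi s₁
    · rw [Set.indicator_of_mem hs]; exact hf s hs
    · rw [Set.indicator_of_notMem hs, norm_zero]
      exact mul_nonneg hC (majorant_nonneg p s)
  have b3 := key (solU₃ ρ p) fun s hs => (hm s hs).2.2.2
  have hcW : ContinuousOn (solW' ρ p) (Set.Ioi s₁) := fun s hs =>
    (continuousAt_solW' hρ hp (hI s hs)).continuousWithinAt
  have hms : AEStronglyMeasurable ((Set.Ioi s₁).indicator (solU₃ ρ p)) volume := by
    rw [aestronglyMeasurable_indicator_iff measurableSet_Ioi]
    exact (Lp.aestronglyMeasurable _).restrict.add (hcW.aestronglyMeasurable measurableSet_Ioi)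
  have hP := isPrim_ft (hp.integrable 2 le_rfl) (by
    have := hp.memLp 3 le_rfl
    rwa [Function.iterate_succ_apply'] at this)
  rw [← Function.iterate_succ_apply' (f := zmul)] at hP
  -- The leading term of the third derivative is merely an element of `L²`, so it enters through an
  -- integral identity and not pointwise. Extension by zero outside the half-line makes local
  -- integrability on the whole line a consequence of the `L²` bound.
  refine ⟨(Set.Ioi s₁).indicator (solU₃ ρ p), fun s hs => (d0 s hs).differentiableAt,
    fun s hs => (d1 s hs).differentiableAt,
    (memLp_of_eLpNorm_le hms b3).locallyIntegrable (by norm_num), fun a ha b hb => ?_,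
    key _ fun s hs => ?_, key _ fun s hs => ?_, key _ fun s hs => ?_, ?_⟩
  · have hsub : Set.uIcc a b ⊆ Set.Ioi s₁ := (Set.ordConnected_Ioi).uIcc_subset ha hb
    have h1 : ∫ s in a..b, (Set.Ioi s₁).indicator (solU₃ ρ p) s = ∫ s in a..b, solU₃ ρ p s :=
      intervalIntegral.integral_congr fun s hs => Set.indicator_of_mem (hsub hs) _
    have hi : IntervalIntegrable (solW' ρ p) volume a b := (hcW.mono hsub).intervalIntegrable
    have h2 : ∫ s in a..b, solW' ρ p s = solW ρ p b - solW ρ p a :=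
      intervalIntegral.integral_eq_sub_of_hasDerivAt
        (fun s hs => hasDerivAt_solW hρ hp (hI s (hsub hs))) hi
    rw [h1, (d1 a ha).deriv, (d1 b hb).deriv]
    simp only [solU₃]
    rw [intervalIntegral.integral_add (hP.intervalIntegrable a b) hi, h2, hP.eq]
    simp only [solU₂]; ring
  · rw [norm_mul, Complex.norm_real, Real.norm_of_nonneg (bracket_pos s).le]
    exact (hm s hs).1
  · rw [norm_mul, Complex.norm_real, Real.norm_of_nonneg (bracket_pos s).le, (d0 s hs).deriv]
    exact (hm s hs).2.1
  · rw [(d1 s hs).deriv]; exact (hm s hs).2.2.1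
  · rw [Set.indicator_indicator, Set.inter_self]; exact b3

end

/-! ### Invertibility of the Marchenko operator -/

section

variable {ρ p : ℝ → ℂ} {M N : ℝ}

/-- Invertibility is the Neumann series, and the bound follows from `R = 1 - T R`. -/
theorem isUnit_one_add {T : E →L[ℂ] E} {q : ℝ} (hq : q < 1) (hT : ‖T‖ ≤ q) :
    IsUnit (1 + T) ∧ ‖Ring.inverse (1 + T)‖ ≤ (1 - q)⁻¹ := by
  have hu : IsUnit (1 + T) := by
    have := isUnit_one_sub_of_norm_lt_one (x := -T) (by rw [norm_neg]; linarith)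
    rwa [sub_neg_eq_add] at this
  refine ⟨hu, ?_⟩
  set R := Ring.inverse (1 + T)
  have h1 : R = 1 - T * R := by
    have : (1 + T) * R = 1 := Ring.mul_inverse_cancel _ hu
    rw [← this]; noncomm_ring
  have h2 : ‖R‖ ≤ 1 + q * ‖R‖ := by
    calc ‖R‖ = ‖1 - T * R‖ := by rw [← h1]
      _ ≤ ‖(1 : E →L[ℂ] E)‖ + ‖T * R‖ := norm_sub_le _ _
      _ ≤ 1 + ‖T‖ * ‖R‖ := add_le_add ContinuousLinearMap.norm_id_le (norm_mul_le _ _)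
      _ ≤ 1 + q * ‖R‖ := by gcongr
  rw [← one_div, le_div_iff₀ (by linarith)]
  linarith

theorem norm_opK_le_of_bound (hρ : Good ρ M) (hp : Good p N) {a b : ℝ} (ha : ∀ z, ‖ρ z‖ ≤ a)
    (hb : ∀ z, ‖p z‖ ≤ b) (s : ℝ) : ‖opK ρ p s‖ ≤ a * b := by
  have ha0 : 0 ≤ a := (norm_nonneg _).trans (ha 0)
  have hb0 : 0 ≤ b := (norm_nonneg _).trans (hb 0)
  refine ContinuousLinearMap.opNorm_le_bound _ (by positivity) fun X => ?_
  calc ‖opK ρ p s X‖ ≤ ‖Gam ρ (cut s (Gam p (cut 0 X)))‖ := norm_cut_le _ _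
    _ ≤ a * ‖cut s (Gam p (cut 0 X))‖ :=
      (Gam ρ).le_of_opNorm_le (norm_Gam_le hρ.continuous.aestronglyMeasurable ha0 ha) _
    _ ≤ a * (b * ‖X‖) := by
      gcongr
      refine (norm_cut_le _ _).trans (((Gam p).le_of_opNorm_le
        (norm_Gam_le hp.continuous.aestronglyMeasurable hb0 hb) _).trans ?_)
      gcongr
      exact norm_cut_le _ _
    _ = a * b * ‖X‖ := by ring

/-- The cut-off moves to the translate, whose remaining part is the tail beyond `s + y`. The
constant `3` is `2 + ⟨0⟩`. -/
theorem norm_pair_vec_cut_le (hρ : Good ρ M) {s y : ℝ} (hs : 0 ≤ s + y) (X : E) :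
    ‖pair (vec ρ y) (cut s X)‖ ≤ 3 * M * (bracket (s + y))⁻¹ * ‖X‖ := by
  rw [← pair_cut]
  refine (norm_pair_le _ _).trans ?_
  gcongr
  have h1 := hρ.norm_cut_vec (k := 0) (by norm_num) s y
  have h2 := hρ.bracket_mul_norm_cut_le (k := 0) (by norm_num) (s₁ := 0) (s := s + y) hs
  have h3 : bracket 0 = 1 := by simp [bracket]
  simp only [Function.iterate_zero, id] at h1 h2
  rw [h1, add_comm y s, ← div_eq_mul_inv, le_div_iff₀ (bracket_pos _)]
  rw [h3] at h2
  linarith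

/-- The tail of the square integrable function `1/⟨x⟩`. -/
def tail (s : ℝ) : ℝ := ‖toE ((Set.Ioi s).indicator fun z => ((bracket z)⁻¹ : ℂ))‖

theorem memLp_inv_bracket : MemLp (fun z => ((bracket z)⁻¹ : ℂ)) 2 volume :=
  memLp_of_eLpNorm_le ((Complex.continuous_ofReal.comp continuous_bracket).inv₀ fun z => by
    simpa using (bracket_pos z).ne').aestronglyMeasurable eLpNorm_inv_bracket_le

theorem tendsto_tail : Tendsto tail atTop (𝓝 0) := by
  have h1 : Tendsto (fun s => toE ((Set.Ioi s).indicator fun z => ((bracket z)⁻¹ : ℂ))) atTop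
      (𝓝 (toE 0)) := by
    refine tendsto_toE_of_dominated (G := fun z => ‖((bracket z)⁻¹ : ℂ)‖) memLp_inv_bracket.norm
      (fun s => memLp_inv_bracket.1.indicator measurableSet_Ioi) aestronglyMeasurable_const
      (Eventually.of_forall fun s => Eventually.of_forall fun z => norm_indicator_le_norm_self _ _)
      (Eventually.of_forall fun z => by simp) (Eventually.of_forall fun z => ?_)
    refine tendsto_const_nhds.congr' ?_
    filter_upwards [eventually_ge_atTop z] with s hs
    rw [Set.indicator_of_notMem (by simpa using hs)]; rfl
  have h2 : toE (0 : ℝ → ℂ) = 0 := by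
    rw [toE_eq MemLp.zero]; rfl
  rw [h2] at h1
  rw [← norm_zero (E := E)]
  exact h1.norm

/-- At `y > 0` the image is bounded by a multiple of `1/⟨s + y⟩`, and the `L²` norm of this function
on the half-line is `tail s`. -/
theorem norm_cut_Gam_cut_le (hρ : Good ρ M) {s : ℝ} (hs : 0 ≤ s) (X : E) :
    ‖cut 0 (Gam ρ (cut s X))‖ ≤ 3 * M * tail s * ‖X‖ := by
  have hM := hρ.nonneg
  have hm : MemLp ((Set.Ioi s).indicator fun z => ((bracket z)⁻¹ : ℂ)) 2 volume :=
    memLp_inv_bracket.indicator measurableSet_Ioi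
  have hm2 := hm.comp_measurePreserving (measurePreserving_add_left volume s)
  have e : tail s = ‖toE (((Set.Ioi s).indicator fun z => ((bracket z)⁻¹ : ℂ)) ∘ fun y => s + y)‖ := by
    rw [tail, norm_toE hm, norm_toE hm2,
      eLpNorm_comp_measurePreserving hm.1 (measurePreserving_add_left volume s)]
  rw [e, mul_right_comm]
  refine Lp.norm_le_mul_norm_of_ae_le_mul ?_
  filter_upwards [coeFn_cut 0 (Gam ρ (cut s X)), coeFn_Gam (r := ρ) (hρ.memLp 0 (by norm_num))
    hρ.memLp_top (cut s X), coeFn_toE hm2] with y h1 h2 h3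
  rw [h1, h3]
  by_cases hy : (0 : ℝ) < y
  · rw [Set.indicator_of_mem (by exact hy), h2, Function.comp, Set.indicator_of_mem (by simpa using hy),
      norm_inv, Complex.norm_real, Real.norm_of_nonneg (bracket_pos _).le]
    refine (norm_pair_vec_cut_le hρ (by linarith) X).trans (le_of_eq (by ring))
  · rw [Set.indicator_of_notMem (by exact hy), norm_zero]
    positivity

/-- No bound by one on the symbols is required: the smallness comes from the far half-line through
one of the Hankel factors. This serves the deformed symbols, and `S` depends only on the bounds `M`
and `N`. -/
theorem exists_isUnit_of_le (M N : ℝ) : ∃ S, 0 ≤ S ∧ ∀ ρ p : ℝ → ℂ, Good ρ M → Good p N →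
    ∀ s, S ≤ s → IsUnit (1 + opK ρ p s) ∧ ‖res ρ p s‖ ≤ 2 := by
  have h1 : Tendsto (fun s => 3 * M * tail s * N) atTop (𝓝 0) := by
    simpa using (tendsto_tail.const_mul (3 * M)).mul_const N
  obtain ⟨S, hS⟩ := ((h1.eventually (gt_mem_nhds (show (0 : ℝ) < 1 / 2 by norm_num))).and
    (eventually_ge_atTop 0)).exists_forall_of_atTop
  refine ⟨max S 0, le_max_right _ _, fun ρ p hρ hp s hs => ?_⟩
  obtain ⟨h2, h3⟩ := hS s ((le_max_left _ _).trans hs)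
  have hM := hρ.nonneg
  have ht : 0 ≤ tail s := norm_nonneg _
  have h4 : ‖opK ρ p s‖ ≤ 1 / 2 := by
    refine (ContinuousLinearMap.opNorm_le_bound _ (by have := hp.nonneg; positivity)
      fun X => ?_).trans h2.le
    refine (norm_cut_Gam_cut_le hρ h3 _).trans ?_
    rw [mul_assoc _ N]
    gcongr
    refine ((Gam p).le_of_opNorm_le hp.norm_Gam_le _).trans ?_
    have := hp.nonneg
    gcongr
    exact norm_cut_le _ _
  have := isUnit_one_add (by norm_num) h4
  norm_num at this
  exact this

end

section

/-! ### The Cauchy transform -/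

/-- `f` is an element of the Sobolev space `W^{1,1}(ℝ)` with the derivative `f'`. -/
structure InW (f f' : ℝ → ℂ) : Prop where
  prim : IsPrim f f'
  integrable : Integrable f
  integrable_deriv : Integrable f'

theorem InW.comp_neg {f f' : ℝ → ℂ} (h : InW f f') : InW (fun y => f (-y)) (fun y => -f' (-y)) :=
  ⟨h.prim.comp_neg, h.integrable.comp_neg, h.integrable_deriv.comp_neg.neg⟩

/-- The kernel of the Cauchy transform on the Fourier side. -/
def ker (z : ℂ) (y : ℝ) : ℂ := Complex.exp (2 * Real.pi * Complex.I * z * y)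

theorem norm_ker (z : ℂ) (y : ℝ) : ‖ker z y‖ = Real.exp (-(2 * Real.pi * z.im * y)) := by
  rw [ker, Complex.norm_exp]
  congr 1
  simp

theorem norm_ker_le_one {z : ℂ} {y : ℝ} (hz : 0 ≤ z.im) (hy : 0 ≤ y) : ‖ker z y‖ ≤ 1 := by
  rw [norm_ker, Real.exp_le_one_iff]
  have := Real.pi_pos
  have : 0 ≤ 2 * Real.pi * z.im * y := by positivity
  linarith

@[fun_prop]
theorem continuous_ker (z : ℂ) : Continuous (ker z) := by unfold ker; fun_prop

theorem ker_ofReal (x y : ℝ) : ker x y = chi (y * x) := by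
  rw [ker, chi]; congr 1; push_cast; ring

theorem hasDerivAt_ker (z : ℂ) (y : ℝ) :
    HasDerivAt (ker z) (2 * Real.pi * Complex.I * z * ker z y) y := by
  have h1 : HasDerivAt (fun y : ℝ => (2 * Real.pi * Complex.I * z * y : ℂ))
      (2 * Real.pi * Complex.I * z * 1) y :=
    ((hasDerivAt_id y).ofReal_comp).const_mul _
  refine h1.cexp.congr_deriv ?_
  rw [ker]; ring

theorem hasDerivAt_ker_left (z : ℂ) (y : ℝ) :
    HasDerivAt (fun z => ker z y) (2 * Real.pi * Complex.I * y * ker z y) z := by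
  have h1 : HasDerivAt (fun z : ℂ => (2 * Real.pi * Complex.I * z * y : ℂ))
      (2 * Real.pi * Complex.I * 1 * y) z :=
    (((hasDerivAt_id z).const_mul _)).mul_const _
  refine h1.cexp.congr_deriv ?_
  rw [ker]; ring

/-- The half-line Fourier transform, which is a function on the upper half-plane. -/
def cauchyUp (f : ℝ → ℂ) (z : ℂ) : ℂ := ∫ y in Set.Ioi 0, f y * ker z y

theorem integrableOn_mul_ker {f : ℝ → ℂ} (hf : Integrable f) {z : ℂ} (hz : 0 ≤ z.im) :
    IntegrableOn (fun y => f y * ker z y) (Set.Ioi 0) := by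
  refine hf.integrableOn.mul_bdd (c := 1) (continuous_ker z).aestronglyMeasurable ?_
  filter_upwards [ae_restrict_mem measurableSet_Ioi] with y hy
  exact norm_ker_le_one hz (le_of_lt hy)

theorem norm_cauchyUp_le {f : ℝ → ℂ} (hf : Integrable f) {z : ℂ} (hz : 0 ≤ z.im) :
    ‖cauchyUp f z‖ ≤ ∫ y, ‖f y‖ := by
  refine (norm_integral_le_integral_norm _).trans ?_
  refine le_trans ?_ (setIntegral_le_integral (s := Set.Ioi 0) hf.norm
    (Eventually.of_forall fun y => norm_nonneg _))
  refine setIntegral_mono_on (integrableOn_mul_ker hf hz).norm hf.norm.integrableOn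
    measurableSet_Ioi fun y hy => ?_
  rw [norm_mul]
  exact mul_le_of_le_one_right (norm_nonneg _) (norm_ker_le_one hz (le_of_lt hy))

theorem differentiableAt_cauchyUp {f : ℝ → ℂ} (hf : Integrable f) {z : ℂ} (hz : 0 < z.im) :
    DifferentiableAt ℂ (cauchyUp f) z := by
  -- On the ball of this radius the imaginary part stays above `ε`, so the derivative of the kernel
  -- is at most `t e^{-tε} ≤ 1/ε` with `t = 2πy`.
  set ε := z.im / 2 with hε
  have hε0 : 0 < ε := by positivity
  have hball : ∀ w ∈ Metric.ball z ε, ε ≤ w.im := fun w hw => by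
    have h1 : |(w - z).im| ≤ ‖w - z‖ := Complex.abs_im_le_norm _
    rw [Metric.mem_ball, dist_eq_norm] at hw
    have h2 := (abs_le.1 (h1.trans hw.le)).1
    rw [Complex.sub_im] at h2
    linarith
  have hpi := Real.pi_pos
  refine (hasDerivAt_integral_of_dominated_loc_of_deriv_le (𝕜 := ℂ) (bound := fun y => ‖f y‖ * ε⁻¹)
    (F := fun z y => f y * ker z y)
    (F' := fun z y => f y * (2 * Real.pi * Complex.I * y * ker z y))
    (Metric.ball_mem_nhds z hε0) (Eventually.of_forall fun w => ?_) (integrableOn_mul_ker hf hz.le) ?_ ?_ ?_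
    ?_).2.differentiableAt
  · exact hf.1.restrict.mul (continuous_ker w).aestronglyMeasurable
  · exact hf.1.restrict.mul (Continuous.aestronglyMeasurable (by fun_prop))
  · filter_upwards [ae_restrict_mem measurableSet_Ioi] with y hy w hw
    have hy : (0 : ℝ) < y := hy
    rw [norm_mul]
    gcongr
    rw [norm_mul, norm_ker]
    simp only [norm_mul, Complex.norm_ofNat, Complex.norm_real, Complex.norm_I, mul_one,
      Real.norm_of_nonneg hpi.le, Real.norm_of_nonneg hy.le]
    set t := 2 * Real.pi * y with ht
    have ht0 : 0 < t := by positivity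
    have h1 : Real.exp (-(2 * Real.pi * w.im * y)) ≤ Real.exp (-(t * ε)) := by
      apply Real.exp_le_exp.2
      have := hball w hw
      rw [ht]
      nlinarith [mul_le_mul_of_nonneg_left this (show 0 ≤ 2 * Real.pi * y by positivity)]
    refine (mul_le_mul_of_nonneg_left h1 ht0.le).trans ?_
    rw [Real.exp_neg, ← div_eq_mul_inv, div_le_iff₀ (Real.exp_pos _), inv_mul_eq_div,
      le_div_iff₀ hε0]
    linarith [Real.add_one_le_exp (t * ε)]
  · exact (hf.norm.mul_const _).integrableOn
  · exact Eventually.of_forall fun y w _ => (hasDerivAt_ker_left w y).const_mul _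

theorem tendsto_cauchyUp {f : ℝ → ℂ} (hf : Integrable f) (x : ℝ) :
    Tendsto (cauchyUp f) (𝓝[{z : ℂ | 0 < z.im}] (x : ℂ)) (𝓝 (cauchyUp f x)) := by
  refine tendsto_integral_filter_of_dominated_convergence (fun y => ‖f y‖) ?_ ?_
    hf.norm.integrableOn ?_
  · exact Eventually.of_forall fun z => hf.1.restrict.mul (continuous_ker z).aestronglyMeasurable
  · filter_upwards [self_mem_nhdsWithin] with z hz
    filter_upwards [ae_restrict_mem measurableSet_Ioi] with y hy
    rw [norm_mul]
    exact mul_le_of_le_one_right (norm_nonneg _) (norm_ker_le_one (le_of_lt hz) (le_of_lt hy))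
  · refine Eventually.of_forall fun y => ?_
    exact ((hasDerivAt_ker_left x y).continuousAt.tendsto.mono_left nhdsWithin_le_nhds).const_mul _

/-- Integration by parts: the factor `z` is produced by differentiating the kernel and is moved onto
`f`. The boundary term at `0` becomes the coefficient of `1/z`. -/
theorem InW.mul_cauchyUp {f f' : ℝ → ℂ} (h : InW f f') {z : ℂ} (hz : 0 ≤ z.im) :
    z * cauchyUp f z = Complex.I / (2 * Real.pi) * (f 0 + cauchyUp f' z) := by
  have hk : IsPrim (ker z) fun y => 2 * Real.pi * Complex.I * z * ker z y :=
    IsPrim.of_hasDerivAt (hasDerivAt_ker z) (by fun_prop)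
  have i1 := integrableOn_mul_ker h.integrable hz
  have i2 := integrableOn_mul_ker h.integrable_deriv hz
  have i3 : IntegrableOn (fun y => f y * (2 * Real.pi * Complex.I * z * ker z y)) (Set.Ioi 0) := by
    refine (i1.const_mul (2 * Real.pi * Complex.I * z)).congr (Eventually.of_forall fun y => ?_)
    simp only; ring
  have h1 := (h.prim.mul hk).integral_Ioi (a := 0) i1 (i2.add i3)
  rw [integral_add i2 i3] at h1
  have h2 : ∫ y in Set.Ioi 0, f y * (2 * Real.pi * Complex.I * z * ker z y) =
      2 * Real.pi * Complex.I * z * cauchyUp f z := by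
    rw [cauchyUp, ← integral_const_mul]
    congr 1; ext y; ring
  have h3 : ker z 0 = 1 := by simp [ker]
  rw [h2, h3, mul_one] at h1
  have hpi : (Real.pi : ℂ) ≠ 0 := by exact_mod_cast Real.pi_ne_zero
  have h4 : cauchyUp f' z + 2 * Real.pi * Complex.I * z * cauchyUp f z = -f 0 := h1
  have h5 : f 0 + cauchyUp f' z = -(2 * Real.pi * Complex.I * z * cauchyUp f z) := by
    linear_combination h4
  rw [h5]
  field_simp
  linear_combination (z * cauchyUp f z) * Complex.I_sq

/-- A Riemann–Lebesgue lemma up to the boundary of the half-plane. For test functions integration by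
parts gives decay like `1/|z|`, and these are dense in `L¹`, where the transform is bounded
uniformly in `z`. -/
theorem tendsto_cauchyUp_cobounded {g : ℝ → ℂ} (hg : Integrable g) :
    Tendsto (cauchyUp g) (Bornology.cobounded ℂ ⊓ 𝓟 {z : ℂ | 0 < z.im}) (𝓝 0) := by
  rw [Metric.tendsto_nhds]
  intro ε hε
  obtain ⟨h, hc, hs, hd⟩ := MemLp.exist_eLpNorm_sub_le (by simp) le_rfl (memLp_one_iff_integrable.2 hg)
    (half_pos hε)
  have hw : InW h (deriv h) :=
    ⟨IsPrim.of_hasDerivAt (fun x => (hs.differentiable (by simp) x).hasDerivAt)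
      (hs.continuous_deriv (by simp)), hs.continuous.integrable_of_hasCompactSupport hc,
      (hs.continuous_deriv (by simp)).integrable_of_hasCompactSupport hc.deriv⟩
  have hi : Integrable (fun y => g y - h y) := hg.sub hw.integrable
  have hd' : ∫ y, ‖g y - h y‖ ≤ ε / 2 := by
    rw [eLpNorm_one_eq_lintegral_enorm] at hd
    rw [integral_norm_eq_lintegral_enorm hi.1]
    exact ENNReal.toReal_le_of_le_ofReal (half_pos hε).le hd
  set K := ‖Complex.I / (2 * Real.pi)‖ * (‖h 0‖ + ∫ y, ‖deriv h y‖) with hK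
  have e1 : ∀ᶠ z in Bornology.cobounded ℂ ⊓ 𝓟 {z : ℂ | 0 < z.im}, 2 * K / ε < ‖z‖ :=
    (tendsto_norm_cobounded_atTop.eventually_gt_atTop _).filter_mono inf_le_left
  have e2 : ∀ᶠ z in Bornology.cobounded ℂ ⊓ 𝓟 {z : ℂ | 0 < z.im}, 0 < z.im :=
    (eventually_principal.2 fun z hz => hz).filter_mono inf_le_right
  filter_upwards [e1, e2] with z h1 h2
  have h3 : cauchyUp g z = cauchyUp (fun y => g y - h y) z + cauchyUp h z := by
    rw [cauchyUp, cauchyUp, cauchyUp, ← integral_add (integrableOn_mul_ker hi h2.le)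
      (integrableOn_mul_ker hw.integrable h2.le)]
    congr 1; ext y; ring
  have h4 := norm_cauchyUp_le hi h2.le
  have h5 : ‖z‖ * ‖cauchyUp h z‖ ≤ K := by
    rw [← norm_mul, hw.mul_cauchyUp h2.le, norm_mul, hK]
    gcongr
    exact (norm_add_le _ _).trans (by gcongr; exact norm_cauchyUp_le hw.integrable_deriv h2.le)
  have hz : 0 < ‖z‖ := by
    rw [norm_pos_iff]; rintro rfl; simp at h2
  have h6 : ‖cauchyUp h z‖ < ε / 2 := by
    rw [div_lt_iff₀ hε] at h1
    by_contra! hcon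
    nlinarith
  rw [dist_zero_right, h3]
  exact (norm_add_le _ _).trans_lt (by linarith)

theorem InW.tendsto_mul_cauchyUp {f f' : ℝ → ℂ} (h : InW f f') :
    Tendsto (fun z => z * cauchyUp f z) (Bornology.cobounded ℂ ⊓ 𝓟 {z : ℂ | 0 < z.im})
      (𝓝 (Complex.I / (2 * Real.pi) * f 0)) := by
  have h1 := ((tendsto_cauchyUp_cobounded h.integrable_deriv).const_add (f 0)).const_mul
    (Complex.I / (2 * Real.pi) : ℂ)
  rw [add_zero] at h1
  refine h1.congr' ?_
  filter_upwards [(eventually_principal.2 fun z hz => hz :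
    ∀ᶠ z in 𝓟 {z : ℂ | 0 < z.im}, 0 < z.im).filter_mono inf_le_right] with z hz
  exact (h.mul_cauchyUp hz.le).symm

/-- The Cauchy transform of the inverse Fourier transform of `f`. -/
def cau (f : ℝ → ℂ) (z : ℂ) : ℂ :=
  if 0 < z.im then cauchyUp f z else -cauchyUp (fun y => f (-y)) (-z)

theorem differentiableOn_cau {f : ℝ → ℂ} (hf : Integrable f) : DifferentiableOn ℂ (cau f) offReal := by
  intro z hz
  refine DifferentiableAt.differentiableWithinAt ?_
  rcases lt_or_gt_of_ne (show z.im ≠ 0 from hz) with h | h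
  · have h1 : DifferentiableAt ℂ (fun z => -cauchyUp (fun y => f (-y)) (-z)) z :=
      ((differentiableAt_cauchyUp hf.comp_neg (z := -z) (by simpa using h)).comp z
        differentiableAt_id.neg).neg
    refine h1.congr_of_eventuallyEq ?_
    filter_upwards [(isOpen_lt Complex.continuous_im continuous_const).mem_nhds h] with w hw
    rw [cau, if_neg (not_lt.2 (le_of_lt hw))]
  · refine (differentiableAt_cauchyUp hf h).congr_of_eventuallyEq ?_
    filter_upwards [(isOpen_lt continuous_const Complex.continuous_im).mem_nhds h] with w hw
    rw [cau, if_pos hw]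

/-- The boundary value from the lower half-plane of the Cauchy transform. -/
def cauM (f : ℝ → ℂ) (x : ℝ) : ℂ := -cauchyUp (fun y => f (-y)) (-x)

theorem tendsto_cau_up {f : ℝ → ℂ} (hf : Integrable f) (x : ℝ) :
    Tendsto (cau f) (𝓝[{z : ℂ | 0 < z.im}] (x : ℂ)) (𝓝 (cauchyUp f x)) := by
  refine (tendsto_cauchyUp hf x).congr' ?_
  filter_upwards [self_mem_nhdsWithin] with z hz
  rw [cau, if_pos hz]

theorem tendsto_neg_nhdsWithin (x : ℝ) :
    Tendsto (fun z : ℂ => -z) (𝓝[{z : ℂ | z.im < 0}] (x : ℂ)) (𝓝[{z : ℂ | 0 < z.im}] ((-x : ℝ) : ℂ)) := by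
  refine tendsto_nhdsWithin_iff.2 ⟨?_, ?_⟩
  · rw [Complex.ofReal_neg]
    exact (continuous_neg.tendsto (x : ℂ)).mono_left nhdsWithin_le_nhds
  · filter_upwards [self_mem_nhdsWithin] with z hz
    simpa using hz

theorem tendsto_cau_low {f : ℝ → ℂ} (hf : Integrable f) (x : ℝ) :
    Tendsto (cau f) (𝓝[{z : ℂ | z.im < 0}] (x : ℂ)) (𝓝 (cauM f x)) := by
  have h1 := ((tendsto_cauchyUp hf.comp_neg (-x)).comp (tendsto_neg_nhdsWithin x)).neg
  rw [Complex.ofReal_neg] at h1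
  refine h1.congr' ?_
  filter_upwards [self_mem_nhdsWithin] with z hz
  rw [cau, if_neg (not_lt.2 (le_of_lt hz))]; rfl

/-- The Plemelj formula on the Fourier side: the two boundary values are the integrals over the two
half-lines, up to sign, and together they give the full Fourier integral. -/
theorem cauchyUp_sub_cauM {f : ℝ → ℂ} (hf : Integrable f) (x : ℝ) :
    cauchyUp f x - cauM f x = ft f (-x) := by
  have h1 : IntegrableOn (fun y => f y * ker x y) (Set.Ioi 0) := integrableOn_mul_ker hf (by simp)
  have h0 : Integrable fun y => f y * ker x y := by
    refine hf.mul_bdd (c := 1) (continuous_ker x).aestronglyMeasurable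
      (Eventually.of_forall fun y => ?_)
    rw [norm_ker]; simp
  have h2 : ∫ y in Set.Ioi 0, f (-y) * ker (-x) y = ∫ y in Set.Iic 0, f y * ker x y := by
    have := integral_comp_neg_Ioi (0 : ℝ) (fun y => f y * ker x y)
    rw [neg_zero] at this
    rw [← this]
    congr 1; ext y
    rw [ker, ker]; push_cast; congr 2; ring
  rw [cauM, sub_neg_eq_add, cauchyUp, cauchyUp, h2, add_comm,
    intervalIntegral.integral_Iic_add_Ioi h0.integrableOn h0.integrableOn, ft]
  congr 1; ext y
  rw [ker_ofReal, mul_comm]; congr 2; ring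

theorem atInfinity_eq : atInfinity = (Bornology.cobounded ℂ ⊓ 𝓟 {z : ℂ | 0 < z.im}) ⊔
    (Bornology.cobounded ℂ ⊓ 𝓟 {z : ℂ | z.im < 0}) := by
  rw [atInfinity, ← inf_sup_left, sup_principal]
  congr 2
  ext z
  simp only [offReal, Set.mem_ofPred_eq, Set.mem_union, ne_iff_lt_or_gt]
  exact or_comm

theorem tendsto_neg_cobounded : Tendsto (fun z : ℂ => -z)
    (Bornology.cobounded ℂ ⊓ 𝓟 {z : ℂ | z.im < 0})
    (Bornology.cobounded ℂ ⊓ 𝓟 {z : ℂ | 0 < z.im}) := by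
  refine Tendsto.inf ?_ (tendsto_principal_principal.2 fun z hz => by simpa using hz)
  rw [← tendsto_norm_atTop_iff_cobounded]
  simpa using tendsto_norm_cobounded_atTop (E := ℂ)

theorem InW.tendsto_mul_cau {f f' : ℝ → ℂ} (h : InW f f') :
    Tendsto (fun z => z * cau f z) atInfinity (𝓝 (Complex.I / (2 * Real.pi) * f 0)) := by
  rw [atInfinity_eq]
  refine Tendsto.sup ?_ ?_
  · refine h.tendsto_mul_cauchyUp.congr' ?_
    filter_upwards [(eventually_principal.2 fun z hz => hz :
      ∀ᶠ z in 𝓟 {z : ℂ | 0 < z.im}, 0 < z.im).filter_mono inf_le_right] with z hz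
    rw [cau, if_pos hz]
  · have h1 := h.comp_neg.tendsto_mul_cauchyUp.comp tendsto_neg_cobounded
    rw [neg_zero] at h1
    refine h1.congr' ?_
    filter_upwards [(eventually_principal.2 fun z hz => hz :
      ∀ᶠ z in 𝓟 {z : ℂ | z.im < 0}, z.im < 0).filter_mono inf_le_right] with z hz
    rw [cau, if_neg (not_lt.2 hz.le), Function.comp]; ring

theorem eventually_ne_zero_atInfinity : ∀ᶠ z in atInfinity, z ≠ 0 :=
  Eventually.filter_mono (inf_le_right : atInfinity ≤ 𝓟 offReal) <|
    eventually_principal.2 fun z (hz : z.im ≠ 0) => by rintro rfl; simp at hz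

theorem isBigO_of_tendsto_mul {f : ℂ → ℂ} {c : ℂ} (h : Tendsto (fun z => z * f z) atInfinity (𝓝 c)) :
    f =O[atInfinity] (fun z : ℂ => z⁻¹) := by
  have h1 := (h.isBigO_one ℂ).mul (Asymptotics.isBigO_refl (fun z : ℂ => z⁻¹) atInfinity)
  refine (h1.congr' ?_ ?_)
  · filter_upwards [eventually_ne_zero_atInfinity] with z hz
    field_simp
  · exact Eventually.of_forall fun z => by simp

end

section

/-! ### Convolutions -/

/-- The correlation of two functions. -/
def corr (f g : ℝ → ℂ) (y : ℝ) : ℂ := ∫ t, f (y + t) * g t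

theorem corr_eq_convolution (f g : ℝ → ℂ) :
    corr f g = convolution (fun t => g (-t)) f (ContinuousLinearMap.mul ℂ ℂ) volume := by
  ext y
  rw [convolution_def, corr, ← integral_neg_eq_self]
  simp [mul_comm, sub_eq_add_neg]

theorem integrable_corr_prod {f g : ℝ → ℂ} (hf : Integrable f) (hg : Integrable g) :
    Integrable (fun z : ℝ × ℝ => f (z.1 + z.2) * g z.2) (volume.prod volume) := by
  have h1 := (measurePreserving_prod_add_swap (volume : Measure ℝ) (volume : Measure ℝ)).integrable_comp_of_integrable
    (hg.mul_prod hf)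
  refine h1.congr (Eventually.of_forall fun z => ?_)
  simp only [Function.comp]
  rw [mul_comm, add_comm]

theorem integrable_corr {f g : ℝ → ℂ} (hf : Integrable f) (hg : Integrable g) :
    Integrable (corr f g) := (integrable_corr_prod hf hg).integral_prod_left

theorem ft_corr {f g : ℝ → ℂ} (hf : Integrable f) (hg : Integrable g) (w : ℝ) :
    ft (corr f g) w = ft g (-w) * ft f w := by
  rw [corr_eq_convolution, ← fourier_eq_ft, Real.fourier_mul_convolution_eq hg.comp_neg hf,
    fourier_eq_ft, fourier_eq_ft, ft_neg_eq]

theorem InW.norm_le {f f' : ℝ → ℂ} (h : InW f f') (y : ℝ) : ‖f y‖ ≤ ∫ x, ‖f' x‖ := by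
  have h1 := h.prim.integral_Ioi (a := y) h.integrable.integrableOn h.integrable_deriv.integrableOn
  rw [← norm_neg, ← h1]
  exact (norm_integral_le_integral_norm _).trans (setIntegral_le_integral h.integrable_deriv.norm
    (Eventually.of_forall fun _ => norm_nonneg _))

/-- By Fubini the derivative falls on the first factor, so the second need only be integrable. -/
theorem InW.corr {f f' g : ℝ → ℂ} (hf : InW f f') (hg : Integrable g) :
    InW (corr f g) (corr f' g) := by
  refine ⟨⟨(integrable_corr hf.integrable_deriv hg).locallyIntegrable, fun a b => ?_⟩,
    integrable_corr hf.integrable hg, integrable_corr hf.integrable_deriv hg⟩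
  wlog hab : a ≤ b
  · rw [intervalIntegral.integral_symm, this hf hg b a (le_of_not_ge hab)]; ring
  have h1 : Integrable (fun z : ℝ × ℝ => f' (z.1 + z.2) * g z.2)
      ((volume.restrict (Set.Ioc a b)).prod volume) :=
    (integrable_corr_prod hf.integrable_deriv hg).mono_measure
      (Measure.prod_mono Measure.restrict_le_self le_rfl)
  have hi : ∀ c, Integrable fun t => f (c + t) * g t := fun c =>
    hg.bdd_mul (c := ∫ x, ‖f' x‖) (hf.prim.continuous.comp (by fun_prop)).aestronglyMeasurable
      (Eventually.of_forall fun t => hf.norm_le _)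
  rw [intervalIntegral.integral_of_le hab]
  simp only [NonlocalMKdV.corr]
  rw [integral_integral_swap h1, ← integral_sub (hi b) (hi a)]
  congr 1; ext t
  have h2 : ∫ y in a..b, f' (y + t) = f (b + t) - f (a + t) := by
    rw [intervalIntegral.integral_comp_add_right, hf.prim.eq]
  rw [integral_mul_const, ← intervalIntegral.integral_of_le hab, h2]; ring

theorem InW.add {f f' g g' : ℝ → ℂ} (hf : InW f f') (hg : InW g g') :
    InW (fun x => f x + g x) (fun x => f' x + g' x) :=
  ⟨hf.prim.add hg.prim, hf.integrable.add hg.integrable, hf.integrable_deriv.add hg.integrable_deriv⟩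

theorem InW.neg {f f' : ℝ → ℂ} (hf : InW f f') : InW (fun x => -f x) (fun x => -f' x) :=
  ⟨by simpa using hf.prim.const_mul (-1), hf.integrable.neg, hf.integrable_deriv.neg⟩

theorem InW.comp_add {f f' : ℝ → ℂ} (hf : InW f f') (s : ℝ) :
    InW (fun x => f (s + x)) (fun x => f' (s + x)) := by
  refine ⟨⟨(hf.integrable_deriv.comp_add_left s).locallyIntegrable, fun a b => ?_⟩,
    hf.integrable.comp_add_left s, hf.integrable_deriv.comp_add_left s⟩
  rw [intervalIntegral.integral_comp_add_left, hf.prim.eq]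

variable {ρ p : ℝ → ℂ} {M N : ℝ}

theorem Good.memLp_bracket_ft (h : Good p N) {k : ℕ} (hk : k ≤ 1) :
    MemLp (fun y => (bracket y : ℂ) * ft (zmul^[k] p) y) 2 volume := by
  have hc := h.continuous_ft (k := k) (by omega)
  exact memLp_of_eLpNorm_le (Continuous.aestronglyMeasurable (by fun_prop)) (h.eLpNorm_bracket_ft_le hk)

/-- Write `(1+|y|)^{1/4} = (1+|y|)^{-3/4} (1+|y|)`. The first factor is square integrable, and the
second is covered by the weight. The spare quarter power is what makes the Marchenko kernel
integrable below. -/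
theorem Good.integrable_rpow_ft (h : Good p N) {k : ℕ} (hk : k ≤ 1) :
    Integrable fun y : ℝ => (((1 + |y|) ^ (1 / 4 : ℝ) : ℝ) : ℂ) * ft (zmul^[k] p) y := by
  have hc := h.continuous_ft (k := k) (by omega)
  have h0 : ∀ y : ℝ, 0 < 1 + |y| := fun y => by positivity
  have hcr : ∀ e : ℝ, Continuous fun y : ℝ => (((1 + |y|) ^ e : ℝ) : ℂ) := fun e =>
    Complex.continuous_ofReal.comp ((by fun_prop : Continuous fun y : ℝ => 1 + |y|).rpow_const
      fun y => Or.inl (h0 y).ne')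
  have h1 : MemLp (fun y : ℝ => (((1 + |y|) ^ (-(3 / 4) : ℝ) : ℝ) : ℂ)) 2 volume := by
    rw [← memLp_norm_iff (hcr _).aestronglyMeasurable,
      memLp_two_iff_integrable_sq (hcr _).norm.aestronglyMeasurable]
    have := integrable_one_add_norm (μ := (volume : Measure ℝ)) (r := 3 / 2) (by norm_num)
    refine this.congr (Eventually.of_forall fun y => ?_)
    simp only
    rw [Complex.norm_real, Real.norm_of_nonneg (Real.rpow_nonneg (h0 y).le _), ← Real.rpow_natCast,
      ← Real.rpow_mul (h0 y).le, Real.norm_eq_abs]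
    norm_num
  have h2 := h1.integrable_mul (h.memLp_bracket_ft hk)
  refine (h2.norm.const_mul 2).mono' ((hcr _).mul hc).aestronglyMeasurable
    (Eventually.of_forall fun y => ?_)
  simp only [norm_mul, Complex.norm_real, Real.norm_of_nonneg (Real.rpow_nonneg (h0 y).le _),
    Real.norm_of_nonneg (bracket_pos y).le, Pi.mul_apply]
  have e1 : (1 + |y|) ^ (1 / 4 : ℝ) = (1 + |y|) ^ (-(3 / 4) : ℝ) * (1 + |y|) := by
    rw [← Real.rpow_add_one (h0 y).ne']; norm_num
  rw [e1]
  have e2 : 1 + |y| ≤ 2 * bracket y := by linarith [one_le_bracket y, abs_le_bracket y]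
  have e3 : 0 ≤ (1 + |y|) ^ (-(3 / 4) : ℝ) := Real.rpow_nonneg (h0 y).le _
  calc (1 + |y|) ^ (-(3 / 4) : ℝ) * (1 + |y|) * ‖ft (zmul^[k] p) y‖
      ≤ (1 + |y|) ^ (-(3 / 4) : ℝ) * (2 * bracket y) * ‖ft (zmul^[k] p) y‖ := by gcongr
    _ = _ := by ring

theorem Good.integrable_ft (h : Good p N) {k : ℕ} (hk : k ≤ 1) : Integrable (ft (zmul^[k] p)) := by
  refine (h.integrable_rpow_ft hk).mono (h.continuous_ft (by omega)).aestronglyMeasurable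
    (Eventually.of_forall fun y => ?_)
  rw [norm_mul, Complex.norm_real, Real.norm_of_nonneg (by positivity)]
  exact le_mul_of_one_le_left (norm_nonneg _) (Real.one_le_rpow (by linarith [abs_nonneg y])
    (by norm_num))

theorem Good.inW_ft (h : Good p N) : InW (ft p) (ft (zmul p)) :=
  ⟨IsPrim.of_hasDerivAt (fun x => hasDerivAt_ft (h.integrable 0 (by norm_num))
    (h.integrable 1 (by norm_num)) x) (h.continuous_ft (k := 1) (by norm_num)),
    h.integrable_ft (k := 0) (by norm_num), h.integrable_ft (k := 1) (by norm_num)⟩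

theorem Good.ft_ft (h : Good p N) (z : ℝ) : ft (ft p) z = p (-z) := by
  have h1 := Continuous.fourierInv_fourier_eq h.continuous (h.integrable 0 (by norm_num)) (by
    rw [fourier_eq_ft]; exact h.inW_ft.integrable)
  rw [← fourier_eq_ft, ← congrFun h1 (-z), Real.fourierInv_eq_fourier_neg,
    neg_neg, fourier_eq_ft p]

/-! ### The solution of the Riemann–Hilbert problem -/

theorem pair_vec_eq_corr (h : Good p N) (t : ℝ) (X : E) : pair (vec p t) X = corr (ft p) X t := by
  rw [pair_apply, corr]
  refine integral_congr_ae ?_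
  filter_upwards [coeFn_vec (h.integrable 0 (by norm_num)) (h.memLp 0 (by norm_num)) t] with y hy
  simp only [Function.iterate_zero, id] at hy
  rw [hy]

/-- The off-diagonal kernel, as an element of `L²`. -/
def solB (ρ p : ℝ → ℂ) (s : ℝ) : E := toE (ft p) + Gam p (solA ρ p s)

/-- The off-diagonal kernel. -/
def kerB (ρ p : ℝ → ℂ) (s t : ℝ) : ℂ := ft p t + pair (vec p t) (solA ρ p s)

/-- The diagonal kernel. -/
def kerA (ρ p : ℝ → ℂ) (s y : ℝ) : ℂ := -pair (vec ρ y) (cut s (solB ρ p s))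

theorem solB_ae (hp : Good p N) (s : ℝ) : (solB ρ p s : ℝ → ℂ) =ᵐ[volume] kerB ρ p s := by
  filter_upwards [Lp.coeFn_add (toE (ft p)) (Gam p (solA ρ p s)),
    coeFn_toE (hp.memLp_ft (k := 0) (by norm_num)),
    coeFn_Gam (r := p) (hp.memLp 0 (by norm_num)) hp.memLp_top (solA ρ p s)] with t h1 h2 h3
  simp only [Function.iterate_zero, id] at h2
  rw [solB, h1, Pi.add_apply, h2, h3, kerB]

/-- The Marchenko equation is the elimination of `B` from the pair `A = -1_{(0,∞)} Γ_ρ 1_{(s,∞)} B`,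
`B = F_p + Γ_p A`. The solution is supported in the half-line because the source and the range of
the operator are. -/
theorem solA_eq {s : ℝ} (hu : IsUnit (1 + opK ρ p s)) :
    solA ρ p s = -(cut 0 (Gam ρ (cut s (solB ρ p s)))) := by
  have h1 : (1 + opK ρ p s) (solA ρ p s) = -src ρ p s := by
    have := congrArg (fun T : E →L[ℂ] E => T (src ρ p s)) (mul_res hu)
    simp only [mul_apply_eq_comp] at this
    rw [solA, map_neg, this]; rfl
  have h2 : solA ρ p s = -src ρ p s - opK ρ p s (solA ρ p s) := by
    rw [← h1]; simp
  have h3 : cut 0 (solA ρ p s) = solA ρ p s := by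
    rw [h2]; simp only [map_sub, map_neg, src, opK, ContinuousLinearMap.comp_apply, cut_cut]
  nth_rw 1 [h2]
  simp only [opK, ContinuousLinearMap.comp_apply, h3, src, solB, map_add]
  abel

theorem solA_ae (hρ : Good ρ M) {s : ℝ} (hu : IsUnit (1 + opK ρ p s)) :
    (solA ρ p s : ℝ → ℂ) =ᵐ[volume] (Set.Ioi 0).indicator (kerA ρ p s) := by
  have h0 := solA_eq hu
  rw [← map_neg, ← map_neg] at h0
  rw [h0]
  filter_upwards [coeFn_cut 0 (Gam ρ (-cut s (solB ρ p s))), coeFn_Gam (r := ρ)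
    (hρ.memLp 0 (by norm_num)) hρ.memLp_top (-cut s (solB ρ p s))] with y h1 h2
  rw [h1]
  by_cases hy : y ∈ Set.Ioi (0 : ℝ)
  · rw [Set.indicator_of_mem hy, Set.indicator_of_mem hy, h2, map_neg, kerA]
  · rw [Set.indicator_of_notMem hy, Set.indicator_of_notMem hy]

theorem one_add_le {s y w : ℝ} (h : y ≤ w - s) : 1 + y ≤ (1 + |s|) * (1 + |w|) := by
  nlinarith [le_abs_self w, neg_abs_le s, mul_nonneg (abs_nonneg s) (abs_nonneg w)]

/-- The value at `y` sees only the tail beyond `y + s` of the transform of `ρ`, which decays like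
`1/⟨y + s⟩`; this is comparable with `1/(1 + y)` for fixed `s`. -/
theorem norm_kerA_le (hρ : Good ρ M) {s y : ℝ} (hy : 0 < y) : ‖kerA ρ p s y‖ ≤
    2 * (1 + |s|) * ((2 + bracket s) * M) * ‖solB ρ p s‖ * (1 + y)⁻¹ := by
  have hM := hρ.nonneg
  have h1 : ‖cut s (vec ρ y)‖ ≤ 2 * (1 + |s|) * ((2 + bracket s) * M) * (1 + y)⁻¹ := by
    have e1 := hρ.norm_cut_vec (k := 0) (by norm_num) s y
    have e2 := hρ.bracket_mul_norm_cut_le (k := 0) (by norm_num) (s₁ := s) (s := y + s) (by linarith)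
    simp only [Function.iterate_zero, id] at e1 e2
    rw [e1, ← div_eq_mul_inv, le_div_iff₀ (by linarith)]
    have e3 := one_add_le (s := s) (y := y) (w := y + s) (by linarith)
    have e4 : 1 + |y + s| ≤ 2 * bracket (y + s) := by
      linarith [one_le_bracket (y + s), abs_le_bracket (y + s)]
    calc ‖cut (y + s) (toE (ft ρ))‖ * (1 + y)
        ≤ ‖cut (y + s) (toE (ft ρ))‖ * ((1 + |s|) * (2 * bracket (y + s))) := by
          gcongr; exact e3.trans (by gcongr)
      _ = 2 * (1 + |s|) * (bracket (y + s) * ‖cut (y + s) (toE (ft ρ))‖) := by ring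
      _ ≤ 2 * (1 + |s|) * ((2 + bracket s) * M) := by gcongr
  rw [kerA, norm_neg, ← pair_cut]
  refine (norm_pair_le _ _).trans ?_
  rw [mul_right_comm]
  gcongr

/-- The Cauchy transforms have pointwise boundary values if the kernels are in `L¹`, whereas the
Marchenko equation is solved in `L²`. The bound `1/(1 + y)` on `kerA` just fails to be integrable,
so a quarter power is borrowed from `F_p`: for `t > s` one has `(1+y)^{1/4} ≤ (1+|s|)^{1/4}
(1+|t+y|)^{1/4}`. Two integrable factors remain, and Fubini applies. -/
theorem integrable_cut_solB (hρ : Good ρ M) (hp : Good p N) {s : ℝ}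
    (hu : IsUnit (1 + opK ρ p s)) : Integrable (cut s (solB ρ p s)) := by
  set C := 2 * (1 + |s|) * ((2 + bracket s) * M) * ‖solB ρ p s‖ with hC
  have hC0 : 0 ≤ C := by have := hρ.nonneg; have := bracket_pos s; positivity
  set G₁ : ℝ → ℂ := fun y => (((1 + |y|) ^ (1 / 4 : ℝ) : ℝ) : ℂ) * ft p y with hG₁
  set G₂ : ℝ → ℂ := fun y => (((1 + ‖y‖) ^ (-(5 / 4) : ℝ) : ℝ) : ℂ) with hG₂
  have i₁ : Integrable G₁ := hp.integrable_rpow_ft (k := 0) (by norm_num)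
  have i₂ : Integrable G₂ := (integrable_one_add_norm (by norm_num)).ofReal
  have hprod := (integrable_corr_prod i₁ i₂).norm
  have i₃ : Integrable fun t => ∫ y, ‖G₁ (t + y) * G₂ y‖ := hprod.integral_prod_left
  set K := C * (1 + |s|) ^ (1 / 4 : ℝ)
  have hbound : ∀ t y, s < t → 0 < y → ‖ft p (t + y) * kerA ρ p s y‖ ≤ K * ‖G₁ (t + y) * G₂ y‖ := by
    intro t y ht hy
    have h1 : ‖kerA ρ p s y‖ ≤ C * (1 + y)⁻¹ := norm_kerA_le hρ hy
    have hw : 0 < 1 + |t + y| := by positivity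
    have hy1 : 0 < 1 + y := by linarith
    have h2 : (1 + y) ^ (1 / 4 : ℝ) ≤ (1 + |s|) ^ (1 / 4 : ℝ) * (1 + |t + y|) ^ (1 / 4 : ℝ) := by
      rw [← Real.mul_rpow (by positivity) hw.le]
      exact Real.rpow_le_rpow hy1.le (one_add_le (by linarith)) (by norm_num)
    have h3 : (1 + y)⁻¹ = (1 + y) ^ (1 / 4 : ℝ) * (1 + y) ^ (-(5 / 4) : ℝ) := by
      rw [← Real.rpow_add hy1, ← Real.rpow_neg_one]; norm_num
    have h4 : 0 ≤ (1 + y) ^ (-(5 / 4) : ℝ) := Real.rpow_nonneg hy1.le _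
    rw [hG₁, hG₂]
    simp only [norm_mul, Complex.norm_real, Real.norm_of_nonneg hy.le]
    rw [Real.norm_of_nonneg h4, Real.norm_of_nonneg (Real.rpow_nonneg hw.le _)]
    calc ‖ft p (t + y)‖ * ‖kerA ρ p s y‖
        ≤ ‖ft p (t + y)‖ * (C * ((1 + |s|) ^ (1 / 4 : ℝ) * (1 + |t + y|) ^ (1 / 4 : ℝ) *
          (1 + y) ^ (-(5 / 4) : ℝ))) := by
          gcongr
          refine h1.trans ?_
          rw [h3]
          gcongr
      _ = _ := by ring
  have hcorr : IntegrableOn (corr (ft p) (solA ρ p s)) (Set.Ioi s) := by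
    have hFW := hp.inW_ft
    refine ((i₃.const_mul K).integrableOn (s := Set.Ioi s)).mono' ?_ ?_
    · have hc : Continuous (corr (ft p) (solA ρ p s)) := by
        have := continuous_pair_vec (r := p) (hp.memLp 0 (by norm_num)) (solA ρ p s)
        simpa only [pair_vec_eq_corr hp] using this
      exact hc.aestronglyMeasurable
    · filter_upwards [ae_restrict_mem measurableSet_Ioi, ae_restrict_of_ae hprod.prod_right_ae]
        with t ht hit
      rw [corr, ← integral_const_mul]
      refine norm_integral_le_of_norm_le (hit.const_mul K) ?_
      filter_upwards [solA_ae hρ hu] with y hy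
      rw [hy]
      by_cases hy0 : y ∈ Set.Ioi (0 : ℝ)
      · rw [Set.indicator_of_mem hy0]; exact hbound t y ht hy0
      · rw [Set.indicator_of_notMem hy0, mul_zero, norm_zero]; positivity
  have h5 : IntegrableOn (kerB ρ p s) (Set.Ioi s) := by
    refine (hp.inW_ft.integrable.integrableOn.add hcorr).congr (Eventually.of_forall fun t => ?_)
    rw [Pi.add_apply, kerB, pair_vec_eq_corr hp]
  rw [← integrable_indicator_iff measurableSet_Ioi] at h5
  refine h5.congr ?_
  filter_upwards [coeFn_cut s (solB ρ p s), solB_ae (ρ := ρ) hp s] with t h1 h2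
  rw [h1]
  by_cases ht : t ∈ Set.Ioi s
  · rw [Set.indicator_of_mem ht, Set.indicator_of_mem ht, h2]
  · rw [Set.indicator_of_notMem ht, Set.indicator_of_notMem ht]

theorem ft_comp_add (f : ℝ → ℂ) (s z : ℝ) : ft (fun t => f (s + t)) (-z) = chi (-(s * z)) * ft f (-z) := by
  have h1 := integral_add_left_eq_self (μ := volume) (fun t => chi (-(-z * t)) * f t) s
  rw [ft, ft, ← h1, ← integral_const_mul]
  congr 1; ext t
  rw [← mul_assoc, ← chi_add]; congr 2; ring

/-- Here `f(t) = B(s + t)` and `g(y) = A(-y)`, where `A` and `B` are continued from their half-lines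
to the whole line by the coupled equations. A correlation becomes a product under the Fourier
transform, and the half-line factors inside it are boundary values of Cauchy transforms. The two
coupled equations thus become the two scalar jump relations for the row `(1 - cau g, cau f)`. -/
theorem exists_row (hρ : Good ρ M) (hp : Good p N) {s : ℝ} (hu : IsUnit (1 + opK ρ p s)) :
    ∃ f f' g g' : ℝ → ℂ, InW f f' ∧ InW g g' ∧ f 0 = solU ρ p s ∧ ∀ z : ℝ,
      ft f (-z) = p z * chi (-(s * z)) * (1 - cauM g z) ∧
      -ft g (-z) = ρ (-z) * chi (s * z) * cauchyUp f z := by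
  obtain ⟨β, hβ⟩ : ∃ β : ℝ → ℂ, β = (cut s (solB ρ p s) : E) := ⟨_, rfl⟩
  have hβi : Integrable β := hβ ▸ integrable_cut_solB hρ hp hu
  have hA : InW (kerA ρ p s) (fun y => -corr (ft (zmul ρ)) β y) := by
    have := (hρ.inW_ft.corr hβi).neg
    have e : kerA ρ p s = fun y => -corr (ft ρ) β y := by
      ext y; rw [kerA, pair_vec_eq_corr hρ, hβ]
    rwa [e]
  obtain ⟨α, hα⟩ : ∃ α : ℝ → ℂ, α = (solA ρ p s : E) := ⟨_, rfl⟩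
  have hαe : α =ᵐ[volume] (Set.Ioi 0).indicator (kerA ρ p s) := hα ▸ solA_ae hρ hu
  have hαi : Integrable α := (hA.integrable.indicator measurableSet_Ioi).congr hαe.symm
  have eB : kerB ρ p s = fun t => ft p t + corr (ft p) α t := by
    ext t; rw [kerB, pair_vec_eq_corr hp, hα]
  have hB : InW (kerB ρ p s) (fun t => ft (zmul p) t + corr (ft (zmul p)) α t) := by
    rw [eB]; exact hp.inW_ft.add (hp.inW_ft.corr hαi)
  have hβe : β =ᵐ[volume] (Set.Ioi s).indicator (kerB ρ p s) := by
    filter_upwards [coeFn_cut s (solB ρ p s), solB_ae (ρ := ρ) hp s] with t h1 h2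
    rw [hβ, h1]
    by_cases ht : t ∈ Set.Ioi s
    · rw [Set.indicator_of_mem ht, Set.indicator_of_mem ht, h2]
    · rw [Set.indicator_of_notMem ht, Set.indicator_of_notMem ht]
  refine ⟨_, _, _, _, hB.comp_add s, hA.comp_neg, ?_, fun z => ⟨?_, ?_⟩⟩
  · simp only [add_zero]
    rw [kerB, solU, wv, pair_cut]
    have : cut 0 (solA ρ p s) = solA ρ p s := by
      rw [solA_eq hu, map_neg, cut_cut]
    rw [this]; rfl
  · have e1 : ft α z = cauchyUp (kerA ρ p s) (-z) := by
      rw [ft, cauchyUp, ← integral_indicator measurableSet_Ioi]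
      refine integral_congr_ae ?_
      filter_upwards [hαe] with y hy
      rw [hy]
      by_cases hy0 : y ∈ Set.Ioi (0 : ℝ)
      · rw [Set.indicator_of_mem hy0, Set.indicator_of_mem hy0, ← Complex.ofReal_neg, ker_ofReal,
          mul_comm]
        congr 2; ring
      · rw [Set.indicator_of_notMem hy0, Set.indicator_of_notMem hy0, mul_zero]
    have e2 : ft (kerB ρ p s) (-z) = p z * (1 + ft α z) := by
      have i1 := integrable_chi_mul hp.inW_ft.integrable
        (c := fun t => -(-z * t)) (by fun_prop)
      have i2 := integrable_chi_mul (hp.inW_ft.corr hαi).integrable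
        (c := fun t => -(-z * t)) (by fun_prop)
      have e3 : ft (kerB ρ p s) (-z) = ft (ft p) (-z) + ft (corr (ft p) α) (-z) := by
        rw [eB, ft, ft, ft, ← integral_add i1 i2]
        congr 1; ext t; ring
      rw [e3, ft_corr hp.inW_ft.integrable hαi, hp.ft_ft, neg_neg]; ring
    rw [ft_comp_add, e2, e1, cauM]
    simp only [neg_neg]
    ring
  · have e1 : ft (fun y => kerA ρ p s (-y)) (-z) = -(ft β (-z) * ρ (-z)) := by
      rw [← ft_neg_eq, neg_neg]
      have e : kerA ρ p s = fun y => -corr (ft ρ) β y := by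
        ext y; rw [kerA, pair_vec_eq_corr hρ, hβ]
      have e2 : ft (kerA ρ p s) z = -ft (corr (ft ρ) β) z := by
        rw [e, ft, ft, ← integral_neg]; congr 1; ext y; ring
      rw [e2, ft_corr hρ.inW_ft.integrable hβi, hρ.ft_ft]
    have e2 : ft β (-z) = chi (s * z) * cauchyUp (fun t => kerB ρ p s (s + t)) z := by
      have e3 : ft β (-z) = ∫ t, (Set.Ioi s).indicator (fun t => chi (t * z) * kerB ρ p s t) t := by
        rw [ft]
        refine integral_congr_ae ?_
        filter_upwards [hβe] with t ht
        rw [ht]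
        by_cases h0 : t ∈ Set.Ioi s
        · rw [Set.indicator_of_mem h0, Set.indicator_of_mem h0]; congr 2; ring
        · rw [Set.indicator_of_notMem h0, Set.indicator_of_notMem h0, mul_zero]
      rw [e3, cauchyUp, ← integral_const_mul, ← integral_indicator measurableSet_Ioi,
        ← integral_add_left_eq_self _ s]
      congr 1; ext t
      by_cases h0 : t ∈ Set.Ioi (0 : ℝ)
      · rw [Set.indicator_of_mem h0, Set.indicator_of_mem (by simpa using h0), ker_ofReal, add_mul,
          chi_add]; ring
      · rw [Set.indicator_of_notMem h0, Set.indicator_of_notMem (by simpa using h0)]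
    rw [e1, neg_neg, e2]; ring

end

section

/-! ### Functions with equal boundary values -/

theorem dense_offReal : Dense offReal := by
  rw [Metric.dense_iff]
  intro z r hr
  by_cases hz : z.im = 0
  · refine ⟨z + (r / 2 : ℝ) * Complex.I, ?_, ?_⟩
    · rw [Metric.mem_ball, dist_eq_norm, add_sub_cancel_left, norm_mul, Complex.norm_real,
        Complex.norm_I, mul_one, Real.norm_of_nonneg (by positivity)]
      linarith
    · change (z + (r / 2 : ℝ) * Complex.I).im ≠ 0
      simp [hz, hr.ne']
  · exact ⟨z, Metric.mem_ball_self hr, hz⟩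

theorem nhdsWithin_offReal (x : ℂ) :
    𝓝[offReal] x = 𝓝[{z : ℂ | 0 < z.im}] x ⊔ 𝓝[{z : ℂ | z.im < 0}] x := by
  rw [← nhdsWithin_union]
  congr 1
  ext z
  simp only [offReal, Set.mem_ofPred_eq, Set.mem_union, ne_iff_lt_or_gt]
  exact or_comm

/-- A continuous function that is analytic off the real line is entire. -/
theorem differentiable_of_differentiableOn_offReal {F : ℂ → ℂ} (hc : Continuous F)
    (hd : DifferentiableOn ℂ F offReal) : Differentiable ℂ F := by
  have hcons : Complex.IsConservativeOn F Set.univ := by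
    intro z w _
    rw [← add_eq_zero_iff_eq_neg, Complex.wedgeIntegral_add_wedgeIntegral_eq]
    -- A rectangle is split along the real axis. The interiors of the two pieces avoid the axis, so
    -- Cauchy's theorem applies to each, and the integrals over the common side cancel.
    have key : ∀ z w : ℂ, z.im = 0 ∨ w.im = 0 → DifferentiableOn ℂ F
        (Set.Ioo (min z.re w.re) (max z.re w.re) ×ℂ Set.Ioo (min z.im w.im) (max z.im w.im)) := by
      intro z w h
      refine hd.mono fun v hv => ?_
      have h2 := hv.2
      change v.im ≠ 0
      have h3 : min z.im w.im < v.im := h2.1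
      have h4 : v.im < max z.im w.im := h2.2
      rintro h5
      rw [h5] at h3 h4
      rcases h with h | h <;> rw [h] at h3 h4 <;> grind
    have h1 := Complex.integral_boundary_rect_eq_zero_of_continuousOn_of_differentiableOn F z ⟨w.re, 0⟩
      hc.continuousOn (key _ _ (Or.inr rfl))
    have h2 := Complex.integral_boundary_rect_eq_zero_of_continuousOn_of_differentiableOn F ⟨z.re, 0⟩ w
      hc.continuousOn (key _ _ (Or.inl rfl))
    have hi : ∀ c a b : ℝ, IntervalIntegrable (fun y : ℝ => F (c + y * Complex.I)) volume a b :=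
      fun c a b => (by fun_prop : Continuous fun y : ℝ => F (c + y * Complex.I)).intervalIntegrable a b
    rw [← intervalIntegral.integral_add_adjacent_intervals (hi w.re z.im 0) (hi w.re 0 w.im),
      ← intervalIntegral.integral_add_adjacent_intervals (hi z.re z.im 0) (hi z.re 0 w.im)]
    simp only [smul_eq_mul] at h1 h2 ⊢
    linear_combination h1 + h2
  exact differentiableOn_univ.1
    (Complex.IsExactOn.differentiableOn isOpen_univ (hcons.isExactOn_univ hc))

/-- Equal boundary values give a continuous extension across the real line, which is entire; a limit
at infinity makes it constant. -/
theorem eq_of_boundary_eq {f : ℂ → ℂ} {c : ℂ} (hd : DifferentiableOn ℂ f offReal)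
    (hb : ∀ x : ℝ, ∃ y, Tendsto f (𝓝[{z : ℂ | 0 < z.im}] (x : ℂ)) (𝓝 y) ∧
      Tendsto f (𝓝[{z : ℂ | z.im < 0}] (x : ℂ)) (𝓝 y))
    (hl : Tendsto f atInfinity (𝓝 c)) {z : ℂ} (hz : z ∈ offReal) : f z = c := by
  set F := extendFrom offReal f with hF
  have hFf : ∀ z ∈ offReal, F z = f z := extendFrom_extends hd.continuousOn
  have hc : Continuous F := by
    refine continuous_extendFrom dense_offReal fun x => ?_
    by_cases hx : x.im = 0
    · obtain ⟨y, h1, h2⟩ := hb x.re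
      have : (x.re : ℂ) = x := Complex.ext (by simp) (by simp [hx])
      rw [this] at h1 h2
      exact ⟨y, by rw [nhdsWithin_offReal]; exact h1.sup h2⟩
    · exact ⟨f x, hd.continuousOn x hx⟩
  have hdF : Differentiable ℂ F :=
    differentiable_of_differentiableOn_offReal hc (hd.congr hFf)
  have hlim : Tendsto F (cocompact ℂ) (𝓝 c) := by
    rw [← Metric.cobounded_eq_cocompact, Metric.tendsto_nhds]
    intro ε hε
    have h1 := (Metric.tendsto_nhds.1 hl) (ε / 2) (half_pos hε)
    rw [atInfinity, eventually_inf_principal] at h1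
    obtain ⟨R, -, hR⟩ := (Filter.hasBasis_cobounded_norm (E := ℂ)).eventually_iff.1 h1
    have hopen : IsOpen {z : ℂ | R < ‖z‖} := isOpen_lt continuous_const continuous_norm
    -- The limit at infinity is known only off the real line. Density extends it as a closed
    -- inequality, which is why half of `ε` is used.
    have h2 : {z : ℂ | R < ‖z‖} ⊆ {z | dist (F z) c ≤ ε / 2} := by
      refine (dense_offReal.open_subset_closure_inter hopen).trans ?_
      refine closure_minimal ?_ (isClosed_le (hc.dist continuous_const) continuous_const)
      rintro w ⟨hw, hw2⟩
      have hw1 : R < ‖w‖ := hw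
      have := hR (show R ≤ ‖w‖ from hw1.le) hw2
      simp only [Set.mem_ofPred_eq]
      rw [hFf w hw2]; exact this.le
    filter_upwards [tendsto_norm_cobounded_atTop.eventually_gt_atTop R] with w hw
    exact (h2 hw).trans_lt (half_lt_self hε)
  rw [← hFf z hz]
  exact hdF.apply_eq_of_tendsto_cocompact z hlim

instance : NeBot atInfinity := by
  have h1 : Tendsto (fun n : ℕ => ((n + 1 : ℝ) : ℂ) * Complex.I) atTop atInfinity := by
    refine tendsto_inf.2 ⟨?_, tendsto_principal.2 (Eventually.of_forall fun n => ?_)⟩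
    · rw [← tendsto_norm_atTop_iff_cobounded]
      have : Tendsto (fun n : ℕ => (n + 1 : ℝ)) atTop atTop :=
        tendsto_atTop_add_const_right _ _ tendsto_natCast_atTop_atTop
      refine this.congr fun n => ?_
      rw [norm_mul, Complex.norm_real, Complex.norm_I, mul_one, Real.norm_of_nonneg (by positivity)]
    · change (((n + 1 : ℝ) : ℂ) * Complex.I).im ≠ 0
      have : (n + 1 : ℝ) ≠ 0 := by positivity
      simpa using this
  exact h1.neBot

theorem tendsto_inv_atInfinity : Tendsto (fun z : ℂ => z⁻¹) atInfinity (𝓝 0) :=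
  tendsto_inv₀_cobounded.mono_left inf_le_left

/-! ### Uniqueness of the solution of the Riemann–Hilbert problem -/

section RH

variable {σ : ℝ} {r₁ r₂ : ℝ → ℂ} {x : ℝ} {M M' : ℂ → Matrix (Fin 2) (Fin 2) ℂ}

theorem det_jump (σ : ℝ) (r₁ r₂ : ℝ → ℂ) (x z : ℝ) : (jump σ r₁ r₂ x z).det = 1 := by
  rw [jump, Matrix.det_fin_two_of]
  have : Complex.exp (2 * Complex.I * x * z) * Complex.exp (-(2 * Complex.I * x * z)) = 1 := by
    rw [← Complex.exp_add, add_neg_cancel, Complex.exp_zero]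
  linear_combination (-σ * r₁ z * r₂ z) * this

theorem IsRHSolution.tendsto (h : IsRHSolution σ r₁ r₂ x M) : Tendsto M atInfinity (𝓝 1) := by
  refine tendsto_pi_nhds.2 fun i => tendsto_pi_nhds.2 fun j => ?_
  have h1 := (h.normalized i j).trans_tendsto tendsto_inv_atInfinity
  simpa using h1.add_const ((1 : Matrix (Fin 2) (Fin 2) ℂ) i j)

/-- The adjugate stands in for the inverse, so invertibility of `M` need not be known beforehand.
The adjugate reverses products and the jump has determinant one, so the jumps cancel and the product
has no discontinuity. -/
theorem IsRHSolution.mul_adjugate (h : IsRHSolution σ r₁ r₂ x M) (h' : IsRHSolution σ r₁ r₂ x M')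
    {z : ℂ} (hz : z ∈ offReal) : M' z * (M z).adjugate = 1 := by
  obtain ⟨Mp, Mm, hM⟩ := h.boundary
  obtain ⟨Mp', Mm', hM'⟩ := h'.boundary
  have hlim : ∀ {l : Filter ℂ} {A B : Matrix (Fin 2) (Fin 2) ℂ}, Tendsto M' l (𝓝 A) →
      Tendsto M l (𝓝 B) → Tendsto (fun z => M' z * (M z).adjugate) l (𝓝 (A * B.adjugate)) := by
    intro l A B hA hB
    have h1 : Tendsto (fun z => (M z).adjugate) l (𝓝 B.adjugate) :=
      ((continuous_id.matrix_adjugate).tendsto B).comp hB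
    exact hA.mul h1
  ext i j
  have hA : ∀ z, (M' z * (M z).adjugate) i j = M' z i 0 * (M z).adjugate 0 j +
        M' z i 1 * (M z).adjugate 1 j := fun z => by rw [Matrix.mul_apply, Fin.sum_univ_two]
  have hD : DifferentiableOn ℂ (fun z => (M' z * (M z).adjugate) i j) offReal := by
    have d := h.analytic
    have d' := h'.analytic
    have e : ∀ k, DifferentiableOn ℂ (fun z => (M z).adjugate k j) offReal := fun k => by
      simp only [Matrix.adjugate_fin_two]
      fin_cases k <;> fin_cases j
      exacts [d 1 1, (d 0 1).neg, (d 1 0).neg, d 0 0]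
    exact (((d' i 0).mul (e 0)).add ((d' i 1).mul (e 1))).congr fun z _ => hA z
  have hB : ∀ s, Mp' s * (Mp s).adjugate = Mm' s * (Mm s).adjugate := fun s => by
    rw [(hM s).2.2, (hM' s).2.2, Matrix.adjugate_mul_distrib, Matrix.mul_assoc,
      ← Matrix.mul_assoc (jump σ r₁ r₂ x s), Matrix.mul_adjugate, det_jump, one_smul,
      Matrix.one_mul]
  have hT : ∀ {l : Filter ℂ} {A : Matrix (Fin 2) (Fin 2) ℂ},
      Tendsto (fun z => M' z * (M z).adjugate) l (𝓝 A) →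
      Tendsto (fun z => (M' z * (M z).adjugate) i j) l (𝓝 (A i j)) := fun hA =>
    tendsto_pi_nhds.1 (tendsto_pi_nhds.1 hA i) j
  have hI := hT (hlim h'.tendsto h.tendsto)
  rw [Matrix.adjugate_one, Matrix.mul_one] at hI
  exact eq_of_boundary_eq hD (fun s => ⟨(Mp' s * (Mp s).adjugate) i j, hT (hlim (hM' s).1 (hM s).1),
    by rw [hB]; exact hT (hlim (hM' s).2.1 (hM s).2.1)⟩) hI hz

/-- The preceding identity with both solutions equal to `M` shows `det M = 1`, so the adjugate is
the inverse. -/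
theorem IsRHSolution.unique (h : IsRHSolution σ r₁ r₂ x M) (h' : IsRHSolution σ r₁ r₂ x M')
    {z : ℂ} (hz : z ∈ offReal) : M' z = M z := by
  have h1 := h.mul_adjugate h hz
  rw [Matrix.mul_adjugate] at h1
  have h2 : (M z).det = 1 := by simpa using congrFun (congrFun h1 0) 0
  calc M' z = M' z * ((M z).adjugate * M z) := by
        rw [Matrix.adjugate_mul, h2, one_smul, Matrix.mul_one]
    _ = M z := by rw [← Matrix.mul_assoc, h.mul_adjugate h' hz, Matrix.one_mul]

theorem IsRHSolution.eventuallyEq (h : IsRHSolution σ r₁ r₂ x M) (h' : IsRHSolution σ r₁ r₂ x M') :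
    M' =ᶠ[atInfinity] M :=
  (eventually_principal.2 fun _ hz => h.unique h' hz : ∀ᶠ z in 𝓟 offReal, M' z = M z).filter_mono
    inf_le_right

/-- Reduces the analysis to the sign `1`. -/
theorem isRHSolution_absorb : IsRHSolution σ r₁ r₂ x M ↔
    IsRHSolution 1 r₁ (fun z => σ * r₂ z) x M := by
  have e : ∀ z, jump σ r₁ r₂ x z = jump 1 r₁ (fun z => σ * r₂ z) x z := fun z => by
    simp only [jump]; push_cast; congr 1; ring_nf
  constructor <;> (rintro ⟨h1, h2, Mp, Mm, h3⟩; refine ⟨h1, h2, Mp, Mm, fun s => ?_⟩)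
  · rw [← e]; exact h3 s
  · rw [e]; exact h3 s

theorem IsRHSolution.congr {s₁ s₂ : ℝ → ℂ} (h : IsRHSolution σ r₁ r₂ x M) (h1 : ∀ z, r₁ z = s₁ z)
    (h2 : ∀ z, r₂ z = s₂ z) : IsRHSolution σ s₁ s₂ x M := by
  rwa [← funext h1, ← funext h2]

theorem tendsto_neg_nhdsWithin' (x : ℝ) :
    Tendsto (fun z : ℂ => -z) (𝓝[{z : ℂ | 0 < z.im}] (x : ℂ)) (𝓝[{z : ℂ | z.im < 0}] ((-x : ℝ) : ℂ)) := by
  refine tendsto_nhdsWithin_iff.2 ⟨?_, ?_⟩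
  · rw [Complex.ofReal_neg]
    exact (continuous_neg.tendsto (x : ℂ)).mono_left nhdsWithin_le_nhds
  · filter_upwards [self_mem_nhdsWithin] with z hz
    simpa using hz

theorem tendsto_neg_atInfinity : Tendsto (fun z : ℂ => -z) atInfinity atInfinity := by
  refine Tendsto.inf ?_ (tendsto_principal_principal.2 fun z hz => ?_)
  · rw [← tendsto_norm_atTop_iff_cobounded]
    simpa using tendsto_norm_cobounded_atTop (E := ℂ)
  · have hz : z.im ≠ 0 := hz
    change (-z).im ≠ 0
    simpa using hz

theorem mapsTo_neg_offReal : Set.MapsTo (fun z : ℂ => -z) offReal offReal := fun z hz => by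
  have hz : z.im ≠ 0 := hz
  change (-z).im ≠ 0
  simpa using hz

theorem IsRHSolution.normalized_neg (h : IsRHSolution σ r₁ r₂ x M) (i j : Fin 2) :
    (fun z => M (-z) i j - (1 : Matrix (Fin 2) (Fin 2) ℂ) i j) =O[atInfinity] (fun z : ℂ => z⁻¹) := by
  refine ((h.normalized i j).comp_tendsto tendsto_neg_atInfinity).trans ?_
  refine Asymptotics.isBigO_of_le _ fun z => ?_
  simp

theorem IsRHSolution.analytic_neg (h : IsRHSolution σ r₁ r₂ x M) (i j : Fin 2) :
    DifferentiableOn ℂ (fun z => M (-z) i j) offReal :=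
  (h.analytic i j).comp differentiableOn_id.neg mapsTo_neg_offReal

theorem tendsto_entry {l : Filter ℂ} {A : Matrix (Fin 2) (Fin 2) ℂ} (h : Tendsto M l (𝓝 A))
    (i j : Fin 2) : Tendsto (fun z => M z i j) l (𝓝 (A i j)) :=
  tendsto_pi_nhds.1 (tendsto_pi_nhds.1 h i) j

theorem tendsto_of_entries {l : Filter ℂ} {A : Matrix (Fin 2) (Fin 2) ℂ}
    (h : ∀ i j, Tendsto (fun z => M z i j) l (𝓝 (A i j))) : Tendsto M l (𝓝 A) :=
  tendsto_pi_nhds.2 fun i => tendsto_pi_nhds.2 fun j => h i j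

/-- The inversion `z ↦ -z` of the problem, which exchanges the two reflection coefficients. -/
theorem IsRHSolution.reflect (h : IsRHSolution 1 r₁ r₂ x M) :
    IsRHSolution 1 (fun z => -r₂ (-z)) (fun z => -r₁ (-z)) x fun z =>
      !![M (-z) 1 1, M (-z) 1 0; M (-z) 0 1, M (-z) 0 0] := by
  obtain ⟨Mp, Mm, hM⟩ := h.boundary
  refine ⟨fun i j => ?_, fun i j => ?_, fun s => !![Mm (-s) 1 1, Mm (-s) 1 0; Mm (-s) 0 1, Mm (-s) 0 0],
    fun s => !![Mp (-s) 1 1, Mp (-s) 1 0; Mp (-s) 0 1, Mp (-s) 0 0], fun s => ⟨?_, ?_, ?_⟩⟩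
  · fin_cases i <;> fin_cases j
    exacts [h.analytic_neg 1 1, h.analytic_neg 1 0, h.analytic_neg 0 1, h.analytic_neg 0 0]
  · fin_cases i <;> fin_cases j
    · simpa using h.normalized_neg 1 1
    · simpa using h.normalized_neg 1 0
    · simpa using h.normalized_neg 0 1
    · simpa using h.normalized_neg 0 0
  · have h1 := fun i j => tendsto_entry ((hM (-s)).2.1.comp (tendsto_neg_nhdsWithin' s)) i j
    refine tendsto_of_entries fun i j => ?_
    fin_cases i <;> fin_cases j
    exacts [h1 1 1, h1 1 0, h1 0 1, h1 0 0]
  · have h1 := fun i j => tendsto_entry ((hM (-s)).1.comp (tendsto_neg_nhdsWithin s)) i j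
    refine tendsto_of_entries fun i j => ?_
    fin_cases i <;> fin_cases j
    exacts [h1 1 1, h1 1 0, h1 0 1, h1 0 0]
  · have e1 : 2 * Complex.I * x * ((-s : ℝ) : ℂ) = -(2 * Complex.I * x * s) := by push_cast; ring
    have e2 : Complex.exp (2 * Complex.I * x * s) * Complex.exp (-(2 * Complex.I * x * s)) = 1 := by
      rw [← Complex.exp_add, add_neg_cancel, Complex.exp_zero]
    have hMs : ∀ i j, Mp (-s) i j = Mm (-s) i 0 * jump 1 r₁ r₂ x (-s) 0 j +
        Mm (-s) i 1 * jump 1 r₁ r₂ x (-s) 1 j := fun i j => by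
      rw [(hM (-s)).2.2, Matrix.mul_apply, Fin.sum_univ_two]
    simp only [jump, e1, neg_neg] at hMs
    ext i j
    fin_cases i <;> fin_cases j <;>
      simp [Matrix.mul_apply, Fin.sum_univ_two, hMs, jump]
    · linear_combination (r₁ (-s) * r₂ (-s) * Mm (-s) 1 1) * e2
    · linear_combination (r₁ (-s) * r₂ (-s) * Mm (-s) 1 0) * e2
    · linear_combination (r₁ (-s) * r₂ (-s) * Mm (-s) 0 1) * e2
    · linear_combination (r₁ (-s) * r₂ (-s) * Mm (-s) 0 0) * e2

/-- The deformation of the problem by a scalar function with the jump `1 + r₁ r₂`. -/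
theorem IsRHSolution.deform (h : IsRHSolution 1 r₁ r₂ x M) {d : ℂ → ℂ} {dp dm : ℝ → ℂ}
    (ha : DifferentiableOn ℂ d offReal) (hn : ∀ z, d z ≠ 0)
    (hO : (fun z => d z - 1) =O[atInfinity] fun z : ℂ => z⁻¹)
    (hO' : (fun z => (d z)⁻¹ - 1) =O[atInfinity] fun z : ℂ => z⁻¹)
    (hp0 : ∀ s, dp s ≠ 0) (hm0 : ∀ s, dm s ≠ 0)
    (hp : ∀ s : ℝ, Tendsto d (𝓝[{z : ℂ | 0 < z.im}] (s : ℂ)) (𝓝 (dp s)))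
    (hm : ∀ s : ℝ, Tendsto d (𝓝[{z : ℂ | z.im < 0}] (s : ℂ)) (𝓝 (dm s)))
    (hj : ∀ s, dp s = dm s * (1 + r₁ s * r₂ s)) :
    IsRHSolution 1 (fun z => -(r₁ (-z) * (dp (-z) * dm (-z))⁻¹))
      (fun z => -(r₂ (-z) * (dp (-z) * dm (-z)))) (-x) fun z =>
      !![M (-z) 0 0 * (d (-z))⁻¹, M (-z) 0 1 * d (-z);
        M (-z) 1 0 * (d (-z))⁻¹, M (-z) 1 1 * d (-z)] := by
  obtain ⟨Mp, Mm, hM⟩ := h.boundary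
  have a1 : DifferentiableOn ℂ (fun z => d (-z)) offReal :=
    ha.comp differentiableOn_id.neg mapsTo_neg_offReal
  have a2 : DifferentiableOn ℂ (fun z => (d (-z))⁻¹) offReal := a1.fun_inv fun z _ => hn _
  have hneg : ∀ {f : ℂ → ℂ}, f =O[atInfinity] (fun z : ℂ => z⁻¹) →
      (fun z => f (-z)) =O[atInfinity] (fun z : ℂ => z⁻¹) := fun hf =>
    (hf.comp_tendsto tendsto_neg_atInfinity).trans
      (Asymptotics.isBigO_of_le _ fun z => by simp)
  have hprod : ∀ {f g : ℂ → ℂ} {c : ℂ}, (fun z => f z - c) =O[atInfinity] (fun z : ℂ => z⁻¹) →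
      (fun z => g z - 1) =O[atInfinity] (fun z : ℂ => z⁻¹) →
      (fun z => f z * g z - c) =O[atInfinity] (fun z : ℂ => z⁻¹) := by
    intro f g c hf hg
    have hg1 : g =O[atInfinity] fun _ => (1 : ℂ) := by
      have h1 := (hg.trans_tendsto tendsto_inv_atInfinity).add_const 1
      refine (h1.isBigO_one ℂ).congr_left fun z => by ring
    have h1 : (fun z => (f z - c) * g z) =O[atInfinity] (fun z : ℂ => z⁻¹) := by
      simpa using hf.mul hg1
    exact (h1.add (hg.const_mul_left c)).congr_left fun z => by ring
  -- Multiplication by `diag(d⁻¹, d)` moves the entry `1 + r₁ r₂` of the jump from the upper left to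
  -- the lower right corner. The map `z ↦ -z` exchanges the boundary values, hence inverts the jump,
  -- which restores the original form with the signs of the off-diagonal entries changed.
  refine ⟨fun i j => ?_, fun i j => ?_,
    fun s => !![Mm (-s) 0 0 * (dm (-s))⁻¹, Mm (-s) 0 1 * dm (-s);
      Mm (-s) 1 0 * (dm (-s))⁻¹, Mm (-s) 1 1 * dm (-s)],
    fun s => !![Mp (-s) 0 0 * (dp (-s))⁻¹, Mp (-s) 0 1 * dp (-s);
      Mp (-s) 1 0 * (dp (-s))⁻¹, Mp (-s) 1 1 * dp (-s)], fun s => ⟨?_, ?_, ?_⟩⟩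
  · fin_cases i <;> fin_cases j
    exacts [(h.analytic_neg 0 0).mul a2, (h.analytic_neg 0 1).mul a1, (h.analytic_neg 1 0).mul a2,
      (h.analytic_neg 1 1).mul a1]
  · fin_cases i <;> fin_cases j
    exacts [hprod (h.normalized_neg 0 0) (hneg hO'), hprod (h.normalized_neg 0 1) (hneg hO),
      hprod (h.normalized_neg 1 0) (hneg hO'), hprod (h.normalized_neg 1 1) (hneg hO)]
  · have h1 := fun i j => tendsto_entry ((hM (-s)).2.1.comp (tendsto_neg_nhdsWithin' s)) i j
    have h2 := (hm (-s)).comp (tendsto_neg_nhdsWithin' s)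
    have h3 := h2.inv₀ (hm0 (-s))
    refine tendsto_of_entries fun i j => ?_
    fin_cases i <;> fin_cases j
    exacts [(h1 0 0).mul h3, (h1 0 1).mul h2, (h1 1 0).mul h3, (h1 1 1).mul h2]
  · have h1 := fun i j => tendsto_entry ((hM (-s)).1.comp (tendsto_neg_nhdsWithin s)) i j
    have h2 := (hp (-s)).comp (tendsto_neg_nhdsWithin s)
    have h3 := h2.inv₀ (hp0 (-s))
    refine tendsto_of_entries fun i j => ?_
    fin_cases i <;> fin_cases j
    exacts [(h1 0 0).mul h3, (h1 0 1).mul h2, (h1 1 0).mul h3, (h1 1 1).mul h2]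
  · have e1 : 2 * Complex.I * x * ((-s : ℝ) : ℂ) = -(2 * Complex.I * x * s) := by push_cast; ring
    have e3 : 2 * Complex.I * ((-x : ℝ) : ℂ) * s = -(2 * Complex.I * x * s) := by push_cast; ring
    have e2 : Complex.exp (2 * Complex.I * x * s) * Complex.exp (-(2 * Complex.I * x * s)) = 1 := by
      rw [← Complex.exp_add, add_neg_cancel, Complex.exp_zero]
    have hd1 := hm0 (-s)
    have hd2 := hj (-s)
    have hd3 : 1 + r₁ (-s) * r₂ (-s) ≠ 0 := fun h0 => hp0 (-s) (by rw [hd2, h0, mul_zero])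
    have hMs : ∀ i j, Mp (-s) i j = Mm (-s) i 0 * jump 1 r₁ r₂ x (-s) 0 j +
        Mm (-s) i 1 * jump 1 r₁ r₂ x (-s) 1 j := fun i j => by
      rw [(hM (-s)).2.2, Matrix.mul_apply, Fin.sum_univ_two]
    simp only [jump, e1, neg_neg] at hMs
    ext i j
    fin_cases i <;> fin_cases j <;>
      simp [Matrix.mul_apply, Fin.sum_univ_two, hMs, jump, hd2] <;> field_simp
    · linear_combination (r₁ (-s) * r₂ (-s) * Mm (-s) 0 0) * e2
    · linear_combination (r₁ (-s) * r₂ (-s) * Mm (-s) 0 1) * e2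
    · linear_combination (r₁ (-s) * r₂ (-s) * Mm (-s) 1 0) * e2
    · linear_combination (r₁ (-s) * r₂ (-s) * Mm (-s) 1 1) * e2

end RH

end

section

variable {ρ p : ℝ → ℂ} {M N : ℝ}

/-! ### Existence of the solution of the Riemann–Hilbert problem -/

/-- The first row solves the scalar relations for `(ρ, p)`. Under `z ↦ -z` the second row becomes a
first row for the symbols `(-p, -ρ)`, which explains the second invertibility hypothesis. -/
theorem exists_isRHSolution (hρ : Good ρ M) (hp : Good p N) (hρ' : Good (fun z => -p z) N)
    (hp' : Good (fun z => -ρ z) M) {s : ℝ} (hu : IsUnit (1 + opK ρ p s))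
    (hu' : IsUnit (1 + opK (fun z => -p z) (fun z => -ρ z) s)) :
    ∃ Mt : ℂ → Matrix (Fin 2) (Fin 2) ℂ, IsRHSolution 1 (fun z => ρ (-z)) p (-(Real.pi * s)) Mt ∧
      Tendsto (fun z => z * Mt z 0 1) atInfinity
        (𝓝 (Complex.I / (2 * Real.pi) * solU ρ p s)) := by
  obtain ⟨f, f', g, g', hf, hg, h0, h1⟩ := exists_row hρ hp hu
  obtain ⟨f₂, f₂', g₂, g₂', hf₂, hg₂, -, h2⟩ := exists_row hρ' hp' hu'
  have aneg : ∀ {q : ℝ → ℂ}, Integrable q → DifferentiableOn ℂ (fun z => cau q (-z)) offReal :=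
    fun hq => (differentiableOn_cau hq).comp differentiableOn_id.neg mapsTo_neg_offReal
  have O : ∀ {q q' : ℝ → ℂ}, InW q q' → cau q =O[atInfinity] (fun z : ℂ => z⁻¹) := fun hq =>
    isBigO_of_tendsto_mul hq.tendsto_mul_cau
  have Oneg : ∀ {q q' : ℝ → ℂ}, InW q q' →
      (fun z => cau q (-z)) =O[atInfinity] (fun z : ℂ => z⁻¹) := fun hq =>
    ((O hq).comp_tendsto tendsto_neg_atInfinity).trans (Asymptotics.isBigO_of_le _ fun z => by simp)
  refine ⟨fun z => !![1 - cau g z, cau f z; cau f₂ (-z), 1 - cau g₂ (-z)],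
    ⟨fun i j => ?_, fun i j => ?_,
      fun x => !![1 - cauchyUp g x, cauchyUp f x; cauM f₂ (-x), 1 - cauM g₂ (-x)],
      fun x => !![1 - cauM g x, cauM f x; cauchyUp f₂ (-x : ℝ), 1 - cauchyUp g₂ (-x : ℝ)],
      fun x => ⟨?_, ?_, ?_⟩⟩, ?_⟩
  · fin_cases i <;> fin_cases j
    exacts [(differentiableOn_cau hg.integrable).const_sub 1, differentiableOn_cau hf.integrable,
      aneg hf₂.integrable, (aneg hg₂.integrable).const_sub 1]
  · fin_cases i <;> fin_cases j
    · simpa using (O hg).neg_left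
    · simpa using O hf
    · simpa using Oneg hf₂
    · simpa using (Oneg hg₂).neg_left
  · refine tendsto_of_entries fun i j => ?_
    fin_cases i <;> fin_cases j
    exacts [(tendsto_cau_up hg.integrable x).const_sub 1, tendsto_cau_up hf.integrable x,
      (tendsto_cau_low hf₂.integrable (-x)).comp (tendsto_neg_nhdsWithin' x),
      ((tendsto_cau_low hg₂.integrable (-x)).comp (tendsto_neg_nhdsWithin' x)).const_sub 1]
  · refine tendsto_of_entries fun i j => ?_
    fin_cases i <;> fin_cases j
    exacts [(tendsto_cau_low hg.integrable x).const_sub 1, tendsto_cau_low hf.integrable x,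
      (tendsto_cau_up hf₂.integrable (-x)).comp (tendsto_neg_nhdsWithin x),
      ((tendsto_cau_up hg₂.integrable (-x)).comp (tendsto_neg_nhdsWithin x)).const_sub 1]
  · have e1 : Complex.exp (2 * Complex.I * ((-(Real.pi * s) : ℝ) : ℂ) * x) = chi (-(s * x)) := by
      rw [chi]; congr 1; push_cast; ring
    have e2 : Complex.exp (-(2 * Complex.I * ((-(Real.pi * s) : ℝ) : ℂ) * x)) = chi (s * x) := by
      rw [chi]; congr 1; push_cast; ring
    have e3 : chi (-(s * x)) * chi (s * x) = 1 := by rw [← chi_add]; simp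
    obtain ⟨k1, k2⟩ := h1 x
    obtain ⟨k3, k4⟩ := h2 (-x)
    rw [← cauchyUp_sub_cauM hf.integrable] at k1
    rw [← cauchyUp_sub_cauM hg.integrable] at k2
    rw [← cauchyUp_sub_cauM hf₂.integrable, show -(s * -x) = s * x by ring] at k3
    rw [← cauchyUp_sub_cauM hg₂.integrable, neg_neg, show s * -x = -(s * x) by ring] at k4
    simp only [jump, e1, e2]
    ext i j
    fin_cases i <;> fin_cases j <;> simp [Matrix.mul_apply, Fin.sum_univ_two] <;>
      simp only [Complex.ofReal_neg] at k3 k4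
    · linear_combination k2 + ρ (-x) * chi (s * x) * k1 +
        ρ (-x) * p x * (1 - cauM g x) * e3
    · linear_combination k1
    · linear_combination -k3 - ρ (-x) * chi (s * x) * k4 + ρ (-x) * p x * cauchyUp f₂ (-x) * e3
    · linear_combination -k4
  · rw [← h0]
    exact hf.tendsto_mul_cau

/-! ### The symbols of the deformed problem -/

namespace InX

variable {r r' q q' : ℝ → ℂ}

theorem good_neg (h : InX r r' N) : Good (fun z => -r z) ((2 * Real.pi) ^ 3 * N) := h.neg.good

theorem norm_bracket_mul_le (h : InX r r' N) (z : ℝ) : bracket z * ‖r z‖ ≤ 5 * N := by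
  have h1 := h.norm_le z
  have h2 := h.norm_mul_le z
  rw [norm_mul, Complex.norm_real, Real.norm_eq_abs] at h2
  nlinarith [bracket_le z, norm_nonneg (r z)]

theorem meas_bracket_deriv (h : InX r r' N) :
    AEStronglyMeasurable (fun z => (bracket z : ℂ) * r' z) volume :=
  (Continuous.aestronglyMeasurable (by fun_prop)).mul h.meas'

/-- The logarithm of `1 + r q`. -/
theorem log (hr : InX r r' N) (hq : InX q q' N) {δ : ℝ} (hδ1 : δ < 1)
    (hrb : ∀ z, ‖r z‖ ≤ δ) (hqb : ∀ z, ‖q z‖ ≤ δ) :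
    InX (fun z => Complex.log (1 + r z * q z))
      (fun z => (1 + r z * q z)⁻¹ * (r' z * q z + r z * q' z)) (2 * (1 - δ ^ 2)⁻¹ * N) := by
  have hδ0 : 0 ≤ δ := (norm_nonneg _).trans (hrb 0)
  have hK : 0 < 1 - δ ^ 2 := by nlinarith
  have hN := hr.nonneg
  have hball : ∀ w ∈ Metric.closedBall (0 : ℂ) (δ ^ 2), 1 - δ ^ 2 ≤ ‖1 + w‖ := fun w hw => by
    rw [mem_closedBall_zero_iff] at hw
    have := norm_sub_norm_le (1 : ℂ) (-w)
    rw [norm_one, norm_neg, sub_neg_eq_add] at this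
    linarith
  have hd : ∀ w ∈ Metric.closedBall (0 : ℂ) (δ ^ 2),
      HasDerivAt (fun w => Complex.log (1 + w)) (1 + w)⁻¹ w := fun w hw => by
    have h1 : (1 + w) ∈ Complex.slitPlane := by
      left
      rw [mem_closedBall_zero_iff] at hw
      have := (abs_le.1 (Complex.abs_re_le_norm w)).1
      simp only [Complex.add_re, Complex.one_re]
      linarith
    have := ((hasDerivAt_id w).const_add 1).clog h1
    simpa [div_eq_mul_inv] using this
  have hL : ∀ w ∈ Metric.closedBall (0 : ℂ) (δ ^ 2), ‖(1 + w)⁻¹‖ ≤ (1 - δ ^ 2)⁻¹ := fun w hw => by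
    rw [norm_inv]
    exact inv_anti₀ hK (hball w hw)
  have hmem : ∀ z, r z * q z ∈ Metric.closedBall (0 : ℂ) (δ ^ 2) := fun z => by
    rw [mem_closedBall_zero_iff, norm_mul, sq]
    exact mul_le_mul (hrb z) (hqb z) (norm_nonneg _) hδ0
  have hc : ContinuousOn (fun w : ℂ => (1 + w)⁻¹) (Metric.closedBall (0 : ℂ) (δ ^ 2)) := by
    refine ContinuousOn.inv₀ (by fun_prop) fun w hw h0 => ?_
    have := hball w hw
    rw [h0, norm_zero] at this
    linarith
  have hP := (hr.prim.mul hq.prim).comp_holomorphic (convex_closedBall 0 (δ ^ 2)) hd hL hc hmem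
  refine ⟨hP, by positivity, ?_, ?_⟩
  · have h1 := eLpNorm_le_ofReal_mul (c := (1 - δ ^ 2)⁻¹) (by positivity) hr.weight
      (f := fun z => ((bracket z ^ 3 : ℝ) : ℂ) * Complex.log (1 + r z * q z))
      (Eventually.of_forall fun z => ?_)
    · refine h1.trans (ENNReal.ofReal_le_ofReal ?_)
      have : 0 ≤ (1 - δ ^ 2)⁻¹ * N := by positivity
      linarith
    · have h2 := (convex_closedBall (0 : ℂ) (δ ^ 2)).norm_image_sub_le_of_norm_hasDerivWithin_le
        (fun w hw => (hd w hw).hasDerivWithinAt) hL (Metric.mem_closedBall_self (by positivity)) (hmem z)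
      simp only [add_zero, Complex.log_one, sub_zero, norm_mul] at h2
      rw [norm_mul, norm_mul]
      have h3 : ‖r z‖ * ‖q z‖ ≤ ‖r z‖ := mul_le_of_le_one_right (norm_nonneg _) ((hqb z).trans hδ1.le)
      calc _ ≤ ‖((bracket z ^ 3 : ℝ) : ℂ)‖ * ((1 - δ ^ 2)⁻¹ * ‖r z‖) := by
            gcongr; exact h2.trans (by gcongr)
        _ = _ := by ring
  · have h1 := eLpNorm_add_le_ofReal (f := fun z => ((‖(bracket z : ℂ) * r' z‖ : ℝ) : ℂ))
      (g := fun z => ((‖(bracket z : ℂ) * q' z‖ : ℝ) : ℂ)) hN hN (Complex.continuous_ofReal.comp_aestronglyMeasurable hr.meas_bracket_deriv.norm)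
      (Complex.continuous_ofReal.comp_aestronglyMeasurable hq.meas_bracket_deriv.norm)
      (le_of_eq_of_le (eLpNorm_congr_norm_ae (Eventually.of_forall fun z => by simp)) hr.weight_deriv)
      (le_of_eq_of_le (eLpNorm_congr_norm_ae (Eventually.of_forall fun z => by simp)) hq.weight_deriv)
    have h2 := eLpNorm_le_ofReal_mul (c := (1 - δ ^ 2)⁻¹) (by positivity) h1
      (f := fun z => (bracket z : ℂ) * ((1 + r z * q z)⁻¹ * (r' z * q z + r z * q' z)))
      (Eventually.of_forall fun z => ?_)
    · exact h2.trans_eq (by congr 1; ring)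
    · have e1 : ‖((‖(bracket z : ℂ) * r' z‖ : ℝ) : ℂ) + ((‖(bracket z : ℂ) * q' z‖ : ℝ) : ℂ)‖ =
          bracket z * (‖r' z‖ + ‖q' z‖) := by
        rw [← Complex.ofReal_add, Complex.norm_real, Real.norm_of_nonneg (by positivity), norm_mul,
          norm_mul, Complex.norm_real, Real.norm_of_nonneg (bracket_pos z).le]
        ring
      rw [e1, norm_mul, norm_mul, Complex.norm_real, Real.norm_of_nonneg (bracket_pos z).le]
      have e2 : ‖r' z * q z + r z * q' z‖ ≤ ‖r' z‖ + ‖q' z‖ := by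
        refine (norm_add_le _ _).trans ?_
        rw [norm_mul, norm_mul]
        exact add_le_add (mul_le_of_le_one_right (norm_nonneg _) ((hqb z).trans hδ1.le))
          (mul_le_of_le_one_left (norm_nonneg _) ((hrb z).trans hδ1.le))
      have e3 := hL _ (hmem z)
      have := bracket_pos z
      calc bracket z * (‖(1 + r z * q z)⁻¹‖ * ‖r' z * q z + r z * q' z‖)
          ≤ bracket z * ((1 - δ ^ 2)⁻¹ * (‖r' z‖ + ‖q' z‖)) := by gcongr
        _ = _ := by ring

/-- Multiplication by the exponential of a bounded function with square integrable derivative. -/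
theorem mul_exp (hr : InX r r' N) {η η' : ℝ → ℂ} (hη : IsPrim η η') {Q H : ℝ}
    (hH : 0 ≤ H) (hQ : ∀ z, ‖η z‖ ≤ Q) (hη' : eLpNorm η' 2 volume ≤ ENNReal.ofReal H) :
    InX (fun z => r z * Complex.exp (η z))
      (fun z => r' z * Complex.exp (η z) + r z * (Complex.exp (η z) * η' z))
      (Real.exp Q * (N + 5 * N * H)) := by
  have hN := hr.nonneg
  have hexp : ∀ w ∈ Metric.closedBall (0 : ℂ) Q, ‖Complex.exp w‖ ≤ Real.exp Q := fun w hw => by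
    rw [Complex.norm_exp]
    rw [mem_closedBall_zero_iff] at hw
    exact Real.exp_le_exp.2 ((Complex.re_le_norm w).trans hw)
  have hmem : ∀ z, η z ∈ Metric.closedBall (0 : ℂ) Q := fun z => mem_closedBall_zero_iff.2 (hQ z)
  have hE := hη.comp_holomorphic (convex_closedBall 0 Q) (fun w _ => Complex.hasDerivAt_exp w) hexp
    (by fun_prop) hmem
  refine ⟨hr.prim.mul hE, by positivity, ?_, ?_⟩
  · refine (eLpNorm_le_ofReal_mul (Real.exp_pos Q).le hr.weight (Eventually.of_forall fun z => ?_)).trans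
      (ENNReal.ofReal_le_ofReal ?_)
    · rw [← mul_assoc, norm_mul _ (Complex.exp _), mul_comm (Real.exp Q)]
      gcongr
      exact hexp _ (hmem z)
    · gcongr
      have : 0 ≤ 5 * N * H := by positivity
      linarith
  -- No weight is available on `η'`, so the weight is put on `r`, where `⟨z⟩ |r|` is at most `5 N`.
  · have h0 : eLpNorm (fun z => ((5 * N : ℝ) : ℂ) * η' z) 2 volume ≤ ENNReal.ofReal (5 * N * H) :=
      eLpNorm_le_ofReal_mul (by positivity) hη' (Eventually.of_forall fun z => by
        rw [norm_mul, Complex.norm_real, Real.norm_of_nonneg (by positivity)])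
    have hm : AEStronglyMeasurable (fun z => ((5 * N : ℝ) : ℂ) * η' z) volume :=
      hη.loc.aestronglyMeasurable.const_mul _
    have h1 := eLpNorm_add_le_ofReal (f := fun z => ((‖(bracket z : ℂ) * r' z‖ : ℝ) : ℂ))
      (g := fun z => ((‖((5 * N : ℝ) : ℂ) * η' z‖ : ℝ) : ℂ)) hN (by positivity) (Complex.continuous_ofReal.comp_aestronglyMeasurable hr.meas_bracket_deriv.norm)
      (Complex.continuous_ofReal.comp_aestronglyMeasurable hm.norm)
      (le_of_eq_of_le (eLpNorm_congr_norm_ae (Eventually.of_forall fun z => by simp)) hr.weight_deriv)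
      (le_of_eq_of_le (eLpNorm_congr_norm_ae (Eventually.of_forall fun z => by simp)) h0)
    refine eLpNorm_le_ofReal_mul (Real.exp_pos Q).le h1 (Eventually.of_forall fun z => ?_)
    have e1 : ‖((‖(bracket z : ℂ) * r' z‖ : ℝ) : ℂ) + ((‖((5 * N : ℝ) : ℂ) * η' z‖ : ℝ) : ℂ)‖ =
        bracket z * ‖r' z‖ + 5 * N * ‖η' z‖ := by
      rw [← Complex.ofReal_add, Complex.norm_real, Real.norm_of_nonneg (by positivity), norm_mul,
        norm_mul, Complex.norm_real, Complex.norm_real, Real.norm_of_nonneg (bracket_pos z).le,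
        Real.norm_of_nonneg (by positivity)]
    have hb := bracket_pos z
    have h5 := hr.norm_bracket_mul_le z
    rw [e1, norm_mul, Complex.norm_real, Real.norm_of_nonneg hb.le]
    calc bracket z * ‖r' z * Complex.exp (η z) + r z * (Complex.exp (η z) * η' z)‖
        ≤ bracket z * (‖r' z‖ * Real.exp Q + ‖r z‖ * (Real.exp Q * ‖η' z‖)) := by
          gcongr
          exact norm_add_le_of (norm_mul_le_of le_rfl (hexp _ (hmem z)))
            (norm_mul_le_of le_rfl (norm_mul_le_of (hexp _ (hmem z)) le_rfl))
      _ = Real.exp Q * (bracket z * ‖r' z‖ + bracket z * ‖r z‖ * ‖η' z‖) := by ring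
      _ ≤ Real.exp Q * (bracket z * ‖r' z‖ + 5 * N * ‖η' z‖) := by gcongr

end InX

theorem Good.integral_norm_ft_le (h : Good p N) : ∫ y, ‖ft p y‖ ≤ 2 * Real.pi * (2 * N) := by
  have hN := h.nonneg
  have hm := memLp_inv_bracket.1
  have hc : Continuous (ft p) := h.continuous_ft (k := 0) (by norm_num)
  have h1 := (integral_norm_mul_le (by positivity) (by positivity) hm
    (Continuous.aestronglyMeasurable (by fun_prop)) eLpNorm_inv_bracket_le
    (h.eLpNorm_bracket_ft_le (k := 0) (by norm_num))).2
  refine le_of_eq_of_le (integral_congr_ae (Eventually.of_forall fun y => ?_)) h1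
  have : (bracket y : ℂ) ≠ 0 := by exact_mod_cast (bracket_pos y).ne'
  simp only [Function.iterate_zero, id]
  rw [← mul_assoc, inv_mul_cancel₀ this, one_mul]

/-- The product of the two boundary values of the scalar function with the jump `exp L`. -/
theorem exists_deformation {L : ℝ → ℂ} {K : ℝ} (hL : Good L K) :
    ∃ η' : ℝ → ℂ, IsPrim (fun z => cauchyUp (ft L) z + cauM (ft L) z) η' ∧
      (∀ z : ℝ, ‖cauchyUp (ft L) z + cauM (ft L) z‖ ≤ 2 * Real.pi * (2 * K)) ∧
      eLpNorm η' 2 volume ≤ ENNReal.ofReal (2 * Real.pi * K) := by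
  -- The sum of the two boundary values is the Fourier integral of the reflected transform of `L`
  -- times a sign. The sign does not affect the first moment in `L²`, so the derivative is square
  -- integrable; it may destroy smoothness at `0`, so no weighted bound on the derivative is
  -- claimed.
  set g : ℝ → ℂ := fun y => (if y < 0 then 1 else -1) * ft L (-y) with hg
  have hWi := hL.inW_ft.integrable
  have hLc : Continuous (ft L) := hL.inW_ft.prim.continuous
  have hsm : Measurable fun y : ℝ => (if y < 0 then 1 else -1 : ℂ) :=
    Measurable.ite measurableSet_Iio measurable_const measurable_const
  have hsn : ∀ y : ℝ, ‖(if y < 0 then 1 else -1 : ℂ)‖ = 1 := fun y => by split_ifs <;> simp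
  have hgn : ∀ y, ‖g y‖ = ‖ft L (-y)‖ := fun y => by rw [hg, norm_mul, hsn, one_mul]
  have hgm : AEStronglyMeasurable g volume :=
    hsm.aestronglyMeasurable.mul (hLc.comp continuous_neg).aestronglyMeasurable
  have hgi : Integrable g :=
    hWi.comp_neg.norm.mono' hgm (Eventually.of_forall fun y => (hgn y).le)
  have hK := hL.nonneg
  have hwt : eLpNorm (fun y : ℝ => (y : ℂ) * ft L y) 2 volume ≤ ENNReal.ofReal K :=
    eLpNorm_le_of_norm_toE_le (hL.memLp_weight 0 (by norm_num)) (hL.weight_le 0 (by norm_num))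
  have hwt' : eLpNorm ((fun y : ℝ => (y : ℂ) * ft L y) ∘ Neg.neg) 2 volume ≤ ENNReal.ofReal K := by
    have hm0 : AEStronglyMeasurable (fun y : ℝ => (y : ℂ) * ft L y) volume :=
      (hL.memLp_weight 0 (by norm_num)).1
    rwa [eLpNorm_comp_measurePreserving hm0
      (Measure.measurePreserving_neg (volume : Measure ℝ))]
  have hzm : AEStronglyMeasurable (zmul g) volume :=
    (Continuous.aestronglyMeasurable (by fun_prop)).mul hgm
  have hz : eLpNorm (zmul g) 2 volume ≤ ENNReal.ofReal (2 * Real.pi * K) := by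
    refine eLpNorm_le_ofReal_mul (by positivity) hwt' (Eventually.of_forall fun y => ?_)
    rw [zmul, norm_mul, hgn]
    simp [abs_of_pos Real.pi_pos]
    exact le_of_eq (by ring)
  have hη : ∀ z : ℝ, cauchyUp (ft L) z + cauM (ft L) z = ft g z := by
    intro z
    have i0 : Integrable fun y => chi (-(z * y)) * g y := integrable_chi_mul hgi (by fun_prop)
    have e1 : cauM (ft L) z = ∫ y in Set.Ioi 0, chi (-(z * y)) * g y := by
      rw [cauM, cauchyUp, ← integral_neg]
      refine setIntegral_congr_fun measurableSet_Ioi fun y hy => ?_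
      have hy : (0 : ℝ) < y := hy
      simp only [hg, if_neg (not_lt.2 hy.le)]
      rw [← Complex.ofReal_neg, ker_ofReal, show y * -z = -(z * y) by ring]; ring
    have e2 : cauchyUp (ft L) z = ∫ y in Set.Iic 0, chi (-(z * y)) * g y := by
      have := integral_comp_neg_Iic (0 : ℝ) (fun y => ft L y * ker z y)
      rw [neg_zero] at this
      rw [cauchyUp, ← this, integral_Iic_eq_integral_Iio, integral_Iic_eq_integral_Iio]
      refine setIntegral_congr_fun measurableSet_Iio fun y hy => ?_
      have hy : y < (0 : ℝ) := hy
      simp only [hg, if_pos hy]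
      rw [ker_ofReal, show -y * z = -(z * y) by ring]; ring
    rw [e1, e2, intervalIntegral.integral_Iic_add_Ioi i0.integrableOn i0.integrableOn, ft]
  refine ⟨FT (toE (zmul g)), ?_, fun z => ?_, ?_⟩
  · simp only [hη]
    exact isPrim_ft hgi (memLp_of_eLpNorm_le hzm hz)
  · rw [hη]
    refine (norm_ft_le g z).trans (le_of_eq_of_le ?_ hL.integral_norm_ft_le)
    simp only [hgn]
    exact integral_neg_eq_self (fun y => ‖ft L y‖) volume
  · refine eLpNorm_le_of_norm_toE_le (Lp.memLp _) ?_
    rw [toE_coeFn, LinearIsometryEquiv.norm_map]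
    exact norm_toE_le (by positivity) hz

end

/-! ### The deformed problem and the limit in the reconstruction formula -/

section

variable {M N : ℝ}

theorem isBigO_exp_sub_one {f : ℂ → ℂ} (hf : f =O[atInfinity] fun z : ℂ => z⁻¹) :
    (fun z => Complex.exp (f z) - 1) =O[atInfinity] fun z : ℂ => z⁻¹ := by
  have h1 := (Complex.hasDerivAt_exp 0).isBigO_sub.comp_tendsto
    (hf.trans_tendsto tendsto_inv_atInfinity)
  simp only [Function.comp_def, Complex.exp_zero, sub_zero] at h1
  exact h1.trans hf

/-- The Riemann–Hilbert problem after the deformation which makes the limit `x → -∞` accessible. -/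
theorem exists_deformed {δ : ℝ} (hδ0 : 0 ≤ δ) (hδ1 : δ < 1) (hN : 0 ≤ N) :
    ∃ C, 0 ≤ C ∧ ∀ r r' p p' : ℝ → ℂ, InX r r' N → InX p p' N → (∀ z, ‖r z‖ ≤ δ) →
      (∀ z, ‖p z‖ ≤ δ) → ∃ ρ₁ ρ₁' p₁ p₁' : ℝ → ℂ, InX ρ₁ ρ₁' C ∧ InX p₁ p₁' C ∧
        ∀ x Mt, IsRHSolution 1 r p x Mt → ∃ Mt', IsRHSolution 1 (fun z => ρ₁ (-z)) p₁ (-x) Mt' ∧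
          ∀ c, Tendsto (fun z => z * Mt z 0 1) atInfinity (𝓝 c) →
            Tendsto (fun z => z * Mt' z 0 1) atInfinity (𝓝 (-c)) := by
  have hK : 0 < 1 - δ ^ 2 := by nlinarith
  obtain ⟨K, hKe⟩ : ∃ K, K = (2 * Real.pi) ^ 3 * (2 * (1 - δ ^ 2)⁻¹ * N) := ⟨_, rfl⟩
  have hK0 : 0 ≤ K := by rw [hKe]; positivity
  refine ⟨Real.exp (2 * Real.pi * (2 * K)) * (N + 5 * N * (2 * Real.pi * K)), by positivity, ?_⟩
  intro r r' p p' hr hp hrδ hpδ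
  set L : ℝ → ℂ := fun z => Complex.log (1 + r z * p z) with hLdef
  have hL : Good L K := hKe ▸ (hr.log hp hδ1 hrδ hpδ).good
  have hLW := hL.inW_ft
  have hi := hLW.integrable
  obtain ⟨η', hη, hηb, hη'⟩ := exists_deformation hL
  set η : ℝ → ℂ := fun z => cauchyUp (ft L) z + cauM (ft L) z with hηdef
  have hH : 0 ≤ 2 * Real.pi * K := by positivity
  have hη0 : IsPrim (fun z => -η z) fun z => -η' z := by simpa using hη.const_mul (-1)
  have hη0' : eLpNorm (fun z => -η' z) 2 volume ≤ ENNReal.ofReal (2 * Real.pi * K) :=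
    le_of_eq_of_le (eLpNorm_congr_norm_ae (Eventually.of_forall fun z => norm_neg _)) hη'
  have hρ₁ := (hr.mul_exp hη0 hH (fun z => (norm_neg _).trans_le (hηb z)) hη0').neg
  have hp₁ := (hp.mul_exp hη hH hηb hη').neg.reflect
  refine ⟨_, _, _, _, hρ₁, hp₁, fun x Mt hM => ?_⟩
  have hO : cau (ft L) =O[atInfinity] fun z : ℂ => z⁻¹ := isBigO_of_tendsto_mul hLW.tendsto_mul_cau
  have h1p : ∀ z, 1 + r z * p z ≠ 0 := fun z h0 => by
    have h1 : ‖r z * p z‖ ≤ δ ^ 2 := by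
      rw [norm_mul, sq]
      exact mul_le_mul (hrδ z) (hpδ z) (norm_nonneg _) hδ0
    rw [← neg_eq_iff_add_eq_zero.2 h0, norm_neg, norm_one] at h1
    linarith
  -- The jump of the Cauchy transform is `L = log(1 + r p)`, so its exponential has the jump `1 + r
  -- p`. The values of `1 + r p` lie in a disc around `1` that avoids `0`, so the principal
  -- logarithm is smooth there.
  have hd := hM.deform (d := fun z => Complex.exp (cau (ft L) z))
    (dp := fun s => Complex.exp (cauchyUp (ft L) s)) (dm := fun s => Complex.exp (cauM (ft L) s))
    ((differentiableOn_cau hi).cexp) (fun z => Complex.exp_ne_zero _) (isBigO_exp_sub_one hO)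
    ((isBigO_exp_sub_one hO.neg_left).congr_left fun z => by rw [Complex.exp_neg])
    (fun s => Complex.exp_ne_zero _) (fun s => Complex.exp_ne_zero _)
    (fun s => (Complex.continuous_exp.tendsto _).comp (tendsto_cau_up hi s))
    (fun s => (Complex.continuous_exp.tendsto _).comp (tendsto_cau_low hi s)) (fun s => by
      have h1 := cauchyUp_sub_cauM hi s
      rw [hL.ft_ft, neg_neg] at h1
      rw [← Complex.exp_log (h1p s), ← Complex.exp_add, ← show L s = Complex.log (1 + r s * p s) from rfl, ← h1]
      congr 1; ring)
  refine ⟨_, hd.congr (fun z => ?_) fun z => ?_, fun c hc => ?_⟩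
  · rw [← Complex.exp_add, ← Complex.exp_neg]
  · rw [← Complex.exp_add]
  · have h1 := (hc.comp tendsto_neg_atInfinity).mul ((Complex.continuous_exp.tendsto 0).comp
      ((hO.trans_tendsto tendsto_inv_atInfinity).comp tendsto_neg_atInfinity))
    rw [Complex.exp_zero, mul_one] at h1
    refine h1.neg.congr fun z => ?_
    simp [mul_assoc]

/-- The limit in the reconstruction formula. -/
theorem tendsto_of_isRHSolution {r p r' p' : ℝ → ℂ} (hr : InX r r' M) (hp : InX p p' N) {s : ℝ}
    {Mt : ℂ → Matrix (Fin 2) (Fin 2) ℂ}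
    (hu : IsUnit (1 + opK (fun z => r (-z)) p s))
    (hu' : IsUnit (1 + opK (fun z => -p z) (fun z => -r (-z)) s))
    (hM : IsRHSolution 1 r p (-(Real.pi * s)) Mt) :
    Tendsto (fun z => z * Mt z 0 1) atInfinity
        (𝓝 (Complex.I / (2 * Real.pi) * solU (fun z => r (-z)) p s)) := by
  obtain ⟨Mt', h1, h2⟩ := exists_isRHSolution hr.reflect.good hp.good hp.good_neg
    hr.reflect.good_neg hu hu'
  refine h2.congr' ?_
  filter_upwards [hM.eventuallyEq (h1.congr (fun z => by rw [neg_neg]) fun z => rfl)] with z hz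
  rw [hz]

theorem isUnit_opK_of_bound {ρ p : ℝ → ℂ} (hρ : Good ρ M) (hp : Good p N) {δ : ℝ} (hδ1 : δ < 1)
    (hrδ : ∀ z, ‖ρ z‖ ≤ δ) (hpδ : ∀ z, ‖p z‖ ≤ δ) (s : ℝ) :
    IsUnit (1 + opK ρ p s) ∧ ‖res ρ p s‖ ≤ (1 - δ ^ 2)⁻¹ := by
  have hδ0 : 0 ≤ δ := (norm_nonneg _).trans (hrδ 0)
  exact isUnit_one_add (by nlinarith) ((norm_opK_le_of_bound hρ hp hrδ hpδ s).trans_eq (sq δ).symm)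

end

/-! ### Gluing the two half-lines and bounding the potential in the space of potentials -/

section

variable {M N : ℝ}

/-- `u` has three derivatives `u₁`, `u₂`, `u₃`, of size at most `C` in the space of the potentials. -/
structure InY (u u₁ u₂ u₃ : ℝ → ℂ) (C : ℝ) : Prop where
  prim₁ : IsPrim u u₁
  prim₂ : IsPrim u₁ u₂
  prim₃ : IsPrim u₂ u₃
  norm : eLpNorm (fun s => (bracket s : ℂ) * u s) 2 volume ≤ ENNReal.ofReal C
  norm₁ : eLpNorm (fun s => (bracket s : ℂ) * u₁ s) 2 volume ≤ ENNReal.ofReal C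
  norm₂ : eLpNorm u₂ 2 volume ≤ ENNReal.ofReal C
  norm₃ : eLpNorm u₃ 2 volume ≤ ENNReal.ofReal C

theorem isPrim_of_locallyIntegrable {g : ℝ → ℂ} (h : LocallyIntegrable g) :
    IsPrim (fun x => ∫ t in (0 : ℝ)..x, g t) g := ⟨h, fun u v => by
  rw [intervalIntegral.integral_interval_sub_left] <;>
    exact intervalIntegrable_of_locallyIntegrable h _ _⟩

theorem LocallyIntegrable.comp_neg {g : ℝ → ℂ} (h : LocallyIntegrable g) :
    LocallyIntegrable fun x => g (-x) := by
  have h1 := (isPrim_of_locallyIntegrable h).comp_neg.loc.neg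
  refine (congrArg (fun f => LocallyIntegrable f volume) (funext fun x => ?_)).mp h1
  simp

theorem eLpNorm_comp_neg (g : ℝ → ℂ) :
    eLpNorm (fun x => g (-x)) 2 volume = eLpNorm g 2 volume := by
  have h := (MeasurableEquiv.neg ℝ).measurableEmbedding.eLpNorm_map_measure (g := g) (p := 2)
    (μ := (volume : Measure ℝ))
  have e : Measure.map (MeasurableEquiv.neg ℝ) (volume : Measure ℝ) = volume :=
    (Measure.measurePreserving_neg (volume : Measure ℝ)).map_eq
  rw [e] at h
  exact h.symm

theorem eLpNorm_le_of_halves {f g h : ℝ → ℂ} {a b c A B : ℝ} (hA : 0 ≤ A) (hB : 0 ≤ B)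
    (hf : AEStronglyMeasurable f volume)
    (h1 : eLpNorm ((Set.Ioi a).indicator g) 2 volume ≤ ENNReal.ofReal A)
    (h2 : eLpNorm ((Set.Ioi b).indicator h) 2 volume ≤ ENNReal.ofReal B)
    (hac : a < c) (hbc : b < -c)
    (hg : ∀ s, c < s → ‖f s‖ = ‖g s‖) (he : ∀ s ≤ c, ‖f s‖ = ‖h (-s)‖) :
    eLpNorm f 2 volume ≤ ENNReal.ofReal (A + B) := by
  have e : f = fun s => (Set.Ioi c).indicator f s + (Set.Iic c).indicator f s := by
    ext s
    by_cases hs : c < s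
    · simp [hs, not_le.2 hs]
    · simp [hs, not_lt.1 hs]
  rw [e]
  refine eLpNorm_add_le_ofReal hA hB (hf.indicator measurableSet_Ioi)
    (hf.indicator measurableSet_Iic) ?_ ?_
  · refine (eLpNorm_mono fun s => ?_).trans h1
    by_cases hs : c < s
    · simp [hs, hac.trans hs, hg s hs]
    · simp [hs]
  · refine (eLpNorm_mono (g := fun s => (Set.Ioi b).indicator h (-s)) fun s => ?_).trans
      ((eLpNorm_comp_neg _).trans_le h2)
    by_cases hs : s ≤ c
    · have : b < -s := by linarith
      simp [hs, this, he s hs]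
    · simp [hs]

/-- The half-lines `s > a` and `s < -b` overlap and cover the line, so differentiability is local on
each. The third derivative is defined by switching at the point `c` of the overlap, where the
identity `u(s) = -v(-s)` lets the two integral formulas be joined. -/
theorem LocalEst.glue {u v w₁ w₂ : ℝ → ℂ} {a b c A B : ℝ} (h1 : LocalEst (Set.Ioi a) u w₁ A)
    (h2 : LocalEst (Set.Ioi b) v w₂ B) (hA : 0 ≤ A) (hB : 0 ≤ B) (hac : a < c) (hbc : b < -c)
    (h : ∀ s < -b, u s = -v (-s)) : ∃ u₁ u₂ u₃, InY u u₁ u₂ u₃ (A + B) := by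
  have hev : ∀ s < -b, u =ᶠ[𝓝 s] fun s => -v (-s) := fun s hs => by
    filter_upwards [Iio_mem_nhds hs] with t ht using h t ht
  have d1 : ∀ s < -b, deriv u s = deriv v (-s) := fun s hs => by
    rw [(hev s hs).deriv_eq, deriv.fun_neg, deriv_comp_neg, neg_neg]
  have hev1 : ∀ s < -b, deriv u =ᶠ[𝓝 s] fun s => deriv v (-s) := fun s hs => by
    filter_upwards [Iio_mem_nhds hs] with t ht using d1 t ht
  have d2 : ∀ s < -b, deriv (deriv u) s = -deriv (deriv v) (-s) := fun s hs => by
    rw [(hev1 s hs).deriv_eq, deriv_comp_neg]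
  have D1 : Differentiable ℝ u := fun s => by
    by_cases hs : a < s
    · exact h1.differentiableAt s hs
    · have hs' : s < -b := by linarith [not_lt.1 hs]
      refine DifferentiableAt.congr_of_eventuallyEq ?_ (hev s hs')
      exact ((h2.differentiableAt (-s) (by simpa using lt_neg_of_lt_neg hs')).comp s
        differentiableAt_id.neg).neg
  have D2 : Differentiable ℝ (deriv u) := fun s => by
    by_cases hs : a < s
    · exact h1.differentiableAt_deriv s hs
    · have hs' : s < -b := by linarith [not_lt.1 hs]
      refine DifferentiableAt.congr_of_eventuallyEq ?_ (hev1 s hs')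
      exact (h2.differentiableAt_deriv (-s) (by simpa using lt_neg_of_lt_neg hs')).comp s
        differentiableAt_id.neg
  have hloc : LocallyIntegrable ((Set.Ioi c).indicator w₁ + (Set.Iic c).indicator fun s => w₂ (-s)) :=
    (h1.locallyIntegrable.indicator measurableSet_Ioi).add
      ((LocallyIntegrable.comp_neg h2.locallyIntegrable).indicator measurableSet_Iic)
  set u₃ : ℝ → ℂ := (Set.Ioi c).indicator w₁ + (Set.Iic c).indicator fun s => w₂ (-s) with hu₃
  have e1 : ∀ s, c < s → u₃ s = w₁ s := fun s hs => by simp [hu₃, hs, not_le.2 hs]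
  have e2 : ∀ s ≤ c, u₃ s = w₂ (-s) := fun s hs => by simp [hu₃, hs, not_lt.2 hs]
  have base : ∀ x, ∫ s in c..x, u₃ s = deriv (deriv u) x - deriv (deriv u) c := fun x => by
    rcases le_or_gt c x with hx | hx
    · rw [← h1.integral_eq c hac x (hac.trans_le hx)]
      refine intervalIntegral.integral_congr_ae (Eventually.of_forall fun s hs => ?_)
      rw [Set.uIoc_of_le hx] at hs
      exact e1 s hs.1
    · have h3 : ∫ s in c..x, u₃ s = ∫ s in c..x, w₂ (-s) :=
        intervalIntegral.integral_congr_ae (Eventually.of_forall fun s hs => by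
          rw [Set.uIoc_of_ge hx.le] at hs
          exact e2 s hs.2)
      rw [h3, intervalIntegral.integral_comp_neg, h2.integral_eq (-x) (by simp; linarith) (-c) hbc,
        d2 x (by linarith), d2 c (by linarith)]
      ring
  have P3 : IsPrim (deriv (deriv u)) u₃ := ⟨hloc, fun x y => by
    rw [← intervalIntegral.integral_interval_sub_left
      (intervalIntegrable_of_locallyIntegrable hloc c y)
      (intervalIntegrable_of_locallyIntegrable hloc c x), base, base]
    ring⟩
  have hb : Continuous fun s => (bracket s : ℂ) := by fun_prop
  refine ⟨deriv u, deriv (deriv u), u₃, ⟨IsPrim.of_hasDerivAt (fun x => (D1 x).hasDerivAt) D2.continuous,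
    IsPrim.of_hasDerivAt (fun x => (D2 x).hasDerivAt) P3.continuous, P3, ?_, ?_, ?_, ?_⟩⟩
  · refine eLpNorm_le_of_halves hA hB (hb.mul D1.continuous).aestronglyMeasurable h1.norm_le h2.norm_le
      hac hbc (fun s _ => rfl) fun s hs => ?_
    rw [h s (by linarith), bracket_neg, mul_neg, norm_neg]
  · refine eLpNorm_le_of_halves hA hB (hb.mul D2.continuous).aestronglyMeasurable h1.norm_deriv_le
      h2.norm_deriv_le hac hbc (fun s _ => rfl) fun s hs => ?_
    rw [d1 s (by linarith), bracket_neg]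
  · refine eLpNorm_le_of_halves hA hB P3.continuous.aestronglyMeasurable h1.norm_deriv₂_le
      h2.norm_deriv₂_le hac hbc (fun s _ => rfl) fun s hs => ?_
    rw [d2 s (by linarith), norm_neg]
  · exact eLpNorm_le_of_halves hA hB hloc.aestronglyMeasurable h1.norm_deriv₃_le h2.norm_deriv₃_le
      hac hbc (fun s hs => by rw [e1 s hs]) fun s hs => by rw [e2 s hs]

/-- The scaling factor between the variable of the potential and that of the Marchenko equation. -/
def scl : ℝ := -(1 / Real.pi)

/-- The potential reconstructed from two symbols. -/
def pot (r p : ℝ → ℂ) (x : ℝ) : ℂ := scl * solU (fun z => r (-z)) p (scl * x)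

theorem scl_ne_zero : scl ≠ 0 := neg_ne_zero.2 (one_div_ne_zero Real.pi_ne_zero)

theorem abs_scl : |scl| = 1 / Real.pi := by
  rw [scl, abs_neg, abs_of_pos (by positivity)]

theorem abs_scl_le_one : |scl| ≤ 1 := by
  rw [abs_scl, div_le_one Real.pi_pos]
  linarith [Real.pi_gt_three]

theorem abs_scl_mul_bracket_le (x : ℝ) : |scl| * bracket x ≤ bracket (scl * x) := by
  rw [bracket, bracket, ← Real.sqrt_sq (abs_nonneg scl), ← Real.sqrt_mul (sq_nonneg _), sq_abs]
  refine Real.sqrt_le_sqrt ?_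
  have : scl ^ 2 ≤ 1 := by rw [← sq_abs]; exact pow_le_one₀ (abs_nonneg _) abs_scl_le_one
  linarith [mul_pow scl x 2]

/-- The change of variables contributes `|scl|^{-1/2} = √π ≤ 2`. -/
theorem eLpNorm_comp_scl_le {g : ℝ → ℂ} {C : ℝ}
    (h : eLpNorm g 2 volume ≤ ENNReal.ofReal C) :
    eLpNorm (fun x => g (scl * x)) 2 volume ≤ ENNReal.ofReal (2 * C) := by
  have h1 := (MeasurableEquiv.mulLeft₀ scl scl_ne_zero).measurableEmbedding.eLpNorm_map_measure
    (g := g) (p := 2) (μ := (volume : Measure ℝ))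
  have e : Measure.map (MeasurableEquiv.mulLeft₀ scl scl_ne_zero) (volume : Measure ℝ) =
      ENNReal.ofReal |scl⁻¹| • volume := Real.map_volume_mul_left scl_ne_zero
  rw [e, eLpNorm_smul_measure_of_ne_top (by norm_num)] at h1
  refine (h1.symm.trans_le ?_ : eLpNorm (fun x => g (scl * x)) 2 volume ≤ _)
  rw [smul_eq_mul, ENNReal.ofReal_mul (by norm_num)]
  refine mul_le_mul' ?_ h
  have h4 : ENNReal.ofReal |scl⁻¹| ≤ 4 := by
    rw [abs_inv, abs_scl, one_div, inv_inv]
    exact ENNReal.ofReal_le_of_le_toReal (by simpa using Real.pi_le_four)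
  calc ENNReal.ofReal |scl⁻¹| ^ (1 / (2 : ℝ≥0∞)).toReal ≤ 4 ^ (1 / (2 : ℝ≥0∞)).toReal := by gcongr
    _ = (2 ^ (2 : ℝ)) ^ (1 / 2 : ℝ) := by norm_num
    _ = ENNReal.ofReal 2 := by rw [← ENNReal.rpow_mul]; norm_num

theorem InY.scale {u u₁ u₂ u₃ : ℝ → ℂ} {C : ℝ} (h : InY u u₁ u₂ u₃ C) :
    ∃ v₁ v₂ v₃, InY (fun x => scl * u (scl * x)) v₁ v₂ v₃ (2 * C) := by
  have e0 : (Complex.ofReal scl) ≠ 0 := by exact_mod_cast scl_ne_zero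
  have b0 := abs_nonneg scl
  have b1 := abs_scl_le_one
  have key : ∀ (x : ℝ) (a : ℂ), ‖(bracket x : ℂ) * (scl * a)‖ ≤ 1 * ‖(bracket (scl * x) : ℂ) * a‖ :=
    fun x a => by
      rw [norm_mul, norm_mul, norm_mul, Complex.norm_real, Complex.norm_real, Complex.norm_real,
        Real.norm_of_nonneg (bracket_pos _).le, Real.norm_of_nonneg (bracket_pos _).le, one_mul,
        ← mul_assoc, mul_comm (bracket x)]
      gcongr
      exact abs_scl_mul_bracket_le x
  have hs : ∀ a : ℂ, ‖(scl : ℂ) * a‖ ≤ ‖a‖ := fun a => by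
    rw [norm_mul, Complex.norm_real]
    exact mul_le_of_le_one_left (norm_nonneg _) b1
  refine ⟨_, _, _, (h.prim₁.comp_mul scl_ne_zero).const_mul scl,
    ((h.prim₂.comp_mul scl_ne_zero).const_mul scl).const_mul scl,
    (((h.prim₃.comp_mul scl_ne_zero).const_mul scl).const_mul scl).const_mul scl, ?_, ?_, ?_, ?_⟩
  · refine (eLpNorm_le_ofReal_mul zero_le_one (eLpNorm_comp_scl_le h.norm)
      (Eventually.of_forall fun x => key x _)).trans_eq (by rw [one_mul])
  · refine (eLpNorm_le_ofReal_mul zero_le_one (eLpNorm_comp_scl_le h.norm₁)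
      (Eventually.of_forall fun x => (key x _).trans ?_)).trans_eq (by rw [one_mul])
    gcongr
    rw [mul_left_comm]
    exact hs _
  · refine (eLpNorm_le_ofReal_mul zero_le_one (eLpNorm_comp_scl_le h.norm₂)
      (Eventually.of_forall fun x => ?_)).trans_eq (by rw [one_mul])
    rw [one_mul]
    exact ((hs _).trans (hs _)).trans (hs _)
  · refine (eLpNorm_le_ofReal_mul zero_le_one (eLpNorm_comp_scl_le h.norm₃)
      (Eventually.of_forall fun x => ?_)).trans_eq (by rw [one_mul])
    rw [one_mul]
    exact (((hs _).trans (hs _)).trans (hs _)).trans (hs _)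

/-- The potential lies in the space of the potentials, uniformly for bounded sets of symbols. -/
theorem exists_inY {δ : ℝ} (hδ0 : 0 ≤ δ) (hδ1 : δ < 1) (hN : 0 ≤ N) :
    ∃ C, 0 ≤ C ∧ ∀ r r' p p' : ℝ → ℂ, InX r r' N → InX p p' N → (∀ z, ‖r z‖ ≤ δ) →
      (∀ z, ‖p z‖ ≤ δ) → ∃ u₁ u₂ u₃, InY (pot r p) u₁ u₂ u₃ C := by
  have hK : 0 < 1 - δ ^ 2 := by nlinarith
  obtain ⟨D, hD, hdef⟩ := exists_deformed hδ0 hδ1 hN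
  set G : ℝ := (2 * Real.pi) ^ 3 with hG
  have hG0 : 0 ≤ G := by positivity
  obtain ⟨S, hS, hinv⟩ := exists_isUnit_of_le (G * D) (G * D)
  -- The contraction estimate holds for all `s`, so this half-line may start at any point. The
  -- choice `-S - 1` makes it overlap with `s < -S`, where the deformed problem takes over.
  obtain ⟨A, hA, hest₁⟩ := exists_localEst (G * N) (G * N) (1 - δ ^ 2)⁻¹ (-S - 1) (by positivity)
    (by positivity) (by positivity)
  obtain ⟨B, hB, hest₂⟩ := exists_localEst (G * D) (G * D) 2 S (by positivity) (by positivity)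
    (by norm_num)
  refine ⟨2 * (A + B), by positivity, fun r r' p p' hr hp hrδ hpδ => ?_⟩
  obtain ⟨ρ₁, ρ₁', p₁, p₁', hρ₁, hp₁, hM⟩ := hdef r r' p p' hr hp hrδ hpδ
  have hu := isUnit_opK_of_bound hr.reflect.good hp.good hδ1 (fun z => hrδ _) hpδ
  have hu' := isUnit_opK_of_bound hp.good_neg hr.reflect.good_neg hδ1
    (fun z => (norm_neg _).trans_le (hpδ z)) (fun z => (norm_neg _).trans_le (hrδ _))
  obtain ⟨w₁, hw₁⟩ := hest₁ _ _ hr.reflect.good hp.good fun s _ => hu s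
  obtain ⟨w₂, hw₂⟩ := hest₂ _ _ hρ₁.good hp₁.good fun s hs => hinv _ _ hρ₁.good hp₁.good s hs
  -- The deformation takes a solution at `s` to a solution at `-s` and changes the sign of the
  -- coefficient of `1/z`. Each coefficient is given by its own Marchenko equation, and limits are
  -- unique.
  have key : ∀ s < -S, solU (fun z => r (-z)) p s = -solU ρ₁ p₁ (-s) := by
    intro s hs
    obtain ⟨Mt, m1, m2⟩ := exists_isRHSolution hr.reflect.good hp.good hp.good_neg
      hr.reflect.good_neg (hu s).1 (hu' s).1
    obtain ⟨Mt', m3, m4⟩ := hM (-(Real.pi * s)) Mt (m1.congr (fun z => by rw [neg_neg]) fun z => rfl)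
    have m5 := m4 _ m2
    have hs' : S ≤ -s := by linarith
    have m6 := tendsto_of_isRHSolution (s := -s) hρ₁.reflect hp₁ (Mt := Mt')
      (by simpa using (hinv _ _ hρ₁.good hp₁.good (-s) hs').1)
      (by simpa using (hinv _ _ hp₁.good_neg hρ₁.good_neg (-s) hs').1)
      (by simpa using m3)
    have m7 := tendsto_nhds_unique m5 m6
    simp only [neg_neg] at m7
    have hne : Complex.I / (2 * Real.pi) ≠ 0 := by
      have : (Real.pi : ℂ) ≠ 0 := by exact_mod_cast Real.pi_ne_zero
      simp [this]
    refine mul_left_cancel₀ hne ?_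
    rw [← neg_eq_iff_eq_neg.2 m7.symm]; ring
  obtain ⟨u₁, u₂, u₃, h3⟩ := hw₁.glue hw₂ hA hB (c := -S - 1 / 2) (by linarith) (by linarith) key
  exact h3.scale

end

section

/-! ### Families of functions depending holomorphically on a parameter -/

/-- Differentiation under the integral. Cauchy's estimate on discs of radius `ε/4` turns the uniform
bound on `f` into the uniform bound on its derivative in `θ` that dominates. -/
theorem differentiableOn_integral_mul {f : ℂ → ℝ → ℂ} {U : Set ℂ} (hU : IsOpen U) {B : ℝ}
    (hd : ∀ x, DifferentiableOn ℂ (fun θ => f θ x) U) (hc : ∀ θ ∈ U, Continuous (f θ))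
    (hB : ∀ θ ∈ U, ∀ x, ‖f θ x‖ ≤ B) {χ : ℝ → ℂ} (hχ : Continuous χ) (hs : HasCompactSupport χ) :
    DifferentiableOn ℂ (fun θ => ∫ x, f θ x * χ x) U := by
  intro θ₀ hθ₀
  obtain ⟨ε, hε, hεU⟩ := Metric.isOpen_iff.1 hU θ₀ hθ₀
  have hball : ∀ θ ∈ Metric.ball θ₀ (ε / 2), Metric.closedBall θ (ε / 4) ⊆ Metric.ball θ₀ ε :=
    fun θ hθ w hw => by
      rw [Metric.mem_ball] at hθ ⊢
      rw [Metric.mem_closedBall] at hw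
      linarith [dist_triangle w θ θ₀]
  have hdiff : ∀ θ ∈ Metric.ball θ₀ (ε / 2), ∀ x, HasDerivAt (fun θ => f θ x) (deriv (fun θ => f θ x) θ) θ :=
    fun θ hθ x => ((hd x).differentiableAt (hU.mem_nhds (hεU (hball θ hθ
      (Metric.mem_closedBall_self (by positivity)))))).hasDerivAt
  have hbd : ∀ θ ∈ Metric.ball θ₀ (ε / 2), ∀ x, ‖deriv (fun θ => f θ x) θ‖ ≤ B / (ε / 4) :=
    fun θ hθ x => by
      refine Complex.norm_deriv_le_of_forall_mem_sphere_norm_le (by positivity) ?_ fun w hw =>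
        hB w (hεU (hball θ hθ (Metric.sphere_subset_closedBall hw))) x
      refine ((hd x).mono ((hball θ hθ).trans hεU)).diffContOnCl_ball ?_
      exact subset_rfl
  have hχi : Integrable χ := hχ.integrable_of_hasCompactSupport hs
  have hθb : θ₀ ∈ Metric.ball θ₀ (ε / 2) := Metric.mem_ball_self (by positivity)
  refine DifferentiableAt.differentiableWithinAt ?_
  refine (hasDerivAt_integral_of_dominated_loc_of_deriv_le (F := fun θ x => f θ x * χ x)
    (F' := fun θ x => deriv (fun θ => f θ x) θ * χ x) (bound := fun x => B / (ε / 4) * ‖χ x‖)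
    (Metric.ball_mem_nhds θ₀ (half_pos hε)) ?_ ?_ ?_ ?_ (hχi.norm.const_mul _) ?_).2.differentiableAt
  · filter_upwards [hU.mem_nhds hθ₀] with θ hθ
    exact ((hc θ hθ).mul hχ).aestronglyMeasurable
  · exact ((hc θ₀ hθ₀).mul hχ).integrable_of_hasCompactSupport hs.mul_left
  · refine AEStronglyMeasurable.mul ?_ hχ.aestronglyMeasurable
    -- The derivative in the parameter is measurable in `x` as the limit of difference quotients
    -- along a sequence; the increments are nonzero and smaller than `ε`.
    have hseq : Tendsto (fun n : ℕ => θ₀ + ((ε / 2) * (n + 2 : ℝ)⁻¹ : ℝ)) atTop (𝓝[≠] θ₀) := by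
      refine tendsto_nhdsWithin_iff.2 ⟨?_, Eventually.of_forall fun n => ?_⟩
      · have h1 : Tendsto (fun n : ℕ => (ε / 2) * (n + 2 : ℝ)⁻¹) atTop (𝓝 0) := by
          have := (tendsto_inv_atTop_zero.comp (tendsto_natCast_atTop_atTop.atTop_add
            (tendsto_const_nhds (x := (2 : ℝ))))).const_mul (ε / 2)
          simpa using this
        have := ((Complex.continuous_ofReal.tendsto 0).comp h1).const_add θ₀
        simpa using this
      · have h2 : ((ε / 2) * (n + 2 : ℝ)⁻¹ : ℝ) ≠ 0 := by positivity
        have h3 : (((ε / 2) * (n + 2 : ℝ)⁻¹ : ℝ) : ℂ) ≠ 0 := by exact_mod_cast h2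
        simpa using h3
    have hmem : ∀ n : ℕ, θ₀ + ((ε / 2) * (n + 2 : ℝ)⁻¹ : ℝ) ∈ U := fun n => hεU <| by
      rw [Metric.mem_ball, dist_eq_norm, add_sub_cancel_left, Complex.norm_real,
        Real.norm_of_nonneg (by positivity)]
      have : (n + 2 : ℝ)⁻¹ ≤ 1 := inv_le_one_of_one_le₀ (by linarith [n.cast_nonneg (α := ℝ)])
      nlinarith
    refine aestronglyMeasurable_of_tendsto_ae atTop
      (f := fun (n : ℕ) x => slope (fun θ => f θ x) θ₀ (θ₀ + ((ε / 2) * (n + 2 : ℝ)⁻¹ : ℝ)))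
      (fun n => ?_) (Eventually.of_forall fun x =>
        ((hasDerivAt_iff_tendsto_slope.1 (hdiff θ₀ hθb x)).comp hseq))
    simp only [slope_def_field]
    exact (((hc _ (hmem n)).sub (hc _ hθ₀)).div_const _).aestronglyMeasurable
  · refine Eventually.of_forall fun x θ hθ => ?_
    rw [norm_mul]
    gcongr
    exact hbd θ hθ x
  · exact Eventually.of_forall fun x θ hθ => (hdiff θ hθ x).mul_const _

/-- The Schwarz lemma for square integrable functions depending weakly holomorphically on a
parameter. -/
theorem eLpNorm_sub_le_of_weak {h : ℂ → ℝ → ℂ} {R C : ℝ} (hR : 1 < R) (hC : 0 ≤ C)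
    (hm : ∀ θ ∈ Metric.ball (0 : ℂ) R, AEStronglyMeasurable (h θ) volume)
    (hb : ∀ θ ∈ Metric.ball (0 : ℂ) R, eLpNorm (h θ) 2 volume ≤ ENNReal.ofReal C)
    (hd : ∀ ψ : ℝ → ℂ, ContDiff ℝ ∞ ψ → HasCompactSupport ψ →
      DifferentiableOn ℂ (fun θ => ∫ x, h θ x * ψ x) (Metric.ball 0 R)) :
    eLpNorm (fun x => h 1 x - h 0 x) 2 volume ≤ ENNReal.ofReal (2 * C / R) := by
  have hl : ∀ θ ∈ Metric.ball (0 : ℂ) R, MemLp (h θ) 2 volume := fun θ hθ =>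
    memLp_of_eLpNorm_le (hm θ hθ) (hb θ hθ)
  have m1 : (1 : ℂ) ∈ Metric.ball (0 : ℂ) R := by simpa using hR
  have m0 : (0 : ℂ) ∈ Metric.ball (0 : ℂ) R := Metric.mem_ball_self (by linarith)
  refine eLpNorm_le_of_norm_toE_le ((hl 1 m1).sub (hl 0 m0)) (norm_le_of_pair_le fun g => ?_)
  refine (Lp.dense_hasCompactSupport_contDiff (p := 2) (μ := (volume : Measure ℝ)) (E := ℝ) (F := ℂ)
    ENNReal.ofNat_ne_top).induction ?_ (isClosed_le (by fun_prop) (by fun_prop)) g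
  rintro f ⟨ψ, hf, hψc, hψ⟩
  have hψ2 : MemLp ψ 2 volume := hψ.continuous.memLp_of_hasCompactSupport hψc
  rw [eq_toE hf]
  have hF : ∀ θ ∈ Metric.ball (0 : ℂ) R, ∫ x, h θ x * ψ x = pair (toE (h θ)) (toE ψ) := fun θ hθ =>
    (pair_toE (hl θ hθ) hψ2).symm
  have hFb : ∀ θ ∈ Metric.ball (0 : ℂ) R, ‖∫ x, h θ x * ψ x‖ ≤ C * ‖toE ψ‖ := fun θ hθ => by
    rw [hF θ hθ]
    exact (norm_pair_le _ _).trans (by gcongr; exact norm_toE_le hC (hb θ hθ))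
  -- The Schwarz lemma for a scalar function bounded by `C ‖ψ‖`. Its distance from the value at the
  -- centre is at most twice that, whence the factor `2` in the result.
  have key := Complex.dist_le_div_mul_dist_of_mapsTo_ball (hd ψ hψ hψc) (R₂ := 2 * (C * ‖toE ψ‖))
    (fun θ hθ => by
      rw [Metric.mem_closedBall, dist_eq_norm]
      linarith [norm_sub_le (∫ x, h θ x * ψ x) (∫ x, h 0 x * ψ x), hFb θ hθ, hFb 0 m0]) m1
  rw [toE_sub (hl 1 m1) (hl 0 m0), map_sub, sub_apply, ← hF 1 m1, ← hF 0 m0,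
    ← dist_eq_norm]
  refine key.trans_eq ?_
  rw [dist_zero_right, norm_one]
  ring

/-! ### Dependence of the potential on the symbols -/

variable {M N M' N' : ℝ} {ρ ρ₁ p p₁ : ℝ → ℂ}

theorem ft_add_mul (hp : Integrable p) (hp₁ : Integrable p₁) (θ : ℂ) (s : ℝ) :
    ft (fun z => p z + θ * p₁ z) s = ft p s + θ * ft p₁ s := by
  rw [ft, ft, ft, ← integral_const_mul, ← integral_add (integrable_chi_mul hp (by fun_prop))
    ((integrable_chi_mul hp₁ (by fun_prop)).const_mul θ)]
  congr 1; ext z; ring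

theorem vec_add_mul (hp : MemLp p 2 volume) (hp₁ : MemLp p₁ 2 volume) (θ : ℂ) (s : ℝ) :
    vec (fun z => p z + θ * p₁ z) s = vec p s + θ • vec p₁ s := by
  have h1 := memLp_chi_mul hp (c := fun z => -(s * z)) (by fun_prop)
  have h2 := memLp_chi_mul hp₁ (c := fun z => -(s * z)) (by fun_prop)
  rw [vec, vec, vec, ← map_smul, ← map_add, ← toE_const_mul h2, ← toE_add h1 (h2.const_mul θ)]
  congr 2; ext z; ring

theorem Good.toE_ft_add_mul (hp : Good p N) (hp₁ : Good p₁ N') (θ : ℂ) :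
    toE (ft fun z => p z + θ * p₁ z) = toE (ft p) + θ • toE (ft p₁) := by
  have h1 : MemLp (ft p) 2 volume := hp.memLp_ft (k := 0) (by norm_num)
  have h2 : MemLp (ft p₁) 2 volume := hp₁.memLp_ft (k := 0) (by norm_num)
  rw [← toE_const_mul h2, ← toE_add h1 (h2.const_mul θ)]
  congr 1; ext s
  exact ft_add_mul (hp.integrable 0 (by norm_num)) (hp₁.integrable 0 (by norm_num)) θ s

/-- The potential is a holomorphic function of the symbols. -/
theorem differentiableAt_solU (hρ : Good ρ M) (hρ₁ : Good ρ₁ M') (hp : Good p N) (hp₁ : Good p₁ N')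
    {θ₀ : ℂ} {s : ℝ}
    (hu : IsUnit (1 + opK (fun z => ρ z + θ₀ * ρ₁ z) (fun z => p z + θ₀ * p₁ z) s)) :
    DifferentiableAt ℂ (fun θ => solU (fun z => ρ z + θ * ρ₁ z) (fun z => p z + θ * p₁ z) s) θ₀ := by
  have i0 : Integrable p := hp.integrable 0 (by norm_num)
  have i1 : Integrable p₁ := hp₁.integrable 0 (by norm_num)
  have m0 : MemLp p 2 volume := hp.memLp 0 (by norm_num)
  have m1 : MemLp p₁ 2 volume := hp₁.memLp 0 (by norm_num)
  have g1 : ∀ θ : ℂ, Gam (fun z => ρ z + θ * ρ₁ z) = Gam ρ + θ • Gam ρ₁ := fun θ =>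
    Gam_add_mul hρ.memLp_top hρ₁.memLp_top θ
  have g2 : ∀ θ : ℂ, Gam (fun z => p z + θ * p₁ z) = Gam p + θ • Gam p₁ := fun θ =>
    Gam_add_mul hp.memLp_top hp₁.memLp_top θ
  have D1 : DifferentiableAt ℂ (fun θ => opK (fun z => ρ z + θ * ρ₁ z) (fun z => p z + θ * p₁ z) s)
      θ₀ := by
    simp only [opK, g1, g2]
    fun_prop
  have D2 : DifferentiableAt ℂ (fun θ => res (fun z => ρ z + θ * ρ₁ z) (fun z => p z + θ * p₁ z) s)
      θ₀ := by
    obtain ⟨v, hv⟩ := hu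
    have h1 := (hasFDerivAt_ringInverse (𝕜 := ℂ) v).differentiableAt
    rw [hv] at h1
    exact h1.comp θ₀ (D1.const_add 1)
  have D3 : DifferentiableAt ℂ (fun θ => src (fun z => ρ z + θ * ρ₁ z) (fun z => p z + θ * p₁ z) s)
      θ₀ := by
    simp only [src, g1, hp.toE_ft_add_mul hp₁]
    fun_prop
  have D4 : DifferentiableAt ℂ (fun θ : ℂ => wv (fun z => p z + θ * p₁ z) 0 s) θ₀ := by
    simp only [wv, Function.iterate_zero, id,
      vec_add_mul m0 m1]
    fun_prop
  simp only [solU, solA, ft_add_mul i0 i1]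
  have D5 := (D2.clm_apply D3).neg
  have D6 := ((pair.differentiableAt.comp θ₀ D4).clm_apply D5)
  exact DifferentiableAt.add (by fun_prop) D6

end

/-! ### Lipschitz dependence by the Schwarz lemma -/

section

variable {N : ℝ}

theorem contDiff_bracket : ContDiff ℝ ∞ fun x => (bracket x : ℂ) :=
  Complex.ofRealCLM.contDiff.comp
    (ContDiff.sqrt (by fun_prop) fun x => (by positivity : (1 + x ^ 2 : ℝ) ≠ 0))

theorem eLpNorm_le_of_bracket {f : ℝ → ℂ} {C : ℝ}
    (h : eLpNorm (fun s => (bracket s : ℂ) * f s) 2 volume ≤ ENNReal.ofReal C) :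
    eLpNorm f 2 volume ≤ ENNReal.ofReal C := by
  refine (eLpNorm_le_ofReal_mul zero_le_one h (Eventually.of_forall fun x => ?_)).trans_eq
    (by rw [one_mul])
  rw [one_mul, norm_mul, Complex.norm_real, Real.norm_of_nonneg (bracket_pos x).le]
  exact le_mul_of_one_le_left (norm_nonneg _) (one_le_bracket x)

theorem InX.add_mul {r r' q q' : ℝ → ℂ} {d : ℝ} (hr : InX r r' N) (hq : InX q q' d) (θ : ℂ) :
    InX (fun z => r z + θ * q z) (fun z => r' z + θ * q' z) (N + ‖θ‖ * d) := by
  have hd := hq.nonneg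
  have hc : Continuous fun z => ((bracket z ^ 3 : ℝ) : ℂ) := by fun_prop
  refine ⟨hr.prim.add (hq.prim.const_mul θ), add_nonneg hr.nonneg (by positivity), ?_, ?_⟩
  · have h1 : eLpNorm (fun z => θ * (((bracket z ^ 3 : ℝ) : ℂ) * q z)) 2 volume ≤
        ENNReal.ofReal (‖θ‖ * d) := eLpNorm_le_ofReal_mul (norm_nonneg _) hq.weight
      (Eventually.of_forall fun z => (norm_mul _ _).le)
    have h2 := eLpNorm_add_le_ofReal (f := fun z => ((bracket z ^ 3 : ℝ) : ℂ) * r z)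
      (g := fun z => θ * (((bracket z ^ 3 : ℝ) : ℂ) * q z)) hr.nonneg (by positivity)
      (hc.mul hr.prim.continuous).aestronglyMeasurable
      ((hc.mul hq.prim.continuous).const_smul θ).aestronglyMeasurable hr.weight h1
    refine le_of_eq_of_le (congrArg (fun f => eLpNorm f 2 volume) (funext fun z => ?_)) h2
    ring
  · have h1 : eLpNorm (fun z => θ * ((bracket z : ℂ) * q' z)) 2 volume ≤
        ENNReal.ofReal (‖θ‖ * d) := eLpNorm_le_ofReal_mul (norm_nonneg _) hq.weight_deriv
      (Eventually.of_forall fun z => (norm_mul _ _).le)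
    have h2 := eLpNorm_add_le_ofReal hr.nonneg (by positivity) hr.meas_bracket_deriv
      (hq.meas_bracket_deriv.const_mul θ) hr.weight_deriv h1
    refine le_of_eq_of_le (congrArg (fun f => eLpNorm f 2 volume) (funext fun z => ?_)) h2
    ring

namespace InY

variable {u u₁ u₂ u₃ v v₁ v₂ v₃ : ℝ → ℂ} {C D : ℝ}

theorem mono (h : InY u u₁ u₂ u₃ C) (hCD : C ≤ D) : InY u u₁ u₂ u₃ D := by
  have := ENNReal.ofReal_le_ofReal hCD
  exact ⟨h.prim₁, h.prim₂, h.prim₃, h.norm.trans this, h.norm₁.trans this, h.norm₂.trans this,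
    h.norm₃.trans this⟩

theorem zero : InY (fun _ => 0) (fun _ => 0) (fun _ => 0) (fun _ => 0) 0 := by
  have h : IsPrim (fun _ => 0) (fun _ => 0) :=
    IsPrim.of_hasDerivAt (fun x => hasDerivAt_const x 0) continuous_const
  constructor <;> first | exact h | simp

theorem norm_le (h : InY u u₁ u₂ u₃ C) (hC : 0 ≤ C) (x : ℝ) : ‖u x‖ ≤ C + C :=
  h.prim₁.norm_le hC hC (eLpNorm_le_of_bracket h.norm) (eLpNorm_le_of_bracket h.norm₁) x

theorem neg (h : InY u u₁ u₂ u₃ C) :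
    InY (fun x => -u x) (fun x => -u₁ x) (fun x => -u₂ x) (fun x => -u₃ x) C := by
  refine ⟨by simpa using h.prim₁.const_mul (-1), by simpa using h.prim₂.const_mul (-1),
    by simpa using h.prim₃.const_mul (-1), ?_, ?_, ?_, ?_⟩
  · exact le_of_eq_of_le (eLpNorm_congr_norm_ae (Eventually.of_forall fun z => by simp)) h.norm
  · exact le_of_eq_of_le (eLpNorm_congr_norm_ae (Eventually.of_forall fun z => by simp)) h.norm₁
  · exact le_of_eq_of_le (eLpNorm_congr_norm_ae (Eventually.of_forall fun z => by simp)) h.norm₂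
  · exact le_of_eq_of_le (eLpNorm_congr_norm_ae (Eventually.of_forall fun z => by simp)) h.norm₃

theorem add (h : InY u u₁ u₂ u₃ C) (h' : InY v v₁ v₂ v₃ D) (hC : 0 ≤ C) (hD : 0 ≤ D) :
    InY (fun x => u x + v x) (fun x => u₁ x + v₁ x) (fun x => u₂ x + v₂ x) (fun x => u₃ x + v₃ x)
      (C + D) := by
  have hb : Continuous fun s => (bracket s : ℂ) := by fun_prop
  refine ⟨h.prim₁.add h'.prim₁, h.prim₂.add h'.prim₂, h.prim₃.add h'.prim₃, ?_, ?_, ?_, ?_⟩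
  · simp only [mul_add]
    exact eLpNorm_add_le_ofReal hC hD (hb.mul h.prim₁.continuous).aestronglyMeasurable
      (hb.mul h'.prim₁.continuous).aestronglyMeasurable h.norm h'.norm
  · simp only [mul_add]
    exact eLpNorm_add_le_ofReal hC hD (hb.mul h.prim₂.continuous).aestronglyMeasurable
      (hb.mul h'.prim₂.continuous).aestronglyMeasurable h.norm₁ h'.norm₁
  · exact eLpNorm_add_le_ofReal hC hD h.prim₃.continuous.aestronglyMeasurable
      h'.prim₃.continuous.aestronglyMeasurable h.norm₂ h'.norm₂
  · exact eLpNorm_add_le_ofReal hC hD h.prim₃.loc.aestronglyMeasurable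
      h'.prim₃.loc.aestronglyMeasurable h.norm₃ h'.norm₃

theorem comp_neg (h : InY u u₁ u₂ u₃ C) :
    InY (fun x => u (-x)) (fun x => -u₁ (-x)) (fun x => u₂ (-x)) (fun x => -u₃ (-x)) C := by
  refine ⟨h.prim₁.comp_neg, by simpa using h.prim₂.comp_neg.const_mul (-1), h.prim₃.comp_neg,
    ?_, ?_, ?_, ?_⟩
  · refine le_of_eq_of_le (eLpNorm_congr_norm_ae (Eventually.of_forall fun z => ?_))
      ((eLpNorm_comp_neg _).trans_le h.norm)
    simp [bracket_neg]
  · refine le_of_eq_of_le (eLpNorm_congr_norm_ae (Eventually.of_forall fun z => ?_))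
      ((eLpNorm_comp_neg _).trans_le h.norm₁)
    simp [bracket_neg]
  · exact (eLpNorm_comp_neg _).trans_le h.norm₂
  · refine le_of_eq_of_le (eLpNorm_congr_norm_ae (Eventually.of_forall fun z => ?_))
      ((eLpNorm_comp_neg _).trans_le h.norm₃)
    simp

/-- The Schwarz lemma for holomorphic families of functions in the space of the potentials. -/
theorem sub_of_differentiableOn {u u₁ u₂ u₃ : ℂ → ℝ → ℂ} {R : ℝ} (hR : 1 < R) (hC : 0 ≤ C)
    (h : ∀ θ ∈ Metric.ball (0 : ℂ) R, InY (u θ) (u₁ θ) (u₂ θ) (u₃ θ) C)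
    (hd : ∀ x, DifferentiableOn ℂ (fun θ => u θ x) (Metric.ball 0 R)) :
    InY (fun x => u 1 x - u 0 x) (fun x => u₁ 1 x - u₁ 0 x) (fun x => u₂ 1 x - u₂ 0 x)
      (fun x => u₃ 1 x - u₃ 0 x) (2 * C / R) := by
  have m1 : (1 : ℂ) ∈ Metric.ball (0 : ℂ) R := by simpa using hR
  have m0 : (0 : ℂ) ∈ Metric.ball (0 : ℂ) R := Metric.mem_ball_self (by linarith)
  -- Tested against `ψ`, a derivative in `x` becomes a derivative of `ψ`. Weak holomorphy in the
  -- parameter therefore passes to all three derivatives without any pointwise control of them.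
  have step : ∀ {f g : ℂ → ℝ → ℂ}, (∀ θ ∈ Metric.ball (0 : ℂ) R, IsPrim (f θ) (g θ)) →
      (∀ ψ : ℝ → ℂ, ContDiff ℝ ∞ ψ → HasCompactSupport ψ →
        DifferentiableOn ℂ (fun θ => ∫ x, f θ x * ψ x) (Metric.ball 0 R)) →
      ∀ ψ : ℝ → ℂ, ContDiff ℝ ∞ ψ → HasCompactSupport ψ →
        DifferentiableOn ℂ (fun θ => ∫ x, g θ x * ψ x) (Metric.ball 0 R) := by
    intro f g hP hf ψ hψ hs
    refine ((hf (deriv ψ) (hψ.iterate_deriv 1) hs.deriv).neg).congr fun θ hθ => ?_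
    rw [Pi.neg_apply, (hP θ hθ).hasWeakDeriv.integral_eq ψ hψ hs, neg_neg]
  have wt : ∀ {f : ℂ → ℝ → ℂ}, (∀ ψ : ℝ → ℂ, ContDiff ℝ ∞ ψ → HasCompactSupport ψ →
        DifferentiableOn ℂ (fun θ => ∫ x, f θ x * ψ x) (Metric.ball 0 R)) →
      ∀ ψ : ℝ → ℂ, ContDiff ℝ ∞ ψ → HasCompactSupport ψ →
        DifferentiableOn ℂ (fun θ => ∫ x, ((bracket x : ℂ) * f θ x) * ψ x) (Metric.ball 0 R) := by
    intro f hf ψ hψ hs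
    refine (hf (fun x => bracket x * ψ x) (contDiff_bracket.mul hψ) hs.mul_left).congr fun θ hθ => ?_
    congr 1; ext x; ring
  have d0 : ∀ ψ : ℝ → ℂ, ContDiff ℝ ∞ ψ → HasCompactSupport ψ →
      DifferentiableOn ℂ (fun θ => ∫ x, u θ x * ψ x) (Metric.ball 0 R) := fun ψ hψ hs =>
    differentiableOn_integral_mul Metric.isOpen_ball hd (fun θ hθ => (h θ hθ).prim₁.continuous)
      (fun θ hθ => (h θ hθ).norm_le hC) hψ.continuous hs
  have d1 := step (fun θ hθ => (h θ hθ).prim₁) d0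
  have d2 := step (fun θ hθ => (h θ hθ).prim₂) d1
  have d3 := step (fun θ hθ => (h θ hθ).prim₃) d2
  have hb : Continuous fun s => (bracket s : ℂ) := by fun_prop
  refine ⟨(h 1 m1).prim₁.sub (h 0 m0).prim₁, (h 1 m1).prim₂.sub (h 0 m0).prim₂,
    (h 1 m1).prim₃.sub (h 0 m0).prim₃, ?_, ?_, ?_, ?_⟩
  · simp only [mul_sub]
    exact eLpNorm_sub_le_of_weak (h := fun θ x => bracket x * u θ x) hR hC
      (fun θ hθ => (hb.mul (h θ hθ).prim₁.continuous).aestronglyMeasurable)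
      (fun θ hθ => (h θ hθ).norm) (wt d0)
  · simp only [mul_sub]
    exact eLpNorm_sub_le_of_weak (h := fun θ x => bracket x * u₁ θ x) hR hC
      (fun θ hθ => (hb.mul (h θ hθ).prim₂.continuous).aestronglyMeasurable)
      (fun θ hθ => (h θ hθ).norm₁) (wt d1)
  · exact eLpNorm_sub_le_of_weak hR hC (fun θ hθ => (h θ hθ).prim₃.continuous.aestronglyMeasurable)
      (fun θ hθ => (h θ hθ).norm₂) d2
  · exact eLpNorm_sub_le_of_weak hR hC (fun θ hθ => (h θ hθ).prim₃.loc.aestronglyMeasurable)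
      (fun θ hθ => (h θ hθ).norm₃) d3

end InY

/-- The potential is a Lipschitz continuous function of the symbols. -/
theorem exists_inY_sub {δ : ℝ} (hδ0 : 0 ≤ δ) (hδ1 : δ < 1) (hN : 0 ≤ N) :
    ∃ C, 0 ≤ C ∧ ∀ (r r' p p' s s' q q' : ℝ → ℂ) (d : ℝ), InX r r' N → InX p p' N →
      InX s s' N → InX q q' N → (∀ z, ‖r z‖ ≤ δ) → (∀ z, ‖p z‖ ≤ δ) → (∀ z, ‖s z‖ ≤ δ) →
      (∀ z, ‖q z‖ ≤ δ) → InX (fun z => r z - s z) (fun z => r' z - s' z) d →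
      InX (fun z => p z - q z) (fun z => p' z - q' z) d →
      ∃ u₁ u₂ u₃, InY (fun x => pot r p x - pot s q x) u₁ u₂ u₃ (C * d) := by
  -- The room between `δ` and `(1 + δ)/2`, and between `N` and `N + 1`, allows the symbols to move
  -- along a complex line.
  obtain ⟨C, hC, h⟩ := exists_inY (δ := (1 + δ) / 2) (N := N + 1) (by linarith) (by linarith)
    (by linarith)
  have hδ : 0 < 1 - δ := by linarith
  refine ⟨8 * C / (1 - δ), by positivity, ?_⟩
  intro r r' p p' s s' q q' d hr hp hs hq hrδ hpδ hsδ hqδ hrs hpq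
  have hδ' : δ ≤ (1 + δ) / 2 := by linarith
  -- If `d = 0` the symbols coincide; this case is separate because the radius below divides by `d`.
  rcases hrs.nonneg.eq_or_lt with rfl | hd
  · have e1 : r = s := funext fun z => sub_eq_zero.1 (norm_le_zero_iff.1 (by simpa using hrs.norm_le z))
    have e2 : p = q := funext fun z => sub_eq_zero.1 (norm_le_zero_iff.1 (by simpa using hpq.norm_le z))
    simp only [e1, e2, sub_self, mul_zero]
    exact ⟨_, _, _, InY.zero⟩
  -- The difference of the symbols is at most `2d` pointwise, so for `|θ| < R` the modulus stays
  -- below `δ + 2dR = (1 + δ)/2`, and the norm below `N + dR ≤ N + 1`.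
  set R := (1 - δ) / (4 * d) with hR
  have hRd : R * d = (1 - δ) / 4 := by rw [hR]; field_simp
  -- If `R ≤ 1` then `d` is at least `(1 - δ)/4`, and the triangle inequality suffices. Otherwise
  -- the parameter `1` lies inside the disc and the Schwarz lemma applies.
  rcases le_or_gt R 1 with hR1 | hR1
  · obtain ⟨u₁, u₂, u₃, h1⟩ := h r r' p p' (hr.mono (by linarith)) (hp.mono (by linarith))
      (fun z => (hrδ z).trans hδ') fun z => (hpδ z).trans hδ'
    obtain ⟨v₁, v₂, v₃, h2⟩ := h s s' q q' (hs.mono (by linarith)) (hq.mono (by linarith))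
      (fun z => (hsδ z).trans hδ') fun z => (hqδ z).trans hδ'
    refine ⟨_, _, _, ((h1.add h2.neg hC hC).mono (D := 8 * C / (1 - δ) * d) ?_ : InY _ _ _ _ _)⟩
    have h3 : (1 - δ) / 4 ≤ d := by nlinarith
    rw [div_mul_eq_mul_div, le_div_iff₀ hδ]
    nlinarith
  · have mem : ∀ {a b : ℝ → ℂ}, (∀ z, ‖b z‖ ≤ δ) → (∀ z, ‖a z - b z‖ ≤ 2 * d) →
        ∀ θ ∈ Metric.ball (0 : ℂ) R, ∀ z, ‖b z + θ * (a z - b z)‖ ≤ (1 + δ) / 2 := by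
      intro a b hb hab θ hθ z
      rw [mem_ball_zero_iff] at hθ
      refine (norm_add_le_of (hb z) (norm_mul_le_of hθ.le (hab z))).trans ?_
      nlinarith
    have hx : ∀ {a a' b b' : ℝ → ℂ}, InX b b' N → InX (fun z => a z - b z) (fun z => a' z - b' z) d →
        ∀ θ ∈ Metric.ball (0 : ℂ) R, InX (fun z => b z + θ * (a z - b z))
          (fun z => b' z + θ * (a' z - b' z)) (N + 1) := by
      intro a a' b b' hb hab θ hθ
      rw [mem_ball_zero_iff] at hθ
      refine (hb.add_mul hab θ).mono ?_
      nlinarith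
    have hY : ∀ θ : ℂ, ∃ u₁ u₂ u₃, θ ∈ Metric.ball (0 : ℂ) R →
        InY (pot (fun z => s z + θ * (r z - s z)) fun z => q z + θ * (p z - q z)) u₁ u₂ u₃ C := by
      intro θ
      by_cases hθ : θ ∈ Metric.ball (0 : ℂ) R
      · obtain ⟨u₁, u₂, u₃, h1⟩ := h _ _ _ _ (hx hs hrs θ hθ) (hx hq hpq θ hθ)
          (mem hsδ hrs.norm_le θ hθ) (mem hqδ hpq.norm_le θ hθ)
        exact ⟨u₁, u₂, u₃, fun _ => h1⟩
      · exact ⟨0, 0, 0, fun h' => absurd h' hθ⟩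
    choose u₁ u₂ u₃ hu using hY
    have key := InY.sub_of_differentiableOn hR1 hC hu fun x θ hθ => by
      have hu := (isUnit_opK_of_bound (hx hs hrs θ hθ).reflect.good (hx hq hpq θ hθ).good
        (by linarith) (fun z => mem hsδ hrs.norm_le θ hθ (-z)) (mem hqδ hpq.norm_le θ hθ)
        (scl * x)).1
      exact ((differentiableAt_solU hs.reflect.good hrs.reflect.good hq.good hpq.good hu).const_mul
        _).differentiableWithinAt
    refine ⟨u₁ 1 - u₁ 0, u₂ 1 - u₂ 0, u₃ 1 - u₃ 0, ?_⟩
    have e : 2 * C / R = 8 * C / (1 - δ) * d := by rw [hR]; field_simp; ring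
    rw [e] at key
    simpa using! key

end

section

variable {N σ δ x : ℝ} {r r' p p' : ℝ → ℂ}

/-! ### The function spaces in terms of primitives -/

theorem normL2w_nonneg (s : ℕ) (f : ℝ → ℂ) : 0 ≤ normL2w s f := ENNReal.toReal_nonneg

theorem normX_nonneg (r : ℝ → ℂ) : 0 ≤ normX r :=
  add_nonneg (add_nonneg (normL2w_nonneg _ _) (normL2w_nonneg _ _)) (normL2w_nonneg _ _)

theorem MemL2w.congr_ae {s : ℕ} {f g : ℝ → ℂ} (h : MemL2w s f) (hfg : f =ᵐ[volume] g) :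
    MemL2w s g :=
  h.ae_eq (hfg.mono fun x hx => by simp only [hx])

theorem normL2w_congr_ae {s : ℕ} {f g : ℝ → ℂ} (hfg : f =ᵐ[volume] g) :
    normL2w s f = normL2w s g :=
  congrArg ENNReal.toReal (eLpNorm_congr_ae (hfg.mono fun x hx => by simp only [hx]))

theorem IsPrim.inX (h : IsPrim r r') (h3 : MemL2w 3 r) (h1 : MemL2w 1 r') :
    InX r r' (normX r) := by
  have e : normX r = normL2w 1 r + normL2w 1 r' + normL2w 3 r := by
    rw [normX, normH11, normL2w_congr_ae h.hasWeakDeriv.weakDeriv_ae_eq]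
  have n1 := normL2w_nonneg 1 r
  have n2 := normL2w_nonneg 1 r'
  have n3 := normL2w_nonneg 3 r
  refine ⟨h, normX_nonneg r, ?_, ?_⟩
  · rw [← ENNReal.ofReal_toReal h3.eLpNorm_ne_top]
    exact ENNReal.ofReal_le_ofReal (by rw [e]; change normL2w 3 r ≤ _; linarith)
  · have h2 : normL2w 1 r' ≤ normX r := by rw [e]; linarith
    have h4 := ENNReal.ofReal_le_ofReal h2
    rw [normL2w, ENNReal.ofReal_toReal h1.eLpNorm_ne_top] at h4
    simpa only [pow_one] using h4

theorem IsReflection.isPrim (h : IsReflection r) : IsPrim r (weakDeriv r) :=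
  h.memX.1.hasWeakDeriv.isPrim h.continuous

theorem IsReflection.inX (h : IsReflection r) : InX r (weakDeriv r) (normX r) :=
  h.isPrim.inX h.memX.2 h.memX.1.memL2w_deriv

theorem MemL2w.sub {s : ℕ} {f g : ℝ → ℂ} (hf : MemL2w s f) (hg : MemL2w s g) :
    MemL2w s fun x => f x - g x := by
  have h := MemLp.sub hf hg
  refine h.ae_eq (Eventually.of_forall fun x => ?_)
  simp [mul_sub]

theorem IsReflection.inX_sub (h : IsReflection r) (h' : IsReflection p) :
    InX (fun z => r z - p z) (fun z => weakDeriv r z - weakDeriv p z) (normX (r - p)) :=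
  (h.isPrim.sub h'.isPrim).inX (h.memX.2.sub h'.memX.2)
    (h.memX.1.memL2w_deriv.sub h'.memX.1.memL2w_deriv)

/-- A reflection coefficient is bounded away from `1` in modulus. -/
theorem IsReflection.exists_bound (h : IsReflection r) : ∃ δ, 0 ≤ δ ∧ δ < 1 ∧ ∀ z, ‖r z‖ ≤ δ := by
  have hX := h.inX
  have hN := hX.nonneg
  -- Since `|z r(z)| ≤ 3 ‖r‖`, the modulus is at most `1/2` for `|z| > A`. On the remaining compact
  -- interval the maximum is attained and is less than one.
  set A := 6 * normX r + 1
  obtain ⟨z₀, -, hz₀⟩ := (isCompact_Icc (a := -A) (b := A)).exists_isMaxOn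
    ⟨0, by constructor <;> simp only [A] <;> linarith⟩ h.continuous.norm.continuousOn
  refine ⟨max (1 / 2) ‖r z₀‖, by positivity, max_lt (by norm_num) (h.norm_lt_one z₀), fun z => ?_⟩
  by_cases hz : |z| ≤ A
  · exact (hz₀ (abs_le.1 hz)).trans (le_max_right _ _)
  · refine le_trans ?_ (le_max_left _ _)
    have h1 := hX.norm_mul_le z
    rw [norm_mul, Complex.norm_real, Real.norm_eq_abs] at h1
    have h2 : 6 * normX r + 1 < |z| := not_le.1 hz
    by_contra! h3
    nlinarith

/-- The chosen weak derivatives agree almost everywhere with the given ones. The factor `6` counts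
the four norms in `H³` and the two in `H^{1,1}`. -/
theorem InY.memY {u u₁ u₂ u₃ : ℝ → ℂ} {C : ℝ} (h : InY u u₁ u₂ u₃ C) (hC : 0 ≤ C) :
    MemY u ∧ normY u ≤ 6 * C := by
  have a1 : weakDeriv u =ᵐ[volume] u₁ := h.prim₁.hasWeakDeriv.weakDeriv_ae_eq
  have w1 : HasWeakDeriv (weakDeriv u) u₂ :=
    h.prim₂.hasWeakDeriv.congr_ae a1.symm (EventuallyEq.refl _ _)
  have a2 : weakDeriv (weakDeriv u) =ᵐ[volume] u₂ := w1.weakDeriv_ae_eq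
  have w2 : HasWeakDeriv (weakDeriv (weakDeriv u)) u₃ :=
    h.prim₃.hasWeakDeriv.congr_ae a2.symm (EventuallyEq.refl _ _)
  have a3 : weakDeriv (weakDeriv (weakDeriv u)) =ᵐ[volume] u₃ := w2.weakDeriv_ae_eq
  have k : ∀ {s : ℕ} {f g : ℝ → ℂ}, f =ᵐ[volume] g → AEStronglyMeasurable g volume →
      eLpNorm (fun x => ((bracket x ^ s : ℝ) : ℂ) * g x) 2 volume ≤ ENNReal.ofReal C →
      MemL2w s f ∧ normL2w s f ≤ C := fun {s f g} hfg hm hg => by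
    have hc : Continuous fun x => ((bracket x ^ s : ℝ) : ℂ) := by fun_prop
    have h1 : MemL2w s g := memLp_of_eLpNorm_le (hc.aestronglyMeasurable.mul hm) hg
    refine ⟨h1.congr_ae hfg.symm, ?_⟩
    rw [normL2w_congr_ae hfg]
    exact ENNReal.toReal_le_of_le_ofReal hC hg
  have m0 := h.prim₁.continuous.aestronglyMeasurable (μ := volume)
  have m1 := h.prim₂.continuous.aestronglyMeasurable (μ := volume)
  have m2 := h.prim₃.continuous.aestronglyMeasurable (μ := volume)
  have z0 := k (s := 0) (EventuallyEq.refl _ u) m0 (by simpa using eLpNorm_le_of_bracket h.norm)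
  have z1 := k (s := 0) a1 m1 (by simpa using eLpNorm_le_of_bracket h.norm₁)
  have z2 := k (s := 0) a2 m2 (by simpa using h.norm₂)
  have z3 := k (s := 0) a3 h.prim₃.loc.aestronglyMeasurable (by simpa using h.norm₃)
  have o0 := k (s := 1) (EventuallyEq.refl _ u) m0 (by simpa using h.norm)
  have o1 := k (s := 1) a1 m1 (by simpa using h.norm₁)
  have hw := h.prim₁.hasWeakDeriv.hasWeakDeriv_weakDeriv
  refine ⟨⟨⟨fun j hj => ?_, fun j hj => ?_⟩, ⟨hw, o0.1, o1.1⟩⟩, ?_⟩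
  · interval_cases j
    exacts [hw, w1.hasWeakDeriv_weakDeriv, w2.hasWeakDeriv_weakDeriv]
  · interval_cases j
    exacts [z0.1, z1.1, z2.1, z3.1]
  · rw [normY, normH, normH11]
    simp only [Finset.sum_range_succ, Finset.sum_range_zero, Function.iterate_succ_apply',
      Function.iterate_zero, id, zero_add]
    linarith [z0.2, z1.2, z2.2, z3.2, o0.2, o1.2]

/-! ### The reconstruction formulas -/

/-- The constants match because `2i · i/(2π) = -1/π = scl`, and `s = scl · x` inverts `x = -πs`. -/
theorem IsRHSolution.tendsto_pot {Mt : ℂ → Matrix (Fin 2) (Fin 2) ℂ} (hM : IsRHSolution 1 r p x Mt)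
    (hr : InX r r' N) (hp : InX p p' N) (hδ1 : δ < 1) (hrδ : ∀ z, ‖r z‖ ≤ δ)
    (hpδ : ∀ z, ‖p z‖ ≤ δ) :
    Tendsto (fun z => 2 * Complex.I * (z * Mt z 0 1)) atInfinity (𝓝 (pot r p x)) := by
  have hpi : (Real.pi : ℂ) ≠ 0 := by exact_mod_cast Real.pi_ne_zero
  have hx : -(Real.pi * (scl * x)) = x := by
    rw [scl]; field_simp
  have h1 := (tendsto_of_isRHSolution (s := scl * x) (Mt := Mt) hr hp
    (isUnit_opK_of_bound hr.reflect.good hp.good hδ1 (fun z => hrδ _) hpδ _).1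
    (isUnit_opK_of_bound hp.good_neg hr.reflect.good_neg hδ1
      (fun z => (norm_neg _).trans_le (hpδ z)) (fun z => (norm_neg _).trans_le (hrδ _)) _).1
    (by rwa [hx])).const_mul (2 * Complex.I)
  have e : 2 * Complex.I * (Complex.I / (2 * Real.pi) * solU (fun z => r (-z)) p (scl * x)) =
      pot r p x := by
    rw [pot, scl]
    push_cast
    field_simp
    rw [Complex.I_sq]
    ring
  rwa [e] at h1

/-- The inversion `z ↦ -z` carries the entry `M₂₁` to the entry `M₁₂` of the problem with exchanged
coefficients. The factor `z` in the limit changes sign, hence `-σ`. -/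
theorem IsRHSolution.tendsto_pot_reflect {Mt : ℂ → Matrix (Fin 2) (Fin 2) ℂ}
    (hM : IsRHSolution 1 r p x Mt)
    (hr : InX r r' N) (hp : InX p p' N) (hδ1 : δ < 1) (hrδ : ∀ z, ‖r z‖ ≤ δ)
    (hpδ : ∀ z, ‖p z‖ ≤ δ) (σ : ℝ) :
    Tendsto (fun z => 2 * Complex.I * σ * (z * Mt z 1 0)) atInfinity
      (𝓝 (-σ * pot (fun z => -p (-z)) (fun z => -r (-z)) x)) := by
  have h1 := ((hM.reflect.tendsto_pot hp.reflect.neg hr.reflect.neg hδ1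
    (fun z => (norm_neg _).trans_le (hpδ _)) fun z => (norm_neg _).trans_le (hrδ _)).comp
    tendsto_neg_atInfinity).const_mul (-σ : ℂ)
  refine h1.congr fun z => ?_
  simp
  ring

theorem exists_solution (hr : InX r r' N) (hp : InX p p' N) (hδ1 : δ < 1) (hrδ : ∀ z, ‖r z‖ ≤ δ)
    (hpδ : ∀ z, ‖p z‖ ≤ δ) (x : ℝ) : ∃ Mt, IsRHSolution 1 r p x Mt := by
  obtain ⟨Mt, h1, -⟩ := exists_isRHSolution (s := scl * x) hr.reflect.good hp.good hp.good_neg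
    hr.reflect.good_neg (isUnit_opK_of_bound hr.reflect.good hp.good hδ1 (fun z => hrδ _) hpδ _).1
    (isUnit_opK_of_bound hp.good_neg hr.reflect.good_neg hδ1
      (fun z => (norm_neg _).trans_le (hpδ z)) (fun z => (norm_neg _).trans_le (hrδ _)) _).1
  have hx : -(Real.pi * (scl * x)) = x := by
    rw [scl]; field_simp
  rw [hx] at h1
  exact ⟨Mt, h1.congr (fun z => by rw [neg_neg]) fun z => rfl⟩

theorem InX.const_mul (h : InX r r' N) {c : ℂ} (hc : ‖c‖ = 1) :
    InX (fun z => c * r z) (fun z => c * r' z) N := by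
  refine ⟨h.prim.const_mul c, h.nonneg, ?_, ?_⟩
  · refine le_of_eq_of_le (eLpNorm_congr_norm_ae (Eventually.of_forall fun z => ?_)) h.weight
    simp [hc]
  · refine le_of_eq_of_le (eLpNorm_congr_norm_ae (Eventually.of_forall fun z => ?_)) h.weight_deriv
    simp [hc]

/-- The potential given by the second reconstruction formula. -/
def potW (σ : ℝ) (r p : ℝ → ℂ) (y : ℝ) : ℂ :=
  -σ * pot (fun z => -p (-z)) (fun z => -r (-z)) (-y)

theorem isReconstruction_pot (hσ : ‖(σ : ℂ)‖ = 1) (hr : InX r r' N) (hp : InX p p' N) (hδ1 : δ < 1)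
    (hrδ : ∀ z, ‖r z‖ ≤ δ) (hpδ : ∀ z, ‖p z‖ ≤ δ) :
    IsReconstruction σ r p (pot r fun z => σ * p z) (potW σ r fun z => σ * p z) := fun x => by
  have hpδ' : ∀ z, ‖σ * p z‖ ≤ δ := fun z => by rw [norm_mul, hσ, one_mul]; exact hpδ z
  obtain ⟨Mt, hM⟩ := exists_solution hr (hp.const_mul hσ) hδ1 hrδ hpδ' x
  refine ⟨Mt, isRHSolution_absorb.2 hM, hM.tendsto_pot hr (hp.const_mul hσ) hδ1 hrδ hpδ', ?_⟩
  rw [potW, neg_neg]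
  exact hM.tendsto_pot_reflect hr (hp.const_mul hσ) hδ1 hrδ hpδ' σ

theorem IsReconstruction.eq_pot {u w : ℝ → ℂ} (h : IsReconstruction σ r p u w) (hσ : ‖(σ : ℂ)‖ = 1)
    (hr : InX r r' N) (hp : InX p p' N) (hδ1 : δ < 1)
    (hrδ : ∀ z, ‖r z‖ ≤ δ) (hpδ : ∀ z, ‖p z‖ ≤ δ) :
    u = pot r (fun z => σ * p z) ∧ w = potW σ r fun z => σ * p z := by
  have hpδ' : ∀ z, ‖σ * p z‖ ≤ δ := fun z => by rw [norm_mul, hσ, one_mul]; exact hpδ z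
  refine ⟨funext fun x => ?_, funext fun y => ?_⟩
  · obtain ⟨Mt, hM, h1, -⟩ := h x
    exact tendsto_nhds_unique h1 ((isRHSolution_absorb.1 hM).tendsto_pot hr (hp.const_mul hσ) hδ1
      hrδ hpδ')
  · obtain ⟨Mt, hM, -, h1⟩ := h (-y)
    rw [neg_neg] at h1
    exact tendsto_nhds_unique h1 ((isRHSolution_absorb.1 hM).tendsto_pot_reflect hr
      (hp.const_mul hσ) hδ1 hrδ hpδ' σ)

/-- The base point for deducing the norm bound from the Lipschitz bound. -/
theorem isReconstruction_zero : IsReconstruction σ 0 0 0 0 := fun x => by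
  refine ⟨fun _ => 1, ⟨fun i j => differentiableOn_const _, fun i j => ?_, fun _ => 1, fun _ => 1,
    fun s => ⟨tendsto_const_nhds, tendsto_const_nhds, ?_⟩⟩, ?_, ?_⟩
  · simpa using Asymptotics.isBigO_zero _ _
  · rw [one_mul]
    ext i j
    fin_cases i <;> fin_cases j <;> simp [jump]
  · simp
  · simp

theorem InY.smul_comp_neg {u u₁ u₂ u₃ : ℝ → ℂ} {C : ℝ} (h : InY u u₁ u₂ u₃ C)
    (hσ : σ = 1 ∨ σ = -1) : ∃ v₁ v₂ v₃, InY (fun y => -σ * u (-y)) v₁ v₂ v₃ C := by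
  rcases hσ with rfl | rfl
  · exact ⟨_, _, _, by simpa using h.comp_neg.neg⟩
  · exact ⟨_, _, _, by simpa using h.comp_neg⟩

/-- Both components reduce to the same Lipschitz estimate: `w` is, up to sign and reflection, the
potential of the reflected and exchanged pair, whose norms and moduli are the same. -/
theorem exists_normY_sub_le (hσ : σ = 1 ∨ σ = -1) (hδ0 : 0 ≤ δ) (hδ1 : δ < 1) (hN : 0 ≤ N) :
    ∃ c, ∀ (r r' p p' s s' q q' u w v y : ℝ → ℂ) (d : ℝ), InX r r' N → InX p p' N →
      InX s s' N → InX q q' N → (∀ z, ‖r z‖ ≤ δ) → (∀ z, ‖p z‖ ≤ δ) → (∀ z, ‖s z‖ ≤ δ) →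
      (∀ z, ‖q z‖ ≤ δ) → InX (fun z => r z - s z) (fun z => r' z - s' z) d →
      InX (fun z => p z - q z) (fun z => p' z - q' z) d →
      IsReconstruction σ r p u w → IsReconstruction σ s q v y →
      normY (u - v) ≤ c * d ∧ normY (w - y) ≤ c * d := by
  have hσ1 : ‖(σ : ℂ)‖ = 1 := by rcases hσ with rfl | rfl <;> simp
  obtain ⟨C, hC, h⟩ := exists_inY_sub hδ0 hδ1 hN
  refine ⟨6 * C, ?_⟩
  intro r r' p p' s s' q q' u w v y d hr hp hs hq hrδ hpδ hsδ hqδ hrs hpq hu hv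
  have hd := hrs.nonneg
  have hσδ : ∀ {a : ℝ → ℂ}, (∀ z, ‖a z‖ ≤ δ) → ∀ z, ‖σ * a z‖ ≤ δ := fun ha z => by
    rw [norm_mul, hσ1, one_mul]; exact ha z
  have hnδ : ∀ {a : ℝ → ℂ}, (∀ z, ‖a z‖ ≤ δ) → ∀ z, ‖-a (-z)‖ ≤ δ := fun ha z =>
    (norm_neg _).trans_le (ha _)
  obtain ⟨rfl, rfl⟩ := hu.eq_pot hσ1 hr hp hδ1 hrδ hpδ
  obtain ⟨rfl, rfl⟩ := hv.eq_pot hσ1 hs hq hδ1 hsδ hqδ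
  have hpq' : InX (fun z => σ * p z - σ * q z) (fun z => σ * p' z - σ * q' z) d := by
    simpa only [mul_sub] using hpq.const_mul hσ1
  have hn : ∀ {a a' b b' : ℝ → ℂ}, InX (fun z => a z - b z) (fun z => a' z - b' z) d →
      InX (fun z => -a (-z) - -b (-z)) (fun z => - -a' (-z) - - -b' (-z)) d := fun hab => by
    convert hab.reflect.neg using 2 <;> ring
  obtain ⟨u₁, u₂, u₃, h1⟩ := h r r' _ _ s s' _ _ d hr (hp.const_mul hσ1) hs (hq.const_mul hσ1)
    hrδ (hσδ hpδ) hsδ (hσδ hqδ) hrs hpq'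
  obtain ⟨w₁, w₂, w₃, h2⟩ := h _ _ _ _ _ _ _ _ d (hp.const_mul hσ1).reflect.neg hr.reflect.neg
    (hq.const_mul hσ1).reflect.neg hs.reflect.neg (hnδ (hσδ hpδ)) (hnδ hrδ) (hnδ (hσδ hqδ))
    (hnδ hsδ) (hn hpq') (hn hrs)
  obtain ⟨_, _, _, h3⟩ := h2.smul_comp_neg hσ
  have e : (potW σ r fun z => σ * p z) - (potW σ s fun z => σ * q z) = fun y => -σ *
      (pot (fun z => -(σ * p (-z))) (fun z => -r (-z)) (-y) -
        pot (fun z => -(σ * q (-z))) (fun z => -s (-z)) (-y)) := by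
    ext y
    simp only [Pi.sub_apply, potW, mul_sub]
  rw [e, mul_assoc]
  exact ⟨(h1.memY (by positivity)).2, (h3.memY (by positivity)).2⟩

theorem inX_zero (hN : 0 ≤ N) : InX 0 0 N := by
  refine ⟨IsPrim.of_hasDerivAt (fun x => hasDerivAt_const x 0) continuous_const, hN, ?_, ?_⟩ <;>
    simp

end

end NonlocalMKdV

end

/-! ### The proposition -/

theorem proposition4p1 (σ : ℝ) (hσ : σ = 1 ∨ σ = -1) :
    -- the Riemann–Hilbert problem is uniquely solvable, the potential exists and is unique,
    -- and it lies in the asserted space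
    (∀ r₁ r₂ : ℝ → ℂ, IsReflection r₁ → IsReflection r₂ →
      (∀ x : ℝ, ∃ M : ℂ → Matrix (Fin 2) (Fin 2) ℂ, IsRHSolution σ r₁ r₂ x M ∧
        ∀ M' : ℂ → Matrix (Fin 2) (Fin 2) ℂ, IsRHSolution σ r₁ r₂ x M' →
          ∀ z : ℂ, z.im ≠ 0 → M' z = M z) ∧
      ∃ u w : ℝ → ℂ, IsReconstruction σ r₁ r₂ u w ∧
        (∀ u' w' : ℝ → ℂ, IsReconstruction σ r₁ r₂ u' w' → u' = u ∧ w' = w) ∧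
        MemY u ∧ MemY w) ∧
    -- norm bound and Lipschitz continuity
    (∀ δ ρ : ℝ, δ < 1 → ∃ c : ℝ,
      (∀ r₁ r₂ u w : ℝ → ℂ, IsReflection r₁ → IsReflection r₂ →
        (∀ z, ‖r₁ z‖ ≤ δ) → (∀ z, ‖r₂ z‖ ≤ δ) → normX r₁ ≤ ρ → normX r₂ ≤ ρ →
        IsReconstruction σ r₁ r₂ u w →
          normY u ≤ c * (normX r₁ + normX r₂) ∧
          normY w ≤ c * (normX r₁ + normX r₂)) ∧
      (∀ r₁ r₂ u w s₁ s₂ v y : ℝ → ℂ, IsReflection r₁ → IsReflection r₂ →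
        IsReflection s₁ → IsReflection s₂ →
        (∀ z, ‖r₁ z‖ ≤ δ) → (∀ z, ‖r₂ z‖ ≤ δ) → normX r₁ ≤ ρ → normX r₂ ≤ ρ →
        (∀ z, ‖s₁ z‖ ≤ δ) → (∀ z, ‖s₂ z‖ ≤ δ) → normX s₁ ≤ ρ → normX s₂ ≤ ρ →
        IsReconstruction σ r₁ r₂ u w → IsReconstruction σ s₁ s₂ v y →
          normY (u - v) ≤ c * (normX (r₁ - s₁) + normX (r₂ - s₂)) ∧
          normY (w - y) ≤ c * (normX (r₁ - s₁) + normX (r₂ - s₂)))) := by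
  have hσ1 : ‖(σ : ℂ)‖ = 1 := by rcases hσ with rfl | rfl <;> simp
  refine ⟨fun r₁ r₂ h₁ h₂ => ?_, fun δ ρ hδ => ?_⟩
  -- The qualitative part assumes only `|r_j| < 1` pointwise, so a uniform bound below one is first
  -- extracted for each coefficient.
  · obtain ⟨δ₁, d0, d1, hb₁⟩ := h₁.exists_bound
    obtain ⟨δ₂, -, d2, hb₂⟩ := h₂.exists_bound
    have hδ1 : max δ₁ δ₂ < 1 := max_lt d1 d2
    have hr := h₁.inX.mono (le_max_left (normX r₁) (normX r₂))
    have hp := h₂.inX.mono (le_max_right (normX r₁) (normX r₂))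
    have hrδ := fun z => (hb₁ z).trans (le_max_left δ₁ δ₂)
    have hpδ := fun z => (hb₂ z).trans (le_max_right δ₁ δ₂)
    have hpδ' : ∀ z, ‖σ * r₂ z‖ ≤ max δ₁ δ₂ := fun z => by rw [norm_mul, hσ1, one_mul]; exact hpδ z
    obtain ⟨C, hC, h⟩ := exists_inY (d0.trans (le_max_left δ₁ δ₂)) hδ1 hr.nonneg
    obtain ⟨u₁, u₂, u₃, hu⟩ := h _ _ _ _ hr (hp.const_mul hσ1) hrδ hpδ'
    obtain ⟨w₁, w₂, w₃, hw⟩ := h _ _ _ _ (hp.const_mul hσ1).reflect.neg hr.reflect.neg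
      (fun z => (norm_neg _).trans_le (hpδ' _)) fun z => (norm_neg _).trans_le (hrδ _)
    obtain ⟨_, _, _, hw'⟩ := hw.smul_comp_neg hσ
    refine ⟨fun x => ?_, _, _, isReconstruction_pot hσ1 hr hp hδ1 hrδ hpδ,
      fun u' w' h' => h'.eq_pot hσ1 hr hp hδ1 hrδ hpδ, (hu.memY hC).1, (hw'.memY hC).1⟩
    obtain ⟨Mt, hM, -⟩ := isReconstruction_pot hσ1 hr hp hδ1 hrδ hpδ x
    exact ⟨Mt, hM, fun M' hM' z hz => hM.unique hM' hz⟩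
  -- The numbers `δ` and `ρ` may be negative, so they are replaced by their positive parts.
  · obtain ⟨c, hc⟩ := exists_normY_sub_le (N := max ρ 0) hσ (le_max_right δ 0)
      (max_lt hδ one_pos) (le_max_right ρ 0)
    have hδ' := le_max_left δ 0
    have hρ' := le_max_left ρ 0
    refine ⟨c, fun r₁ r₂ u w h₁ h₂ b₁ b₂ n₁ n₂ hu => ?_,
      fun r₁ r₂ u w s₁ s₂ v y h₁ h₂ k₁ k₂ b₁ b₂ n₁ n₂ e₁ e₂ m₁ m₂ hu hv => ?_⟩
    -- The norm bound is the Lipschitz bound against the zero coefficients, whose potentials vanish.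
    · have hz : ∀ z, ‖(0 : ℝ → ℂ) z‖ ≤ max δ 0 := fun z => by simp
      have := hc r₁ _ r₂ _ 0 0 0 0 u w 0 0 (normX r₁ + normX r₂) (h₁.inX.mono (n₁.trans hρ'))
        (h₂.inX.mono (n₂.trans hρ')) (inX_zero (le_max_right _ _)) (inX_zero (le_max_right _ _))
        (fun z => (b₁ z).trans hδ') (fun z => (b₂ z).trans hδ') hz hz
        (by simpa using h₁.inX.mono (le_add_of_nonneg_right (normX_nonneg r₂)))
        (by simpa using h₂.inX.mono (le_add_of_nonneg_left (normX_nonneg r₁))) hu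
        isReconstruction_zero
      simpa only [sub_zero] using this
    · exact hc r₁ _ r₂ _ s₁ _ s₂ _ u w v y _ (h₁.inX.mono (n₁.trans hρ'))
        (h₂.inX.mono (n₂.trans hρ')) (k₁.inX.mono (m₁.trans hρ')) (k₂.inX.mono (m₂.trans hρ'))
        (fun z => (b₁ z).trans hδ') (fun z => (b₂ z).trans hδ') (fun z => (e₁ z).trans hδ')
        (fun z => (e₂ z).trans hδ')
        ((h₁.inX_sub k₁).mono (le_add_of_nonneg_right (normX_nonneg _)))
        ((h₂.inX_sub k₂).mono (le_add_of_nonneg_left (normX_nonneg _))) hu hv
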